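/- **Theorem (The curvature of a planar 5-web of maximum rank equals zero).** *Setting.* Let $W$ be a smooth planar 5-web on a domain (connected open set) $\mathbb D\subset\mathbb R^2$, given by five smooth 1-forms, any two of which are linearly independent at every point of $\mathbb D$. The 1-forms defining the foliations can be rescaled by nonvanishing functions to smooth forms $\omega_1,\dots,\omega_5$ with $$\omega_1+\omega_2+\omega_3=0,\qquad a\,\omega_1+\omega_2+\omega_4=0,\qquad b\,\omega_1+\omega_2+\omega_5=0 ,$$ where the functions $a,b$ (the basic invariants) satisfy $a,b\neq 0,1$ and $a\ne b$ everywhere. Fix any such normalization. *Curvature.* For a 3-web $\langle\rho_1,\rho_2,\rho_3\rangle$ with $\rho_1+\rho_2+\rho_3=0$ let $\gamma$ be the unique 1-form with $d\rho_i=\rho_i\wedge\gamma$, and define its curvature function by $d\gamma=K\rho_1\wedge\rho_2$. The curvature $L$ of the 5-web is the weighted mean of the curvatures of its ten 3-subwebs, $$10\,L\;\omega_1\wedge\omega_2=\sum_{[l,m,n]}K[l,m,n]\,\rho_1\wedge\rho_2 ,$$ where $(\rho_1,\rho_2)$ is - $(\omega_1,\omega_2)$ for $[1,2,3]$, - $(a\omega_1,\omega_2)$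 for $[1,2,4]$, - $((a-1)\omega_1,-\omega_3)$ for $[1,3,4]$, - $((a-1)\omega_2,a\omega_3)$ for $[2,3,4]$, - $(b\omega_1,\omega_2)$, $((b-1)\omega_1,-\omega_3)$, $((b-1)\omega_2,b\omega_3)$ for $[1,2,5]$, $[1,3,5]$, $[2,3,5]$, - $((a-b)\omega_1,\omega_4)$ for $[1,4,5]$, - $(\tfrac{b-a}{b}\omega_2,\omega_4)$ for $[2,4,5]$, - $((a-b)\omega_3,-(1-b)\omega_4)$ for $[3,4,5]$. *Obstruction.* Let $K=K[1,2,3]$, let $\gamma=g_1\omega_1+g_2\omega_2$ be the connection form of $[1,2,3]$, let $\partial_1,\partial_2$ be the frame dual to $\omega_1,\omega_2$, and let $\delta_i u=\partial_i u-k\,g_i u$ for a function $u$ of weight $k$ (then $\delta_iu$ has weight $k+1$). Subscripts $1,2$ denote these covariant derivatives; $a,b$ have weight $0$. Put $\Delta_1=\delta_1-\delta_2$, $\Delta_2=\delta_1-\delta_2\circ a$, $\Delta_3=\delta_1-\delta_2\circ b$. The abelian equation of the web, for functions $w,u,v$ of weight $1$, is $$\Delta_1w=0,\quad \Delta_2u=0,\quad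 \Delta_3v=0,\quad \delta_1w+\delta_1u+\delta_1v=0 .$$ Let $\mathfrak A_3$ be its second prolongation: the bundle of 3-jets of $(w,u,v)$ at points $p$ for which the four left-hand sides vanish at $p$ together with their derivatives of order at most $2$. The obstruction is the multi-bracket of the four equations, taken with the normalizing factor $\bigl(-10(1-a)(1-b)\bigr)^{-1}$, restricted to $\mathfrak A_3$: $$\varkappa=\frac{(\Delta_1\Delta_2\Delta_3\delta_1-\delta_1\Delta_2\Delta_3\Delta_1)w+(\Delta_1\Delta_2\Delta_3\delta_1-\Delta_1\delta_1\Delta_3\Delta_2)u+(\Delta_1\Delta_2\Delta_3\delta_1-\Delta_1\Delta_2\delta_1\Delta_3)v}{-10(1-a)(1-b)} .$$ *Claims.* 1. At every point $p\in\mathbb D$ there are unique numbers $c_0,\dots,c_5$ such that, on the fibre of $\mathfrak A_3$ over $p$, $$\varkappa=c_0w_{22}+c_1w_2+c_2v_2+c_3w+c_4u+c_5v .$$ The coefficient $c_0$ is given by $$c_0=K+R[a,b]+R[b,a]-\frac{a-a^2+b-b^2-4ab+2a^2b+2ab^2}{10(a-1)a(a-b)^2(b-1)b}a_1b_1+\frac{2a-a^2+2b-b^2-4ab+a^2b+ab^2}{10(a-1)(a-b)^2(b-1)}a_2b_2,$$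 where $$\begin{aligned}R[a,b]={}&\frac{(1-3a+b)a_{11}+(4a-3a^2-3b+4ab)a_{12}+(a^2-3ab+a^2b)a_{22}}{10(a-1)a(a-b)}\\&+\frac{2a-6a^2+6a^3-b+4ab-6a^2b-b^2+2ab^2}{10(a-1)^2a^2(a-b)^2}a_1^2\\&+\frac{4a^2-8a^3+3a^4-6ab+14a^2b-8a^3b+3b^2-6ab^2+4a^2b^2}{10(a-1)^2a^2(a-b)^2}a_1a_2\\&+\frac{-a^4-2a^2b+6a^3b-a^4b-2a^2b^2}{10(a-1)^2a^2(a-b)^2}a_2^2+\frac{ab-1}{10(a-1)(a-b)^2(b-1)}a_1b_2,\end{aligned}$$ and it equals the curvature of the 5-web at $p$: $c_0=L(p)$. 2. If $W$ is of maximum rank, that is, if the space of tuples of smooth functions $(\lambda_1,\dots,\lambda_5)$ on $\mathbb D$ with $\sum_i\lambda_i\omega_i=0$ and $d(\lambda_i\omega_i)=0$ for all $i$ has dimension $6$, then $L=0$ on $\mathbb D$. -/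

import Mathlib

open scoped ContDiff

namespace PlanarWebs

noncomputable section

/-! ### Differential forms on plane domains -/

/-- The plane with its standard coordinates `x`, `y`. -/
abbrev Plane : Type := ℝ × ℝ

/-- Differential `1`-forms. -/
abbrev OneForm : Type := Plane → Plane →L[ℝ] ℝ

/-- The coordinate vector field `∂/∂x`. -/
abbrev ex : Plane := (1, 0)

/-- The coordinate vector field `∂/∂y`. -/
abbrev ey : Plane := (0, 1)

/-- The wedge product `α ∧ β`. A `2`-form on the plane is recorded by its coefficient with
respect to `dx ∧ dy`, that is, by its value on the pair `(∂/∂x, ∂/∂y)`. -/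
def wedge (α β : OneForm) (p : Plane) : ℝ :=
  α p ex * β p ey - α p ey * β p ex

/-- The exterior derivative of a `1`-form, again recorded by its coefficient with respect to
`dx ∧ dy`. -/
def extD (α : OneForm) (p : Plane) : ℝ :=
  fderiv ℝ α p ex ey - fderiv ℝ α p ey ex

/-- `extD` is the value of Mathlib's exterior derivative on `(∂/∂x, ∂/∂y)`. -/
theorem extD_eq_extDeriv (α : OneForm) (p : Plane) (h : DifferentiableAt ℝ α p) :
    extD α p = extDeriv (fun q => ContinuousAlternatingMap.ofSubsingletonLIE (0 : Fin 1) (α q)) p ![ex, ey] := by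
  have e : (fun q => ContinuousAlternatingMap.ofSubsingletonLIE (𝕜 := ℝ) (E := Plane) (F := ℝ) (0 : Fin 1) (α q)) =
      (ContinuousAlternatingMap.ofSubsingletonLIE (𝕜 := ℝ) (E := Plane) (F := ℝ) (0 : Fin 1)) ∘ α := rfl
  have hd : DifferentiableAt ℝ
      (fun q => ContinuousAlternatingMap.ofSubsingletonLIE (𝕜 := ℝ) (E := Plane) (F := ℝ) (0 : Fin 1) (α q)) p := by
    rw [e]
    exact (ContinuousAlternatingMap.ofSubsingletonLIE (0 : Fin 1)).differentiable.differentiableAt.comp p h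
  have hv : ∀ v : Fin 1 → Plane, (fun q => ContinuousAlternatingMap.ofSubsingletonLIE
      (𝕜 := ℝ) (E := Plane) (F := ℝ) (0 : Fin 1) (α q) v) = fun q => α q (v 0) := fun v => rfl
  rw [extDeriv_apply hd]
  simp only [hv, fderiv_clm_apply h (differentiableAt_const _)]
  simp [extD, Fin.removeNth, sub_eq_add_neg]

theorem covector_ext {α β : Plane →L[ℝ] ℝ} (hx : α ex = β ex) (hy : α ey = β ey) : α = β := by
  ext
  · simpa using hx
  · simpa using hy

theorem extD_add (α β : OneForm) (p : Plane) (hα : DifferentiableAt ℝ α p)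
    (hβ : DifferentiableAt ℝ β p) :
    extD (fun q => α q + β q) p = extD α p + extD β p := by
  simp only [extD, fderiv_fun_add hα hβ, add_apply]
  ring

theorem extD_const_smul (r : ℝ) (α : OneForm) (p : Plane) (hα : DifferentiableAt ℝ α p) :
    extD (fun q => r • α q) p = r * extD α p := by
  simp only [extD, fderiv_fun_const_smul hα, smul_apply, smul_eq_mul]
  ring

/-! ### Planar webs and their rank -/

/-- A (smooth) planar `d`-web on a domain: `d` one-dimensional foliations in general position,
given by `d` smooth differential `1`-forms, any two of which are linearly independent at each
point. -/
structure PlanarWeb (d : ℕ) where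
  /-- the domain on which the web lives -/
  domain : Set Plane
  isOpen_domain : IsOpen domain
  isConnected_domain : IsConnected domain
  /-- the `1`-forms whose kernels are tangent to the foliations -/
  form : Fin d → OneForm
  smooth_form : ∀ i, ContDiffOn ℝ ∞ (form i) domain
  general_position : ∀ i j, i ≠ j → ∀ p ∈ domain, LinearIndependent ℝ ![form i p, form j p]

/-- The solution space of the abelian equation of a web: tuples of smooth functions `lam i` on
the domain such that `∑ lam i • form i = 0` and all the forms `lam i • form i` are closed. (The
functions are extended by zero outside the domain, so that a solution on the domain is
represented by exactly one tuple.) -/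
def PlanarWeb.abelianSolutions {d : ℕ} (W : PlanarWeb d) : Submodule ℝ (Fin d → Plane → ℝ) where
  carrier := {lam | (∀ i, ContDiffOn ℝ ∞ (lam i) W.domain) ∧
    (∀ i, ∀ p, p ∉ W.domain → lam i p = 0) ∧
    (∀ p ∈ W.domain, ∑ i, lam i p • W.form i p = 0) ∧
    (∀ i, ∀ p ∈ W.domain, extD (fun q => lam i q • W.form i q) p = 0)}
  zero_mem' := by
    refine ⟨fun i => contDiffOn_const, fun i p _ => rfl, fun p _ => ?_, fun i p _ => ?_⟩
    · simp
    · simp [extD]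
  add_mem' := by
    rintro lam mu ⟨h1, h2, h3, h4⟩ ⟨k1, k2, k3, k4⟩
    have hd : ∀ (f : Plane → ℝ) (i : Fin d) (p : Plane), ContDiffOn ℝ ∞ f W.domain →
        p ∈ W.domain → DifferentiableAt ℝ (fun q => f q • W.form i q) p := by
      intro f i p hf hp
      exact ((hf.smul (W.smooth_form i)).contDiffAt
        (W.isOpen_domain.mem_nhds hp)).differentiableAt (by simp)
    refine ⟨fun i => (h1 i).add (k1 i), fun i p hp => ?_, fun p hp => ?_, fun i p hp => ?_⟩
    · simp [h2 i p hp, k2 i p hp]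
    · simp [add_smul, Finset.sum_add_distrib, h3 p hp, k3 p hp]
    · simp only [Pi.add_apply, add_smul]
      rw [extD_add _ _ p (hd _ i p (h1 i) hp) (hd _ i p (k1 i) hp), h4 i p hp, k4 i p hp, add_zero]
  smul_mem' := by
    rintro r lam ⟨h1, h2, h3, h4⟩
    have hd : ∀ (f : Plane → ℝ) (i : Fin d) (p : Plane), ContDiffOn ℝ ∞ f W.domain →
        p ∈ W.domain → DifferentiableAt ℝ (fun q => f q • W.form i q) p := by
      intro f i p hf hp
      exact ((hf.smul (W.smooth_form i)).contDiffAt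
        (W.isOpen_domain.mem_nhds hp)).differentiableAt (by simp)
    refine ⟨fun i => (h1 i).const_smul r, fun i p hp => ?_, fun p hp => ?_, fun i p hp => ?_⟩
    · simp [h2 i p hp]
    · simp [mul_smul, ← Finset.smul_sum, h3 p hp]
    · simp only [Pi.smul_apply, smul_assoc]
      rw [extD_const_smul r _ p (hd _ i p (h1 i) hp), h4 i p hp, mul_zero]

/-- The rank of a web: the dimension of the solution space of its abelian equation. -/
def PlanarWeb.rank {d : ℕ} (W : PlanarWeb d) : ℕ :=
  Module.finrank ℝ W.abelianSolutions

/-- A planar `d`-web is of maximum rank if its rank equals Bol's bound `(d - 1)(d - 2) / 2`. -/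
def PlanarWeb.IsOfMaximumRank {d : ℕ} (W : PlanarWeb d) : Prop :=
  W.rank = (d - 1) * (d - 2) / 2

/-! ### The Chern connection and the curvature of a `3`-web

A `3`-web is normalized by `ρ₁ + ρ₂ + ρ₃ = 0`, and is then determined by the coframe `ρ₁, ρ₂`. -/

/-- The coefficient `g₁` of the connection form `γ = g₁ ρ₁ + g₂ ρ₂`. -/
def g₁ (ρ₁ ρ₂ : OneForm) (p : Plane) : ℝ := -extD ρ₂ p / wedge ρ₁ ρ₂ p

/-- The coefficient `g₂` of the connection form `γ = g₁ ρ₁ + g₂ ρ₂`. -/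
def g₂ (ρ₁ ρ₂ : OneForm) (p : Plane) : ℝ := extD ρ₁ p / wedge ρ₁ ρ₂ p

/-- The form `γ` of the Chern connection of the `3`-web `⟨ρ₁, ρ₂, ρ₃⟩`, `ρ₁ + ρ₂ + ρ₃ = 0`. -/
def connectionForm (ρ₁ ρ₂ : OneForm) : OneForm :=
  fun p => g₁ ρ₁ ρ₂ p • ρ₁ p + g₂ ρ₁ ρ₂ p • ρ₂ p

/-- `γ` is the unique form that satisfies the structure equations `dρᵢ = ρᵢ ∧ γ`. -/
theorem structure_equations_iff (ρ₁ ρ₂ γ : OneForm) (p : Plane) (h : wedge ρ₁ ρ₂ p ≠ 0) :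
    (extD ρ₁ p = wedge ρ₁ γ p ∧ extD ρ₂ p = wedge ρ₂ γ p) ↔ γ p = connectionForm ρ₁ ρ₂ p := by
  constructor
  · rintro ⟨h₁, h₂⟩
    apply covector_ext <;>
    · simp only [connectionForm, g₁, g₂, h₁, h₂, add_apply,
        smul_apply, smul_eq_mul]
      field_simp
      simp only [wedge]
      ring
  · intro hγ
    have key : ∀ ρ : OneForm, wedge ρ γ p = g₁ ρ₁ ρ₂ p * wedge ρ ρ₁ p
        + g₂ ρ₁ ρ₂ p * wedge ρ ρ₂ p := by
      intro ρ
      simp only [wedge, hγ, connectionForm, add_apply,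
        smul_apply, smul_eq_mul]
      ring
    have h11 : wedge ρ₁ ρ₁ p = 0 := by simp only [wedge]; ring
    have h22 : wedge ρ₂ ρ₂ p = 0 := by simp only [wedge]; ring
    have h21 : wedge ρ₂ ρ₁ p = -wedge ρ₁ ρ₂ p := by simp only [wedge]; ring
    rw [key, key, h11, h22, h21]
    simp only [g₁, g₂]
    constructor <;> field_simp <;> ring

/-- The curvature function `K` of the `3`-web `⟨ρ₁, ρ₂, ρ₃⟩`, `ρ₁ + ρ₂ + ρ₃ = 0`, defined by
`dγ = K ρ₁ ∧ ρ₂`. -/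
def curvatureFunction (ρ₁ ρ₂ : OneForm) (p : Plane) : ℝ :=
  extD (connectionForm ρ₁ ρ₂) p / wedge ρ₁ ρ₂ p

/-! ### Covariant derivatives -/

/-- The derivatives of a function along the frame `∂₁, ∂₂` dual to `ω₁, ω₂`
(index `0` stands for `∂₁`, index `1` for `∂₂`): `df = ∂₁ f ω₁ + ∂₂ f ω₂`. -/
def frameDeriv (ω₁ ω₂ : OneForm) (i : Fin 2) (f : Plane → ℝ) (p : Plane) : ℝ :=
  ![wedge (fderiv ℝ f) ω₂ p / wedge ω₁ ω₂ p, wedge ω₁ (fderiv ℝ f) p / wedge ω₁ ω₂ p] i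

theorem fderiv_eq_frameDeriv (ω₁ ω₂ : OneForm) (f : Plane → ℝ) (p : Plane)
    (h : wedge ω₁ ω₂ p ≠ 0) :
    fderiv ℝ f p = frameDeriv ω₁ ω₂ 0 f p • ω₁ p + frameDeriv ω₁ ω₂ 1 f p • ω₂ p := by
  apply covector_ext <;>
  · simp only [frameDeriv, Matrix.cons_val_zero, Matrix.cons_val_one,
      add_apply, smul_apply, smul_eq_mul]
    field_simp
    simp only [wedge]
    ring

/-- The covariant derivative `δᵢ⁽ʷ⁾ u = ∂ᵢ u - w gᵢ u` of a function `u` of weight `w`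
with respect to the Chern connection of `⟨ω₁, ω₂, -ω₁ - ω₂⟩`; it has weight `w + 1`. -/
def covDeriv (ω₁ ω₂ : OneForm) (i : Fin 2) (w : ℕ) (u : Plane → ℝ) (p : Plane) : ℝ :=
  frameDeriv ω₁ ω₂ i u p - w * ![g₁ ω₁ ω₂ p, g₂ ω₁ ω₂ p] i * u p

/-- The operator `Δ = δ₁ - δ₂ ∘ A` on functions of weight `w`, for a function `A` of weight `0`. -/
def deltaOp (ω₁ ω₂ : OneForm) (A : Plane → ℝ) (w : ℕ) (u : Plane → ℝ) (p : Plane) : ℝ :=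
  covDeriv ω₁ ω₂ 0 w u p - covDeriv ω₁ ω₂ 1 w (fun q => A q * u q) p

/-! ### Normalized `5`-webs -/

/-- The forms `ω₁, …, ω₅` (written `θ 0, …, θ 4`) define the same foliations as the `5`-web `W`
and are normalized by `ω₁ + ω₂ + ω₃ = 0`, `a ω₁ + ω₂ + ω₄ = 0`, `b ω₁ + ω₂ + ω₅ = 0`;
`a` and `b` are the basic invariants. -/
structure IsNormalization (W : PlanarWeb 5) (θ : Fin 5 → OneForm) (a b : Plane → ℝ) : Prop where
  smooth : ∀ i, ContDiffOn ℝ ∞ (θ i) W.domain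
  same_foliations : ∀ i, ∀ p ∈ W.domain, ∃ s : ℝ, s ≠ 0 ∧ θ i p = s • W.form i p
  relation₃ : ∀ p ∈ W.domain, θ 0 p + θ 1 p + θ 2 p = 0
  relation₄ : ∀ p ∈ W.domain, a p • θ 0 p + θ 1 p + θ 3 p = 0
  relation₅ : ∀ p ∈ W.domain, b p • θ 0 p + θ 1 p + θ 4 p = 0

/-- The ten `3`-subwebs of a normalized `5`-web, each with its normalization (the three forms
of each subweb add up to zero), in the order `[1,2,3]`, `[1,2,4]`, `[1,3,4]`, `[2,3,4]`,
`[1,2,5]`, `[1,3,5]`, `[2,3,5]`, `[1,4,5]`, `[2,4,5]`, `[3,4,5]`. -/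
def subwebForm (θ : Fin 5 → OneForm) (a b : Plane → ℝ) : Fin 10 → Fin 3 → OneForm :=
  ![![θ 0, θ 1, θ 2],
    ![fun p => a p • θ 0 p, θ 1, θ 3],
    ![fun p => (a p - 1) • θ 0 p, fun p => -θ 2 p, θ 3],
    ![fun p => (a p - 1) • θ 1 p, fun p => a p • θ 2 p, fun p => -θ 3 p],
    ![fun p => b p • θ 0 p, θ 1, θ 4],
    ![fun p => (b p - 1) • θ 0 p, fun p => -θ 2 p, θ 4],
    ![fun p => (b p - 1) • θ 1 p, fun p => b p • θ 2 p, fun p => -θ 4 p],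
    ![fun p => (a p - b p) • θ 0 p, θ 3, fun p => -θ 4 p],
    ![fun p => ((b p - a p) / b p) • θ 1 p, θ 3, fun p => -(a p / b p) • θ 4 p],
    ![fun p => (a p - b p) • θ 2 p, fun p => -(1 - b p) • θ 3 p, fun p => -(a p - 1) • θ 4 p]]

theorem sum_subwebForm_eq_zero (W : PlanarWeb 5) (θ : Fin 5 → OneForm) (a b : Plane → ℝ)
    (h : IsNormalization W θ a b) (p : Plane) (hp : p ∈ W.domain) (hb : b p ≠ 0) (k : Fin 10) :
    ∑ j, subwebForm θ a b k j p = 0 := by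
  have r₂ : θ 2 p = -θ 0 p - θ 1 p := by
    rw [← sub_eq_zero, ← h.relation₃ p hp]; abel
  have r₃ : θ 3 p = -(a p • θ 0 p) - θ 1 p := by
    rw [← sub_eq_zero, ← h.relation₄ p hp]; abel
  have r₄ : θ 4 p = -(b p • θ 0 p) - θ 1 p := by
    rw [← sub_eq_zero, ← h.relation₅ p hp]; abel
  have e : b p * (b p)⁻¹ = 1 := mul_inv_cancel₀ hb
  fin_cases k <;> simp [subwebForm, Fin.sum_univ_three, r₂, r₃, r₄] <;>
    apply covector_ext <;> simp <;> field_simp <;> ring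

/-- The curvature `L` of a normalized `5`-web, the weighted mean of the curvatures of its
`3`-subwebs: `10 L ω₁ ∧ ω₂ = ∑ K[l,m,n] ρ₁ ∧ ρ₂`, where the sum is over the ten `3`-subwebs
`[l,m,n]`, normalized by `ρ₁ + ρ₂ + ρ₃ = 0` as above. -/
def webCurvature (θ : Fin 5 → OneForm) (a b : Plane → ℝ) (p : Plane) : ℝ :=
  (∑ k, curvatureFunction (subwebForm θ a b k 0) (subwebForm θ a b k 1) p *
    wedge (subwebForm θ a b k 0) (subwebForm θ a b k 1) p) / (10 * wedge (θ 0) (θ 1) p)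

/-! ### The abelian equation in normalized form and its obstruction

An abelian relation is `(w + a u + b v) ω₁ + (w + u + v) ω₂ + w ω₃ + u ω₄ + v ω₅ = 0`, with
`w, u, v` of weight `1`. -/

/-- The left-hand sides `Δ₁ w`, `Δ₂ u`, `Δ₃ v`, `δ₁ w + δ₁ u + δ₁ v` of the abelian equation,
where `Δ₁ = δ₁ - δ₂`, `Δ₂ = δ₁ - δ₂ ∘ a`, `Δ₃ = δ₁ - δ₂ ∘ b`. -/
def abelianLHS (ω₁ ω₂ : OneForm) (a b : Plane → ℝ) (w u v : Plane → ℝ) :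
    Fin 4 → Plane → ℝ :=
  ![deltaOp ω₁ ω₂ 1 1 w, deltaOp ω₁ ω₂ a 1 u, deltaOp ω₁ ω₂ b 1 v,
    fun q => covDeriv ω₁ ω₂ 0 1 w q + covDeriv ω₁ ω₂ 0 1 u q + covDeriv ω₁ ω₂ 0 1 v q]

/-- The `3`-jet of the (smooth) section `(w, u, v)` at `p` belongs to the second prolongation
`𝔄₃` of the abelian equation: the left-hand sides of the equation vanish at `p` together with
their derivatives up to order two. -/
def JetMemA₃ (ω₁ ω₂ : OneForm) (a b : Plane → ℝ) (w u v : Plane → ℝ) (p : Plane) : Prop :=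
  ∀ j, ∀ k ≤ 2, iteratedFDeriv ℝ k (abelianLHS ω₁ ω₂ a b w u v j) p = 0

/-- The multi-bracket of the abelian equation,
`(Δ₁Δ₂Δ₃δ₁ - δ₁Δ₂Δ₃Δ₁) w + (Δ₁Δ₂Δ₃δ₁ - Δ₁δ₁Δ₃Δ₂) u + (Δ₁Δ₂Δ₃δ₁ - Δ₁Δ₂δ₁Δ₃) v`.
Every operator acts on functions of the weight that its place in the composition dictates. -/
def multiBracket (ω₁ ω₂ : OneForm) (a b : Plane → ℝ) (w u v : Plane → ℝ) (p : Plane) : ℝ :=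
  let δ₁ := covDeriv ω₁ ω₂ 0
  let Δ₁ := deltaOp ω₁ ω₂ 1
  let Δ₂ := deltaOp ω₁ ω₂ a
  let Δ₃ := deltaOp ω₁ ω₂ b
  (Δ₁ 4 (Δ₂ 3 (Δ₃ 2 (δ₁ 1 w))) p - δ₁ 4 (Δ₂ 3 (Δ₃ 2 (Δ₁ 1 w))) p) +
  (Δ₁ 4 (Δ₂ 3 (Δ₃ 2 (δ₁ 1 u))) p - Δ₁ 4 (δ₁ 3 (Δ₃ 2 (Δ₂ 1 u))) p) +
  (Δ₁ 4 (Δ₂ 3 (Δ₃ 2 (δ₁ 1 v))) p - Δ₁ 4 (Δ₂ 3 (δ₁ 2 (Δ₃ 1 v))) p)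

/-- The obstruction `ϰ`: the multi-bracket of the abelian equation, divided by the nowhere
vanishing function `-10 (1 - a) (1 - b)`. This is the normalization of the equation `ϰ = 0` for
which the curvature function `K` of `[1,2,3]` enters the coefficient `c₀` with the factor one. -/
def obstruction (ω₁ ω₂ : OneForm) (a b : Plane → ℝ) (w u v : Plane → ℝ) (p : Plane) : ℝ :=
  multiBracket ω₁ ω₂ a b w u v p / (-10 * (1 - a p) * (1 - b p))

/-- The numbers `c 0, …, c 5` are the coefficients at `p` of the restriction of the obstruction
to `𝔄₃` in the canonical coordinates `w₂₂, w₂, v₂, w, u, v` (subscripts are covariant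
derivatives): `ϰ = c₀ w₂₂ + c₁ w₂ + c₂ v₂ + c₃ w + c₄ u + c₅ v`. -/
def IsObstructionCoefficients (ω₁ ω₂ : OneForm) (a b : Plane → ℝ) (p : Plane)
    (c : Fin 6 → ℝ) : Prop :=
  ∀ w u v : Plane → ℝ, ContDiffAt ℝ ∞ w p → ContDiffAt ℝ ∞ u p → ContDiffAt ℝ ∞ v p →
    JetMemA₃ ω₁ ω₂ a b w u v p →
    obstruction ω₁ ω₂ a b w u v p =
      c 0 * covDeriv ω₁ ω₂ 1 2 (covDeriv ω₁ ω₂ 1 1 w) p + c 1 * covDeriv ω₁ ω₂ 1 1 w p +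
      c 2 * covDeriv ω₁ ω₂ 1 1 v p + c 3 * w p + c 4 * u p + c 5 * v p

/-! ### The explicit expression of `c₀` through the invariants -/

/-- The expression `R[a, b]`. -/
def exprR (a a₁ a₂ a₁₁ a₁₂ a₂₂ b b₂ : ℝ) : ℝ :=
  ((1 - 3 * a + b) * a₁₁ + (4 * a - 3 * a ^ 2 - 3 * b + 4 * a * b) * a₁₂
      + (a ^ 2 - 3 * a * b + a ^ 2 * b) * a₂₂) / (10 * (-1 + a) * a * (a - b))
  + (2 * a - 6 * a ^ 2 + 6 * a ^ 3 - b + 4 * a * b - 6 * a ^ 2 * b - b ^ 2 + 2 * a * b ^ 2)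
      / (10 * (-1 + a) ^ 2 * a ^ 2 * (a - b) ^ 2) * a₁ ^ 2
  + (4 * a ^ 2 - 8 * a ^ 3 + 3 * a ^ 4 - 6 * a * b + 14 * a ^ 2 * b - 8 * a ^ 3 * b + 3 * b ^ 2
      - 6 * a * b ^ 2 + 4 * a ^ 2 * b ^ 2)
      / (10 * (-1 + a) ^ 2 * a ^ 2 * (a - b) ^ 2) * (a₁ * a₂)
  + (-a ^ 4 - 2 * a ^ 2 * b + 6 * a ^ 3 * b - a ^ 4 * b - 2 * a ^ 2 * b ^ 2)
      / (10 * (-1 + a) ^ 2 * a ^ 2 * (a - b) ^ 2) * a₂ ^ 2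
  + (-1 + a * b) / (10 * (-1 + a) * (a - b) ^ 2 * (-1 + b)) * (a₁ * b₂)

/-- The expression of `c₀` through the curvature function `K` of `[1,2,3]`, the basic
invariants `a`, `b` and their covariant derivatives of the first and second order. -/
def c₀Expression (ω₁ ω₂ : OneForm) (A B : Plane → ℝ) (p : Plane) : ℝ :=
  let δ := covDeriv ω₁ ω₂
  let K := curvatureFunction ω₁ ω₂ p
  let a := A p
  let a₁ := δ 0 0 A p
  let a₂ := δ 1 0 A p
  let a₁₁ := δ 0 1 (δ 0 0 A) p
  let a₁₂ := δ 0 1 (δ 1 0 A) p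
  let a₂₂ := δ 1 1 (δ 1 0 A) p
  let b := B p
  let b₁ := δ 0 0 B p
  let b₂ := δ 1 0 B p
  let b₁₁ := δ 0 1 (δ 0 0 B) p
  let b₁₂ := δ 0 1 (δ 1 0 B) p
  let b₂₂ := δ 1 1 (δ 1 0 B) p
  K + exprR a a₁ a₂ a₁₁ a₁₂ a₂₂ b b₂ + exprR b b₁ b₂ b₁₁ b₁₂ b₂₂ a a₂
  - (a - a ^ 2 + b - b ^ 2 - 4 * a * b + 2 * a ^ 2 * b + 2 * a * b ^ 2)
      / (10 * (-1 + a) * a * (a - b) ^ 2 * (-1 + b) * b) * (a₁ * b₁)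
  + (2 * a - a ^ 2 + 2 * b - b ^ 2 - 4 * a * b + a ^ 2 * b + a * b ^ 2)
      / (10 * (-1 + a) * (a - b) ^ 2 * (-1 + b)) * (a₂ * b₂)

end

end PlanarWebs

/-! The obstruction is linear in the 3-jet of `(w, u, v)`, so the first claim is linear algebra on
the fibre of 𝔄₃. There Δ₁w = Δ₂u = Δ₃v = 0 express every derivative through pure ∇₂-derivatives,
with slopes 1, a, b. The fourth equation and its derivatives then become linear systems of
Vandermonde type with nodes 1, a, b. As a, b, 1 - a, 1 - b, a - b are invertible, the whole 3-jet is
determined by w₂₂, w₂, v₂, w, u, v (`killsThreeJet_of_coordinates`). Three 3-jets have 30 parameters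
and the prolonged equations are 24 conditions, so these six numbers are also arbitrary
(`coordinates_surjective`). Hence the coefficients exist and are unique, and c₀ is read off where
the other five coordinates vanish. There the fourth order terms cancel, commutators contribute K,
and elimination of the third order terms leaves the rational expression (`bracket_eq`,
`bracket_scalar_identity`).

The equality with L is a separate computation. The connection form of each 3-subweb differs from γ
by an explicit form s₁ω₁ + s₂ω₂, whence K[l,m,n] ρ₁∧ρ₂ = (K + ∇₁s₂ - ∇₂s₁) ω₁∧ω₂
(`curvatureFunction_mul_wedge`); the sum of the ten corrections is the same rational expression
(`sum_connectionShift`).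

On a genuine solution the multi-bracket vanishes (`bracketGerm_eq_zero`). The six coordinates of a
solution satisfy a linear total differential system, so they determine the solution by their values
at one point (`coordinates_solutionGerms_injective`). If the rank is 6 they can be prescribed there,
and a solution with w₂₂ = 1 and the rest zero forces c₀ = 0.

The jet computations are made for derivations of a commutative ring, followed by a homomorphism π
into an arbitrary ring. With π the evaluation at a point they describe 𝔄₃; with π the reduction of
germs modulo the ideal of the six coordinates they give the differential system. -/

namespace PlanarWebs
noncomputable section

/-! ### Algebra of the abelian equation over a ring with two derivations -/

/-- Two covariant derivatives `∇₁, ∇₂` of a connection with curvature `κ`, acting as derivations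
of a ring of weighted functions whose weights are recorded by the Euler derivation. -/
structure WeightedCalculus (S : Type*) [CommRing S] where
  d₁ : Derivation ℤ S S
  d₂ : Derivation ℤ S S
  euler : Derivation ℤ S S
  κ : S
  comm : ∀ x, d₁ (d₂ x) = d₂ (d₁ x) - κ * euler x
  euler_d₁ : ∀ x, euler (d₁ x) = d₁ (euler x) + d₁ x
  euler_d₂ : ∀ x, euler (d₂ x) = d₂ (euler x) + d₂ x

namespace WeightedCalculus

variable {S : Type*} [CommRing S] (C : WeightedCalculus S)

/-- The operator `∇₁ - ∇₂ ∘ a`. -/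
def delta (a x : S) : S := C.d₁ x - C.d₂ (a * x)

/-- The multi-bracket of the abelian equation. -/
def bracket (a b w u v : S) : S :=
  (C.delta 1 (C.delta a (C.delta b (C.d₁ w))) - C.d₁ (C.delta a (C.delta b (C.delta 1 w)))) +
  (C.delta 1 (C.delta a (C.delta b (C.d₁ u))) - C.delta 1 (C.d₁ (C.delta b (C.delta a u)))) +
  (C.delta 1 (C.delta a (C.delta b (C.d₁ v))) - C.delta 1 (C.delta a (C.d₁ (C.delta b v))))

/-- The homomorphism `π` kills the `2`-jet of `x`. -/
structure KillsTwoJet {Q : Type*} [CommRing Q] (π : S →+* Q) (x : S) : Prop where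
  h : π x = 0
  h₁ : π (C.d₁ x) = 0
  h₂ : π (C.d₂ x) = 0
  h₁₁ : π (C.d₁ (C.d₁ x)) = 0
  h₂₁ : π (C.d₂ (C.d₁ x)) = 0
  h₂₂ : π (C.d₂ (C.d₂ x)) = 0

/-- The homomorphism `π` kills the `3`-jet of `x`. -/
structure KillsThreeJet {Q : Type*} [CommRing Q] (π : S →+* Q) (x : S) : Prop
    extends C.KillsTwoJet π x where
  h₁₁₁ : π (C.d₁ (C.d₁ (C.d₁ x))) = 0
  h₂₁₁ : π (C.d₂ (C.d₁ (C.d₁ x))) = 0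
  h₂₂₁ : π (C.d₂ (C.d₂ (C.d₁ x))) = 0
  h₂₂₂ : π (C.d₂ (C.d₂ (C.d₂ x))) = 0

/-- The homomorphism `π` kills the `2`-jets of the left-hand sides of the abelian equation. -/
structure KillsEquations {Q : Type*} [CommRing Q] (π : S →+* Q) (a b w u v : S) : Prop where
  e₁ : C.KillsTwoJet π (C.delta 1 w)
  e₂ : C.KillsTwoJet π (C.delta a u)
  e₃ : C.KillsTwoJet π (C.delta b v)
  e₄ : C.KillsTwoJet π (C.d₁ w + C.d₁ u + C.d₁ v)

/-- The images of `a`, `b`, `1 - a`, `1 - b`, `a - b` are units. -/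
structure Generic {Q : Type*} [CommRing Q] (a b : Q) : Prop where
  a_unit : IsUnit a
  b_unit : IsUnit b
  a_sub_one : IsUnit (a - 1)
  b_sub_one : IsUnit (b - 1)
  a_sub_b : IsUnit (a - b)

/-- The scalar identity behind the explicit expression of `c₀`: the third order derivatives
`W, U, V` are eliminated by Lagrange interpolation at the points `1, A, B`. -/
theorem bracket_scalar_identity {A B A1 A2 A11 A12 A22 B1 B2 B11 B12 B22 K r s t W U V : ℝ}
    (hA : A ≠ 0) (hA' : A ≠ 1) (hB : B ≠ 0) (hB' : B ≠ 1) (hAB : A ≠ B)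
    (d1 : r + A * (A * s) + B * (B * t) = 0) (d2 : r + A * s + B * t = 0)
    (d11 : W + A * s * A1 * 3 + A ^ 2 * s * A2 * 6 + A ^ 3 * U + B * t * B1 * 3
      + B ^ 2 * t * B2 * 6 + B ^ 3 * V = 0)
    (d21 : W + A * s * A2 * 5 + A ^ 2 * U + s * A1 + B * t * B2 * 5 + B ^ 2 * V + t * B1 = 0)
    (d22 : W + A * U + s * A2 * 3 + B * V + t * B2 * 3 = 0) :
    -(W * A * B2) + W * A * B1 + W * A2 - W * A2 * B - W * A1 + W * A1 * B + W * B2 - W * B1 +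
      A * U * A2 * B - A * U * A1 * 2 - A * U * A1 * B + A * U * B1 + A * s * A2 * A1 * 10 - A *
      s * A2 * B2 * 3 - A * s * A2 * B1 * 6 - A * s * A2 ^ 2 * B * 5 + A * s * A1 * B2 - A * s *
      B * K * 3 - A * s * B * A12 * 3 + A * s * B * A22 * 2 - A * s * B11 + A * s * B12 * 2 - A
      * s * A12 * 4 + A * s * A11 * 3 - A * B * V * B1 - A * B * t * K - A * B * t * B12 * 2 - A
      * B * K * r * 6 + A * B ^ 2 * t * K + A * V * B1 - A * t * B2 * B1 * 3 - A * t * B11 + A *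
      t * B12 * 3 + A * K * r * 6 + A * r * B12 * 2 - A * r * B22 * 2 - A ^ 2 * U * A2 * B + A ^
      2 * U * A1 * 2 - A ^ 2 * U * B2 - A ^ 2 * U * B1 + A ^ 2 * s * A2 * B2 * 5 + A ^ 2 * s * B
      * K * 3 - A ^ 2 * s * B * A22 + A ^ 2 * s * K * 3 - A ^ 2 * s * B22 * 2 + A ^ 2 * s * A12
      * 2 + A ^ 3 * U * B2 - A ^ 3 * s * K * 3 + A ^ 3 * s * B22 + U * A1 * B - s * A2 * A1 * 6
      - s * A2 * A1 * B * 4 + s * A2 * B1 * 3 + s * A2 ^ 2 * B * 3 + s * A1 * B2 * 2 - s * A1 *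
      B1 * 2 + s * A1 ^ 2 * 2 + s * B * A12 * 3 - s * B * A11 - s * A11 - A2 * B * t * B1 + A2 *
      t * B1 * 2 - A2 * B2 * r * 3 + A2 * B1 * r - A1 * t * B1 + A1 * B2 * r * 2 - B * V * B1 +
      B * t * B2 * B1 * 5 + B * t * B11 * 2 - B * t * B12 * 2 + B * K * r * 6 + B * r * A12 - B
      * r * A22 + B ^ 2 * V * B1 + B ^ 2 * t * K + B ^ 2 * t * B12 - B ^ 3 * t * K - t * B2 * B1
      * 3 + t * B1 ^ 2 - t * B11 - K * r * 6 - r * B11 + r * B22 - r * A12 + r * A22 =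
      -10 * (1 - A) * (1 - B) * (K + exprR A A1 A2 A11 A12 A22 B B2
        + exprR B B1 B2 B11 B12 B22 A A2
        - (A - A ^ 2 + B - B ^ 2 - 4 * A * B + 2 * A ^ 2 * B + 2 * A * B ^ 2)
          / (10 * (-1 + A) * A * (A - B) ^ 2 * (-1 + B) * B) * (A1 * B1)
        + (2 * A - A ^ 2 + 2 * B - B ^ 2 - 4 * A * B + A ^ 2 * B + A * B ^ 2)
          / (10 * (-1 + A) * (A - B) ^ 2 * (-1 + B)) * (A2 * B2)) * r := by
  have hA1 : -1 + A ≠ 0 := fun h => hA' (by linarith)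
  have hB1 : -1 + B ≠ 0 := fun h => hB' (by linarith)
  have hD : A - B ≠ 0 := sub_ne_zero.2 hAB
  obtain rfl : s = (B - 1) / (A * (A - B)) * r := by
    field_simp
    linear_combination d1 - B * d2
  obtain rfl : t = (1 - A) / (B * (A - B)) * r := by
    field_simp
    linear_combination A * d2 - d1
  -- `P`, `Q`, `R` are the coefficients of `W`, `U`, `V` divided by (1 - A)(1 - B), A(A - 1)(A - B),
  -- B(B - 1)(B - A). The coefficients of P(x - A)(x - B) + Q(x - 1)(x - B) + R(x - 1)(x - A) are
  -- the multipliers of `d11`, `d21`, `d22` in `key`; subtracting this combination removes the third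
  -- order unknowns.
  set P := (B1 - B2) / (-1 + B) + (A1 - A2) / (-1 + A) with hP
  set Q := (A1 * (2 * A - B) - A * B * A2 - A * B1 + A ^ 2 * B2) / (A * (A - B)) with hQ
  set R := B1 / B with hR
  have key : ∀ x y : ℝ, x = y + ((P + Q + R) * (W + A * ((B - 1) / (A * (A - B)) * r) * A1 * 3 + A ^ 2 * ((B - 1) / (A * (A - B)) * r) * A2 * 6 + A ^ 3 * U + B * ((1 - A) / (B * (A - B)) * r) * B1 * 3
      + B ^ 2 * ((1 - A) / (B * (A - B)) * r) * B2 * 6 + B ^ 3 * V) + (-(A + B) * P - (1 + B) * Q - (1 + A) * R) * (W + A * ((B - 1) / (A * (A - B)) * r) * A2 * 5 + A ^ 2 * U + ((B - 1) / (A * (A - B)) * r) * A1 + B * ((1 - A) / (B * (A - B)) * r) * B2 * 5 + B ^ 2 * V + ((1 - A) / (B * (A - B)) * r) * B1) + (A * B * P + B * Q + A * R) * (W + A * U + ((B - 1) / (A * (A - B)) * r) * A2 * 3 + B * V + ((1 - A) / (B * (A - B)) * r) * B2 * 3)) → x = y := by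
    intro x y h
    rw [d11, d21, d22] at h
    linarith
  apply key
  rw [hP, hQ, hR]
  clear key d11 d21 d22 d1 d2
  simp only [exprR]
  field_simp
  ring

section
variable {Q : Type*} [CommRing Q] (π : S →+* Q) {a b w u v : S}

set_option linter.unusedSimpArgs false

/-- The equations for `w` and `v` kill w₁ and v₁, the fourth one then kills u₁, and u₁ = a u₂ with a
unit a. This is why u₂ is not among the coordinates. -/
theorem first_derivatives_eq_zero (g : Generic (π a) (π b))
    (e : C.KillsEquations π a b w u v) (u0 : π u = 0) (v0 : π v = 0)
    (w2 : π (C.d₂ w) = 0) (v2 : π (C.d₂ v) = 0) :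
    π (C.d₁ w) = 0 ∧ π (C.d₁ u) = 0 ∧ π (C.d₂ u) = 0 ∧ π (C.d₁ v) = 0 := by
  have a0 := e.e₁.h
  have b0 := e.e₂.h
  have c0 := e.e₃.h
  have d0 := e.e₄.h
  simp only [delta, one_mul, map_sub, map_add, Derivation.leibniz, smul_eq_mul, map_mul, u0,
    v0, w2, v2, zero_mul, mul_zero, add_zero, sub_zero] at a0 b0 c0 d0
  rw [a0, c0, zero_add, add_zero] at d0
  rw [d0, zero_sub, neg_eq_zero] at b0
  exact ⟨a0, d0, g.a_unit.mul_right_eq_zero.1 b0, c0⟩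

/-- Once the 1-jets vanish, only the principal parts of the differentiated equations survive:
derivatives of `a`, `b` multiply terms of order at most one, and curvature multiplies an
undifferentiated function. -/
theorem second_derivatives (ha : C.euler a = 0) (hb : C.euler b = 0)
    (hw : C.euler w = w) (hu : C.euler u = u) (hv : C.euler v = v)
    (g : Generic (π a) (π b))
    (e : C.KillsEquations π a b w u v) (w0 : π w = 0) (u0 : π u = 0) (v0 : π v = 0)
    (w2 : π (C.d₂ w) = 0) (v2 : π (C.d₂ v) = 0) :
    π (C.d₁ (C.d₁ w)) = π (C.d₂ (C.d₂ w)) ∧ π (C.d₂ (C.d₁ w)) = π (C.d₂ (C.d₂ w)) ∧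
    π (C.d₁ (C.d₁ u)) = π a * (π a * π (C.d₂ (C.d₂ u))) ∧
    π (C.d₂ (C.d₁ u)) = π a * π (C.d₂ (C.d₂ u)) ∧
    π (C.d₁ (C.d₁ v)) = π b * (π b * π (C.d₂ (C.d₂ v))) ∧
    π (C.d₂ (C.d₁ v)) = π b * π (C.d₂ (C.d₂ v)) := by
  obtain ⟨w1, u1, u2, v1⟩ := C.first_derivatives_eq_zero π g e u0 v0 w2 v2
  have a1 := e.e₁.h₁
  have a2 := e.e₁.h₂
  have b1 := e.e₂.h₁
  have b2 := e.e₂.h₂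
  have c1 := e.e₃.h₁
  have c2 := e.e₃.h₂
  simp only [delta, one_mul, map_sub, map_add, Derivation.leibniz, smul_eq_mul, C.comm,
    C.euler_d₁, C.euler_d₂, ha, hb, hw, hu, hv, map_mul, map_zero, mul_zero, zero_mul, add_zero,
    zero_add, sub_zero, w0, u0, v0, w1, u1, v1, w2, u2, v2, sub_eq_zero]
    at a1 a2 b1 b2 c1 c2
  exact ⟨a1.trans a2, a2, by rw [b1, b2], b2, by rw [c1, c2], c2⟩

/-- Curvature still meets only vanishing 1-jets, but the Leibniz rule now leaves derivatives of `a`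
and `b` multiplied by u₂₂ and v₂₂. These inhomogeneous terms enter c₀. -/
theorem third_derivatives (ha : C.euler a = 0) (hb : C.euler b = 0)
    (hw : C.euler w = w) (hu : C.euler u = u) (hv : C.euler v = v)
    (g : Generic (π a) (π b))
    (e : C.KillsEquations π a b w u v) (w0 : π w = 0) (u0 : π u = 0) (v0 : π v = 0)
    (w2 : π (C.d₂ w) = 0) (v2 : π (C.d₂ v) = 0) :
    π (C.d₁ (C.d₁ (C.d₁ w))) = π (C.d₂ (C.d₂ (C.d₂ w))) ∧
    π (C.d₂ (C.d₁ (C.d₁ w))) = π (C.d₂ (C.d₂ (C.d₂ w))) ∧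
    π (C.d₂ (C.d₂ (C.d₁ w))) = π (C.d₂ (C.d₂ (C.d₂ w))) ∧
    π (C.d₁ (C.d₁ (C.d₁ u))) = π a ^ 3 * π (C.d₂ (C.d₂ (C.d₂ u))) +
      (3 * π a * π (C.d₁ a) + 6 * π a ^ 2 * π (C.d₂ a)) * π (C.d₂ (C.d₂ u)) ∧
    π (C.d₂ (C.d₁ (C.d₁ u))) = π a ^ 2 * π (C.d₂ (C.d₂ (C.d₂ u))) +
      (π (C.d₁ a) + 5 * π a * π (C.d₂ a)) * π (C.d₂ (C.d₂ u)) ∧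
    π (C.d₂ (C.d₂ (C.d₁ u))) = π a * π (C.d₂ (C.d₂ (C.d₂ u))) +
      3 * π (C.d₂ a) * π (C.d₂ (C.d₂ u)) ∧
    π (C.d₁ (C.d₁ (C.d₁ v))) = π b ^ 3 * π (C.d₂ (C.d₂ (C.d₂ v))) +
      (3 * π b * π (C.d₁ b) + 6 * π b ^ 2 * π (C.d₂ b)) * π (C.d₂ (C.d₂ v)) ∧
    π (C.d₂ (C.d₁ (C.d₁ v))) = π b ^ 2 * π (C.d₂ (C.d₂ (C.d₂ v))) +
      (π (C.d₁ b) + 5 * π b * π (C.d₂ b)) * π (C.d₂ (C.d₂ v)) ∧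
    π (C.d₂ (C.d₂ (C.d₁ v))) = π b * π (C.d₂ (C.d₂ (C.d₂ v))) +
      3 * π (C.d₂ b) * π (C.d₂ (C.d₂ v)) := by
  obtain ⟨w1, u1, u2, v1⟩ := C.first_derivatives_eq_zero π g e u0 v0 w2 v2
  obtain ⟨w11, w21, u11, u21, v11, v21⟩ :=
    C.second_derivatives π ha hb hw hu hv g e w0 u0 v0 w2 v2
  have a11 := e.e₁.h₁₁
  have a21 := e.e₁.h₂₁
  have a22 := e.e₁.h₂₂
  have b11 := e.e₂.h₁₁
  have b21 := e.e₂.h₂₁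
  have b22 := e.e₂.h₂₂
  have c11 := e.e₃.h₁₁
  have c21 := e.e₃.h₂₁
  have c22 := e.e₃.h₂₂
  simp only [delta, one_mul, map_sub, map_add, Derivation.leibniz, smul_eq_mul, C.comm,
    C.euler_d₁, C.euler_d₂, ha, hb, hw, hu, hv, map_mul, map_zero, mul_zero, zero_mul, add_zero,
    zero_add, sub_zero, w0, u0, v0, w1, u1, v1, w2, u2, v2, u11, u21, v11, v21]
    at a11 a21 a22 b11 b21 b22 c11 c21 c22
  rw [sub_eq_zero] at a11 a21 a22 b11 b21 b22 c11 c21 c22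
  rw [b22] at b21
  rw [b21] at b11
  rw [c22] at c21
  rw [c21] at c11
  refine ⟨(a11.trans a21).trans a22, a21.trans a22, a22, b11.trans ?_, b21.trans ?_, b22.trans ?_,
    c11.trans ?_, c21.trans ?_, c22.trans ?_⟩ <;> ring

/-- An element of the second prolongation of the abelian equation is determined by the
coordinates `w₂₂, w₂, v₂, w, u, v`. -/
theorem killsThreeJet_of_coordinates (ha : C.euler a = 0) (hb : C.euler b = 0)
    (hw : C.euler w = w) (hu : C.euler u = u) (hv : C.euler v = v)
    (g : Generic (π a) (π b))
    (e : C.KillsEquations π a b w u v) (w0 : π w = 0) (u0 : π u = 0) (v0 : π v = 0)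
    (w2 : π (C.d₂ w) = 0) (v2 : π (C.d₂ v) = 0) (w22 : π (C.d₂ (C.d₂ w)) = 0) :
    C.KillsThreeJet π w ∧ C.KillsThreeJet π u ∧ C.KillsThreeJet π v := by
  obtain ⟨w1, u1, u2, v1⟩ := C.first_derivatives_eq_zero π g e u0 v0 w2 v2
  obtain ⟨w11, w21, u11, u21, v11, v21⟩ :=
    C.second_derivatives π ha hb hw hu hv g e w0 u0 v0 w2 v2
  obtain ⟨w111, w211, w221, u111, u211, u221, v111, v211, v221⟩ :=
    C.third_derivatives π ha hb hw hu hv g e w0 u0 v0 w2 v2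
  have d1 := e.e₄.h₁
  have d2 := e.e₄.h₂
  have d11 := e.e₄.h₁₁
  have d21 := e.e₄.h₂₁
  have d22 := e.e₄.h₂₂
  simp only [map_add] at d1 d2 d11 d21 d22
  rw [w11, u11, v11, w22, zero_add] at d1
  rw [w21, u21, v21, w22, zero_add] at d2
  rw [w111, u111, v111] at d11
  rw [w211, u211, v211] at d21
  rw [w221, u221, v221] at d22
  -- `d1` and `d2` form a linear system for u₂₂ and v₂₂ with determinant ab(a - b).
  have u22 : π (C.d₂ (C.d₂ u)) = 0 := by
    rw [← (g.a_unit.mul g.a_sub_b).mul_right_eq_zero]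
    linear_combination d1 - π b * d2
  have v22 : π (C.d₂ (C.d₂ v)) = 0 := by
    rw [← (g.b_unit.mul g.a_sub_b).mul_right_eq_zero]
    linear_combination π a * d2 - d1
  simp only [u22, v22, mul_zero, add_zero] at d11 d21 d22 u11 u21 v11 v21 u111 u211 u221 v111 v211 v221
  -- A Vandermonde system with nodes 1, a, b. The multipliers are the coefficients of (x - a)(x -
  -- b), and in the next two steps of (x - 1)(x - b) and -(x - 1)(x - a); each polynomial vanishes
  -- at two of the nodes.
  have w222 : π (C.d₂ (C.d₂ (C.d₂ w))) = 0 := by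
    rw [← (g.a_sub_one.mul g.b_sub_one).mul_right_eq_zero]
    linear_combination d11 - (π a + π b) * d21 + π a * π b * d22
  have u222 : π (C.d₂ (C.d₂ (C.d₂ u))) = 0 := by
    rw [← ((g.a_unit.mul g.a_sub_one).mul g.a_sub_b).mul_right_eq_zero]
    linear_combination d11 - (1 + π b) * d21 + π b * d22
  have v222 : π (C.d₂ (C.d₂ (C.d₂ v))) = 0 := by
    rw [← ((g.b_unit.mul g.b_sub_one).mul g.a_sub_b).mul_right_eq_zero]
    linear_combination -d11 + (1 + π a) * d21 - π a * d22
  simp only [w222, u222, v222, mul_zero] at w111 w211 w221 u111 u211 u221 v111 v211 v221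
  exact ⟨⟨⟨w0, w1, w2, w11.trans w22, w21.trans w22, w22⟩, w111, w211, w221, w222⟩,
    ⟨⟨u0, u1, u2, u11, u21, u22⟩, u111, u211, u221, u222⟩,
    ⟨⟨v0, v1, v2, v11, v21, v22⟩, v111, v211, v221, v222⟩⟩
end

/-- The restriction of the multi-bracket to the elements of the second prolongation of the abelian
equation with `w₂ = v₂ = w = u = v = 0`. -/
theorem bracket_eq (π : S →+* ℝ) {a b w u v : S}
    (ha : C.euler a = 0) (hb : C.euler b = 0)
    (hw : C.euler w = w) (hu : C.euler u = u) (hv : C.euler v = v)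
    (g : Generic (π a) (π b))
    (e : C.KillsEquations π a b w u v) (w0 : π w = 0) (u0 : π u = 0) (v0 : π v = 0)
    (w2 : π (C.d₂ w) = 0) (v2 : π (C.d₂ v) = 0) :
    π (C.bracket a b w u v) =
      -10 * (1 - π a) * (1 - π b) * (π C.κ
        + exprR (π a) (π (C.d₁ a)) (π (C.d₂ a)) (π (C.d₁ (C.d₁ a))) (π (C.d₂ (C.d₁ a)))
          (π (C.d₂ (C.d₂ a))) (π b) (π (C.d₂ b))
        + exprR (π b) (π (C.d₁ b)) (π (C.d₂ b)) (π (C.d₁ (C.d₁ b))) (π (C.d₂ (C.d₁ b)))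
          (π (C.d₂ (C.d₂ b))) (π a) (π (C.d₂ a))
        - (π a - π a ^ 2 + π b - π b ^ 2 - 4 * π a * π b + 2 * π a ^ 2 * π b + 2 * π a * π b ^ 2)
          / (10 * (-1 + π a) * π a * (π a - π b) ^ 2 * (-1 + π b) * π b)
          * (π (C.d₁ a) * π (C.d₁ b))
        + (2 * π a - π a ^ 2 + 2 * π b - π b ^ 2 - 4 * π a * π b + π a ^ 2 * π b + π a * π b ^ 2)
          / (10 * (-1 + π a) * (π a - π b) ^ 2 * (-1 + π b)) * (π (C.d₂ a) * π (C.d₂ b)))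
        * π (C.d₂ (C.d₂ w)) := by
  obtain ⟨w1, u1, u2, v1⟩ := C.first_derivatives_eq_zero π g e u0 v0 w2 v2
  obtain ⟨w11, w21, u11, u21, v11, v21⟩ :=
    C.second_derivatives π ha hb hw hu hv g e w0 u0 v0 w2 v2
  obtain ⟨w111, w211, w221, u111, u211, u221, v111, v211, v221⟩ :=
    C.third_derivatives π ha hb hw hu hv g e w0 u0 v0 w2 v2
  have d1 := e.e₄.h₁
  have d2 := e.e₄.h₂
  have d11 := e.e₄.h₁₁
  have d21 := e.e₄.h₂₁
  have d22 := e.e₄.h₂₂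
  simp only [map_add] at d1 d2 d11 d21 d22
  rw [w11, u11, v11] at d1
  rw [w21, u21, v21] at d2
  rw [w111, u111, v111] at d11
  rw [w211, u211, v211] at d21
  rw [w221, u221, v221] at d22
  -- The goal becomes a polynomial identity in the surviving derivatives. The commutation rule moves
  -- every ∇₂ to the left of every ∇₁; the fourth order derivatives, which 𝔄₃ does not constrain,
  -- then cancel.
  rw [← bracket_scalar_identity (r := π (C.d₂ (C.d₂ w))) (s := π (C.d₂ (C.d₂ u)))
    (t := π (C.d₂ (C.d₂ v))) (W := π (C.d₂ (C.d₂ (C.d₂ w)))) (U := π (C.d₂ (C.d₂ (C.d₂ u))))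
    (V := π (C.d₂ (C.d₂ (C.d₂ v)))) g.a_unit.ne_zero (sub_ne_zero.1 g.a_sub_one.ne_zero)
    g.b_unit.ne_zero (sub_ne_zero.1 g.b_sub_one.ne_zero) (sub_ne_zero.1 g.a_sub_b.ne_zero)
    d1 d2 (by linear_combination d11) (by linear_combination d21) (by linear_combination d22)]
  simp only [bracket, delta, one_mul, map_sub, map_add, Derivation.leibniz, smul_eq_mul, C.comm,
    C.euler_d₁, C.euler_d₂, ha, hb, hw, hu, hv, map_mul, map_zero, mul_zero, zero_mul, add_zero,
    zero_add, sub_zero, w0, u0, v0, w1, u1, v1, w2, u2, v2, w11, w21, u11, u21, v11, v21,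
    w111, w211, w221, u111, u211, u221, v111, v211, v221]
  ring

end WeightedCalculus
end
end PlanarWebs

namespace PlanarWebs
noncomputable section

open Polynomial

/-! ### Weights as polynomial degrees -/

/-- The derivation of a polynomial ring that applies `D` to the coefficients. -/
def coeffDerivation {R : Type*} [CommRing R] (D : Derivation ℤ R R) : Derivation ℤ R[X] R[X] :=
  letI : Differential R := ⟨D⟩
  Differential.mapCoeffs

theorem coeffDerivation_monomial {R : Type*} [CommRing R] (D : Derivation ℤ R R) (k : ℕ) (x : R) :
    coeffDerivation D (monomial k x) = monomial k (D x) :=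
  letI : Differential R := ⟨D⟩
  Differential.mapCoeffs_monomial k x

/-- The covariant derivative as a derivation of the ring of weighted elements: an element `x` of
weight `k` is recorded as `x X ^ k` and goes to `(D x - k g x) X ^ (k + 1)`. -/
def covDerivation {R : Type*} [CommRing R] (D : Derivation ℤ R R) (g : R) :
    Derivation ℤ R[X] R[X] :=
  (X : R[X]) • coeffDerivation D - (C g * X ^ 2) • (derivative' (R := R)).restrictScalars ℤ

/-- The Euler derivation, whose eigenvalues are the weights. -/
def eulerDerivation (R : Type*) [CommRing R] : Derivation ℤ R[X] R[X] :=
  (X : R[X]) • (derivative' (R := R)).restrictScalars ℤ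

theorem covDerivation_monomial {R : Type*} [CommRing R] (D : Derivation ℤ R R) (g : R)
    (k : ℕ) (x : R) :
    covDerivation D g (monomial k x) = monomial (k + 1) (D x - k * g * x) := by
  have h : covDerivation D g (monomial k x) =
      X * coeffDerivation D (monomial k x) - C g * X ^ 2 * derivative (monomial k x) := rfl
  rw [h, coeffDerivation_monomial, derivative_monomial, X_mul_monomial, mul_assoc, map_sub]
  congr 1
  rcases k with _ | k
  · simp
  · rw [X_pow_mul_monomial, C_mul_monomial, Nat.add_sub_cancel]
    congr 1
    ring

theorem eulerDerivation_monomial {R : Type*} [CommRing R] (k : ℕ) (x : R) :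
    eulerDerivation R (monomial k x) = monomial k (k * x) := by
  have h : eulerDerivation R (monomial k x) = X * derivative (monomial k x) := rfl
  rw [h, derivative_monomial]
  rcases k with _ | k
  · simp
  · rw [X_mul_monomial, Nat.add_sub_cancel, mul_comm]

/-- By additivity it suffices to take one weight k. Since the first derivative raises the weight to
k + 1, the structure function terms of the frame commutator cancel, and only -k times the curvature
remains. The curvature itself has weight 2. -/
theorem covDerivation_comm {R : Type*} [CommRing R] (D₁ D₂ : Derivation ℤ R R) (g₁ g₂ : R)
    (h : ∀ x, D₁ (D₂ x) - D₂ (D₁ x) = g₁ * D₂ x - g₂ * D₁ x) (x : R[X]) :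
    covDerivation D₁ g₁ (covDerivation D₂ g₂ x) = covDerivation D₂ g₂ (covDerivation D₁ g₁ x) -
      monomial 2 (D₁ g₂ - D₂ g₁) * eulerDerivation R x := by
  induction x using Polynomial.induction_on' with
  | add p q hp hq => simp only [map_add, hp, hq]; ring
  | monomial k x =>
    simp only [covDerivation_monomial, eulerDerivation_monomial, monomial_mul_monomial]
    rw [add_comm 2 k, ← map_sub]
    congr 1
    simp only [map_sub, Derivation.leibniz, Derivation.map_natCast, smul_eq_mul, mul_zero,
      add_zero]
    push_cast
    linear_combination h x

/-- This holds because a covariant derivative raises the weight by exactly one. -/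
theorem eulerDerivation_covDerivation {R : Type*} [CommRing R] (D : Derivation ℤ R R) (g : R)
    (x : R[X]) : eulerDerivation R (covDerivation D g x) =
      covDerivation D g (eulerDerivation R x) + covDerivation D g x := by
  induction x using Polynomial.induction_on' with
  | add p q hp hq => simp only [map_add, hp, hq]; ring
  | monomial k x =>
    simp only [covDerivation_monomial, eulerDerivation_monomial]
    rw [← map_add]
    congr 1
    simp only [Derivation.leibniz, Derivation.map_natCast, smul_eq_mul, mul_zero, add_zero]
    push_cast
    ring

/-- The calculus of covariant derivatives of weighted elements of a ring with two derivations
`D₁, D₂` that form a frame with the structure equation `[D₁, D₂] = g₁ D₂ - g₂ D₁`. -/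
def WeightedCalculus.ofFrame {R : Type*} [CommRing R] (D₁ D₂ : Derivation ℤ R R) (g₁ g₂ : R)
    (h : ∀ x, D₁ (D₂ x) - D₂ (D₁ x) = g₁ * D₂ x - g₂ * D₁ x) : WeightedCalculus R[X] where
  d₁ := covDerivation D₁ g₁
  d₂ := covDerivation D₂ g₂
  euler := eulerDerivation R
  κ := monomial 2 (D₁ g₂ - D₂ g₁)
  comm := covDerivation_comm D₁ D₂ g₁ g₂ h
  euler_d₁ := eulerDerivation_covDerivation D₁ g₁
  euler_d₂ := eulerDerivation_covDerivation D₂ g₂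

end
end PlanarWebs

namespace PlanarWebs
noncomputable section

open Filter Topology

/-! ### Germs of smooth functions -/

/-- The algebra of functions that are smooth at `p`. -/
def smoothAt (p : Plane) : Subalgebra ℝ (Plane → ℝ) where
  carrier := {f | ContDiffAt ℝ ∞ f p}
  mul_mem' {f g} (hf : ContDiffAt ℝ ∞ f p) (hg : ContDiffAt ℝ ∞ g p) := hf.mul hg
  add_mem' {f g} (hf : ContDiffAt ℝ ∞ f p) (hg : ContDiffAt ℝ ∞ g p) := hf.add hg
  algebraMap_mem' r := show ContDiffAt ℝ ∞ (fun _ => r) p from contDiffAt_const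

/-- The ideal of the functions that vanish in a neighbourhood of `p`. -/
def vanishingIdeal (p : Plane) : Ideal (smoothAt p) where
  carrier := {f | f.1 =ᶠ[𝓝 p] 0}
  add_mem' {f g} hf hg := by
    filter_upwards [hf, hg] with q h1 h2
    simp_all
  zero_mem' := EventuallyEq.rfl
  smul_mem' f g hg := by
    filter_upwards [hg] with q h
    simp_all

/-- The algebra of germs at `p` of smooth functions. -/
def SmoothGerm (p : Plane) : Type := smoothAt p ⧸ vanishingIdeal p

instance (p : Plane) : CommRing (SmoothGerm p) :=
  inferInstanceAs (CommRing (smoothAt p ⧸ vanishingIdeal p))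

instance (p : Plane) : Algebra ℝ (SmoothGerm p) :=
  inferInstanceAs (Algebra ℝ (smoothAt p ⧸ vanishingIdeal p))

/-- The germ of a function that is smooth at `p`. -/
def germ {p : Plane} {f : Plane → ℝ} (hf : ContDiffAt ℝ ∞ f p) : SmoothGerm p :=
  Ideal.Quotient.mk (vanishingIdeal p) ⟨f, hf⟩

variable {p : Plane} {f g : Plane → ℝ}

theorem germ_eq_iff (hf : ContDiffAt ℝ ∞ f p) (hg : ContDiffAt ℝ ∞ g p) :
    germ hf = germ hg ↔ f =ᶠ[𝓝 p] g := by
  refine Ideal.Quotient.eq.trans ?_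
  constructor
  · intro h
    have h' : f - g =ᶠ[𝓝 p] 0 := h
    filter_upwards [h'] with q hq
    simpa [sub_eq_zero] using hq
  · intro h
    change f - g =ᶠ[𝓝 p] 0
    filter_upwards [h] with q hq
    simp [hq]

theorem exists_germ (x : SmoothGerm p) : ∃ (f : Plane → ℝ) (hf : ContDiffAt ℝ ∞ f p),
    germ hf = x := by
  obtain ⟨⟨f, hf⟩, h⟩ := Ideal.Quotient.mk_surjective x
  exact ⟨f, hf, h⟩

theorem germ_add (hf : ContDiffAt ℝ ∞ f p) (hg : ContDiffAt ℝ ∞ g p) :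
    germ hf + germ hg = germ (hf.add hg) := rfl

theorem germ_sub (hf : ContDiffAt ℝ ∞ f p) (hg : ContDiffAt ℝ ∞ g p) :
    germ hf - germ hg = germ (hf.sub hg) := rfl

theorem germ_mul (hf : ContDiffAt ℝ ∞ f p) (hg : ContDiffAt ℝ ∞ g p) :
    germ hf * germ hg = germ (hf.mul hg) := rfl

theorem germ_smul (r : ℝ) (hf : ContDiffAt ℝ ∞ f p) :
    r • germ hf = germ (hf.const_smul r) := rfl

/-- The value of a germ at the base point. -/
def evalGerm (p : Plane) : SmoothGerm p →ₐ[ℝ] ℝ :=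
  Ideal.Quotient.liftₐ (vanishingIdeal p) ((Pi.evalAlgHom ℝ (fun _ => ℝ) p).comp (smoothAt p).val)
    fun _ h => EventuallyEq.eq_of_nhds h

theorem evalGerm_germ (hf : ContDiffAt ℝ ∞ f p) : evalGerm p (germ hf) = f p := rfl

/-- Germs form a local ring: a function that is nonzero at `p` is invertible near `p`. Genericity at
a point thus passes to germs and to their quotients. -/
theorem isUnit_germ {x : SmoothGerm p} (h : evalGerm p x ≠ 0) : IsUnit x := by
  obtain ⟨f, hf, rfl⟩ := exists_germ x
  rw [evalGerm_germ] at h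
  refine IsUnit.of_mul_eq_one (germ (hf.inv h)) ?_
  rw [germ_mul, show (1 : SmoothGerm p) = germ (contDiffAt_const (c := (1 : ℝ))) from rfl,
    germ_eq_iff]
  filter_upwards [hf.continuousAt.eventually_ne h] with q hq
  exact mul_inv_cancel₀ hq

/-! ### The frame derivatives of germs -/

/-- Two `1`-forms that are smooth and linearly independent at `p`. -/
structure IsCoframeAt (ω₁ ω₂ : OneForm) (p : Plane) : Prop where
  smooth₁ : ContDiffAt ℝ ∞ ω₁ p
  smooth₂ : ContDiffAt ℝ ∞ ω₂ p
  wedge_ne_zero : wedge ω₁ ω₂ p ≠ 0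

theorem contDiffAt_wedge {α β : OneForm} (hα : ContDiffAt ℝ ∞ α p) (hβ : ContDiffAt ℝ ∞ β p) :
    ContDiffAt ℝ ∞ (wedge α β) p := by
  have h : ∀ {γ : OneForm}, ContDiffAt ℝ ∞ γ p → ∀ v, ContDiffAt ℝ ∞ (fun q => γ q v) p :=
    fun hγ v => hγ.clm_apply contDiffAt_const
  exact ((h hα ex).mul (h hβ ey)).sub ((h hα ey).mul (h hβ ex))

theorem contDiffAt_fderiv {E F : Type*} [NormedAddCommGroup E] [NormedSpace ℝ E]
    [NormedAddCommGroup F] [NormedSpace ℝ F] {f : E → F} {p : E} (hf : ContDiffAt ℝ ∞ f p) :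
    ContDiffAt ℝ ∞ (fderiv ℝ f) p :=
  hf.fderiv_right (by simp)

theorem contDiffAt_extD {α : OneForm} (hα : ContDiffAt ℝ ∞ α p) :
    ContDiffAt ℝ ∞ (extD α) p := by
  have h : ∀ v w, ContDiffAt ℝ ∞ (fun q => fderiv ℝ α q v w) p :=
    fun v w => ((contDiffAt_fderiv hα).clm_apply contDiffAt_const).clm_apply contDiffAt_const
  exact (h ex ey).sub (h ey ex)

/-- Smoothness of order `∞` at a point gives a neighbourhood for each finite order separately, so
the order is first lowered to one. -/
theorem eventually_differentiableAt {E F : Type*} [NormedAddCommGroup E]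
    [NormedSpace ℝ E] [NormedAddCommGroup F] [NormedSpace ℝ F] {f : E → F} {p : E}
    (hf : ContDiffAt ℝ ∞ f p) : ∀ᶠ q in 𝓝 p, DifferentiableAt ℝ f q := by
  have h1 : ContDiffAt ℝ 1 f p := hf.of_le (by simp)
  filter_upwards [h1.eventually (by simp)] with q hq
  exact hq.differentiableAt (by simp)

namespace IsCoframeAt

variable {ω₁ ω₂ : OneForm} (hω : IsCoframeAt ω₁ ω₂ p)
include hω

theorem eventually_wedge_ne_zero : ∀ᶠ q in 𝓝 p, wedge ω₁ ω₂ q ≠ 0 :=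
  (contDiffAt_wedge hω.smooth₁ hω.smooth₂).continuousAt.eventually_ne hω.wedge_ne_zero

theorem contDiffAt_g₁ : ContDiffAt ℝ ∞ (g₁ ω₁ ω₂) p :=
  (contDiffAt_extD hω.smooth₂).neg.div (contDiffAt_wedge hω.smooth₁ hω.smooth₂) hω.wedge_ne_zero

theorem contDiffAt_g₂ : ContDiffAt ℝ ∞ (g₂ ω₁ ω₂) p :=
  (contDiffAt_extD hω.smooth₁).div (contDiffAt_wedge hω.smooth₁ hω.smooth₂) hω.wedge_ne_zero

theorem contDiffAt_frameDeriv (i : Fin 2) (hf : ContDiffAt ℝ ∞ f p) :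
    ContDiffAt ℝ ∞ (frameDeriv ω₁ ω₂ i f) p := by
  have hd := contDiffAt_fderiv hf
  fin_cases i
  · exact (contDiffAt_wedge hd hω.smooth₂).div (contDiffAt_wedge hω.smooth₁ hω.smooth₂)
      hω.wedge_ne_zero
  · exact (contDiffAt_wedge hω.smooth₁ hd).div (contDiffAt_wedge hω.smooth₁ hω.smooth₂)
      hω.wedge_ne_zero

end IsCoframeAt

theorem frameDeriv_congr (ω₁ ω₂ : OneForm) (i : Fin 2) (h : f =ᶠ[𝓝 p] g) :
    frameDeriv ω₁ ω₂ i f =ᶠ[𝓝 p] frameDeriv ω₁ ω₂ i g := by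
  filter_upwards [h.fderiv (𝕜 := ℝ)] with q hq
  simp [frameDeriv, wedge, hq]

theorem frameDeriv_add (ω₁ ω₂ : OneForm) (i : Fin 2) (hf : DifferentiableAt ℝ f p)
    (hg : DifferentiableAt ℝ g p) :
    frameDeriv ω₁ ω₂ i (f + g) p = frameDeriv ω₁ ω₂ i f p + frameDeriv ω₁ ω₂ i g p := by
  fin_cases i <;> simp [frameDeriv, wedge, fderiv_add hf hg] <;> ring

theorem frameDeriv_mul (ω₁ ω₂ : OneForm) (i : Fin 2) (hf : DifferentiableAt ℝ f p)
    (hg : DifferentiableAt ℝ g p) :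
    frameDeriv ω₁ ω₂ i (f * g) p =
      f p * frameDeriv ω₁ ω₂ i g p + g p * frameDeriv ω₁ ω₂ i f p := by
  fin_cases i <;> simp [frameDeriv, wedge, fderiv_mul hf hg] <;> ring

theorem frameDeriv_const (ω₁ ω₂ : OneForm) (i : Fin 2) (r : ℝ) (p : Plane) :
    frameDeriv ω₁ ω₂ i (fun _ => r) p = 0 := by
  fin_cases i <;> simp [frameDeriv, wedge]

namespace IsCoframeAt

variable {ω₁ ω₂ : OneForm} (hω : IsCoframeAt ω₁ ω₂ p)

/-- The frame derivative of a germ. -/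
def derivFun (i : Fin 2) (x : SmoothGerm p) : SmoothGerm p :=
  germ (hω.contDiffAt_frameDeriv i (exists_germ x).choose_spec.choose)

/-- The chosen representative does not matter: functions that agree near `p` have frame derivatives
that agree near `p`. -/
theorem derivFun_germ (i : Fin 2) (hf : ContDiffAt ℝ ∞ f p) :
    hω.derivFun i (germ hf) = germ (hω.contDiffAt_frameDeriv i hf) := by
  rw [derivFun, germ_eq_iff]
  apply frameDeriv_congr
  rw [← germ_eq_iff (exists_germ (germ hf)).choose_spec.choose hf]
  exact (exists_germ (germ hf)).choose_spec.choose_spec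

/-- The frame derivative as a derivation of the algebra of germs. -/
def deriv (i : Fin 2) : Derivation ℝ (SmoothGerm p) (SmoothGerm p) :=
  Derivation.mk'
    { toFun := hω.derivFun i
      map_add' := by
        intro x y
        obtain ⟨f, hf, rfl⟩ := exists_germ x
        obtain ⟨g, hg, rfl⟩ := exists_germ y
        rw [germ_add, derivFun_germ, derivFun_germ, derivFun_germ, germ_add, germ_eq_iff]
        filter_upwards [eventually_differentiableAt hf, eventually_differentiableAt hg]
          with q h1 h2
        exact frameDeriv_add _ _ i h1 h2
      map_smul' := by
        intro r x
        obtain ⟨f, hf, rfl⟩ := exists_germ x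
        rw [germ_smul, derivFun_germ, derivFun_germ, RingHom.id_apply, germ_smul, germ_eq_iff]
        filter_upwards [eventually_differentiableAt hf] with q h1
        have h := frameDeriv_mul ω₁ ω₂ i (differentiableAt_const r) h1
        rw [frameDeriv_const, mul_zero, add_zero] at h
        exact h }
    (by
      intro x y
      obtain ⟨f, hf, rfl⟩ := exists_germ x
      obtain ⟨g, hg, rfl⟩ := exists_germ y
      change hω.derivFun i (germ hf * germ hg) =
        germ hf * hω.derivFun i (germ hg) + germ hg * hω.derivFun i (germ hf)
      rw [germ_mul, derivFun_germ, derivFun_germ, derivFun_germ, germ_mul, germ_mul, germ_add,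
        germ_eq_iff]
      filter_upwards [eventually_differentiableAt hf, eventually_differentiableAt hg]
        with q h1 h2
      exact frameDeriv_mul _ _ i h1 h2)

theorem deriv_germ (i : Fin 2) (hf : ContDiffAt ℝ ∞ f p) :
    hω.deriv i (germ hf) = germ (hω.contDiffAt_frameDeriv i hf) :=
  hω.derivFun_germ i hf

end IsCoframeAt

/-! ### Exterior derivatives in a coframe and the commutator of the frame -/

theorem extD_congr {α β : OneForm} (h : α =ᶠ[𝓝 p] β) : extD α p = extD β p := by
  rw [extD, extD, h.fderiv_eq]

theorem extD_smul (f : Plane → ℝ) (α : OneForm) (hf : DifferentiableAt ℝ f p)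
    (hα : DifferentiableAt ℝ α p) :
    extD (fun q => f q • α q) p = wedge (fderiv ℝ f) α p + f p * extD α p := by
  simp only [extD, wedge, fderiv_fun_smul hf hα, add_apply, smul_apply,
    ContinuousLinearMap.smulRight_apply, smul_eq_mul]
  ring

/-- The exterior derivative of a form that is given by its components in a coframe. -/
theorem extD_components {ω₁ ω₂ : OneForm} (h : wedge ω₁ ω₂ p ≠ 0)
    (h₁ : DifferentiableAt ℝ ω₁ p) (h₂ : DifferentiableAt ℝ ω₂ p)
    (hf : DifferentiableAt ℝ f p) (hg : DifferentiableAt ℝ g p) :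
    extD (fun q => f q • ω₁ q + g q • ω₂ q) p =
      (frameDeriv ω₁ ω₂ 0 g p - frameDeriv ω₁ ω₂ 1 f p + g₂ ω₁ ω₂ p * f p - g₁ ω₁ ω₂ p * g p) *
        wedge ω₁ ω₂ p := by
  rw [extD_add (fun q => f q • ω₁ q) (fun q => g q • ω₂ q) p (hf.smul h₁) (hg.smul h₂), extD_smul f ω₁ hf h₁, extD_smul g ω₂ hg h₂]
  simp only [frameDeriv, g₁, g₂, Matrix.cons_val_zero, Matrix.cons_val_one]
  field_simp
  simp only [wedge]
  ring

namespace IsCoframeAt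

variable {ω₁ ω₂ : OneForm} (hω : IsCoframeAt ω₁ ω₂ p)

theorem extD_components_eventually (hω : IsCoframeAt ω₁ ω₂ p) (hf : ContDiffAt ℝ ∞ f p)
    (hg : ContDiffAt ℝ ∞ g p) : ∀ᶠ q in 𝓝 p, extD (fun q => f q • ω₁ q + g q • ω₂ q) q =
      (frameDeriv ω₁ ω₂ 0 g q - frameDeriv ω₁ ω₂ 1 f q + g₂ ω₁ ω₂ q * f q - g₁ ω₁ ω₂ q * g q) *
        wedge ω₁ ω₂ q := by
  filter_upwards [hω.eventually_wedge_ne_zero, eventually_differentiableAt hω.smooth₁,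
    eventually_differentiableAt hω.smooth₂, eventually_differentiableAt hf,
    eventually_differentiableAt hg] with q h h₁ h₂ h₃ h₄
  exact extD_components h h₁ h₂ h₃ h₄

/-- This is d(df) = 0, that is, the symmetry of the second derivative, written in components with df
= ∂₁f ω₁ + ∂₂f ω₂. -/
theorem commutator (x : SmoothGerm p) :
    hω.deriv 0 (hω.deriv 1 x) - hω.deriv 1 (hω.deriv 0 x) =
      germ hω.contDiffAt_g₁ * hω.deriv 1 x - germ hω.contDiffAt_g₂ * hω.deriv 0 x := by
  obtain ⟨f, hf, rfl⟩ := exists_germ x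
  simp only [deriv_germ, germ_sub, germ_mul]
  rw [germ_eq_iff]
  have h2 : ContDiffAt ℝ 2 f p := hf.of_le (WithTop.coe_le_coe.2 (le_top : (2 : ℕ∞) ≤ ⊤))
  filter_upwards [hω.extD_components_eventually (hω.contDiffAt_frameDeriv 0 hf)
    (hω.contDiffAt_frameDeriv 1 hf), hω.eventually_wedge_ne_zero,
    hω.eventually_wedge_ne_zero.eventually_nhds, h2.eventually (by simp)] with q h hne hne' hq
  have h0 : extD (fderiv ℝ f) q = 0 := by
    have h : IsSymmSndFDerivAt ℝ f q := hq.isSymmSndFDerivAt (by simp)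
    rw [extD, h.eq ex ey, sub_self]
  rw [← extD_congr (α := fderiv ℝ f) (by
    filter_upwards [hne'] with r hr
    exact fderiv_eq_frameDeriv ω₁ ω₂ f r hr), h0] at h
  have h' := (mul_eq_zero.1 h.symm).resolve_right hne
  linear_combination h'

end IsCoframeAt

end
end PlanarWebs

namespace PlanarWebs
noncomputable section

open Filter Topology Polynomial

variable {p : Plane} {f g a b w u v : Plane → ℝ}

/-! ### From functions to weighted germs -/

theorem germ_natCast (k : ℕ) :
    (k : SmoothGerm p) = germ (contDiffAt_const (c := (k : ℝ))) :=
  (map_natCast (Ideal.Quotient.mk (vanishingIdeal p)) k).symm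

/-- The homomorphism that forgets the weights and applies `φ` to the germs. -/
def forget {R Q : Type*} [CommRing R] [CommRing Q] (φ : R →+* Q) : R[X] →+* Q :=
  φ.comp (evalRingHom 1)

theorem forget_monomial {R Q : Type*} [CommRing R] [CommRing Q] (φ : R →+* Q) (k : ℕ) (x : R) :
    forget φ (monomial k x) = φ x := by
  simp [forget, eval_monomial]

namespace IsCoframeAt

variable {ω₁ ω₂ : OneForm} (hω : IsCoframeAt ω₁ ω₂ p)

theorem contDiffAt_covDeriv (hω : IsCoframeAt ω₁ ω₂ p) (i : Fin 2) (k : ℕ)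
    (hf : ContDiffAt ℝ ∞ f p) : ContDiffAt ℝ ∞ (covDeriv ω₁ ω₂ i k f) p := by
  have h : ContDiffAt ℝ ∞ (fun q => ![g₁ ω₁ ω₂ q, g₂ ω₁ ω₂ q] i) p := by
    fin_cases i
    · exact hω.contDiffAt_g₁
    · exact hω.contDiffAt_g₂
  exact (hω.contDiffAt_frameDeriv i hf).sub ((contDiffAt_const.mul h).mul hf)

theorem contDiffAt_deltaOp (hω : IsCoframeAt ω₁ ω₂ p) (k : ℕ) (ha : ContDiffAt ℝ ∞ a p)
    (hf : ContDiffAt ℝ ∞ f p) : ContDiffAt ℝ ∞ (deltaOp ω₁ ω₂ a k f) p :=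
  (hω.contDiffAt_covDeriv 0 k hf).sub (hω.contDiffAt_covDeriv 1 k (ha.mul hf))

/-- The calculus of covariant derivatives of weighted germs. -/
def calculus : WeightedCalculus (SmoothGerm p)[X] :=
  WeightedCalculus.ofFrame ((hω.deriv 0).restrictScalars ℤ) ((hω.deriv 1).restrictScalars ℤ)
    (germ hω.contDiffAt_g₁) (germ hω.contDiffAt_g₂) hω.commutator

theorem d₁_monomial (k : ℕ) (x : SmoothGerm p) : hω.calculus.d₁ (monomial k x) =
    monomial (k + 1) (hω.deriv 0 x - k * germ hω.contDiffAt_g₁ * x) :=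
  covDerivation_monomial _ _ k x

theorem d₂_monomial (k : ℕ) (x : SmoothGerm p) : hω.calculus.d₂ (monomial k x) =
    monomial (k + 1) (hω.deriv 1 x - k * germ hω.contDiffAt_g₂ * x) :=
  covDerivation_monomial _ _ k x

theorem euler_monomial (k : ℕ) (x : SmoothGerm p) :
    hω.calculus.euler (monomial k x) = monomial k (k * x) :=
  eulerDerivation_monomial k x

theorem d₁_germ (k : ℕ) (hf : ContDiffAt ℝ ∞ f p) : hω.calculus.d₁ (monomial k (germ hf)) =
    monomial (k + 1) (germ (hω.contDiffAt_covDeriv 0 k hf)) := by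
  rw [d₁_monomial, deriv_germ, germ_natCast, germ_mul, germ_mul, germ_sub]
  rfl

theorem d₂_germ (k : ℕ) (hf : ContDiffAt ℝ ∞ f p) : hω.calculus.d₂ (monomial k (germ hf)) =
    monomial (k + 1) (germ (hω.contDiffAt_covDeriv 1 k hf)) := by
  rw [d₂_monomial, deriv_germ, germ_natCast, germ_mul, germ_mul, germ_sub]
  rfl

theorem delta_germ (k : ℕ) (ha : ContDiffAt ℝ ∞ a p) (hf : ContDiffAt ℝ ∞ f p) :
    hω.calculus.delta (monomial 0 (germ ha)) (monomial k (germ hf)) =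
      monomial (k + 1) (germ (hω.contDiffAt_deltaOp k ha hf)) := by
  rw [WeightedCalculus.delta, monomial_mul_monomial, zero_add, germ_mul, d₁_germ, d₂_germ,
    ← map_sub, germ_sub]
  rfl

theorem delta_one_germ (k : ℕ) (hf : ContDiffAt ℝ ∞ f p) :
    hω.calculus.delta 1 (monomial k (germ hf)) =
      monomial (k + 1) (germ (hω.contDiffAt_deltaOp (a := 1) k contDiffAt_const hf)) :=
  hω.delta_germ (a := 1) k contDiffAt_const hf

theorem contDiffAt_multiBracket (hω : IsCoframeAt ω₁ ω₂ p) (ha : ContDiffAt ℝ ∞ a p)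
    (hb : ContDiffAt ℝ ∞ b p)
    (hw : ContDiffAt ℝ ∞ w p) (hu : ContDiffAt ℝ ∞ u p) (hv : ContDiffAt ℝ ∞ v p) :
    ContDiffAt ℝ ∞ (multiBracket ω₁ ω₂ a b w u v) p := by
  have h1 : ContDiffAt ℝ ∞ (1 : Plane → ℝ) p := contDiffAt_const
  have δ : ∀ k {f}, ContDiffAt ℝ ∞ f p → ContDiffAt ℝ ∞ (covDeriv ω₁ ω₂ 0 k f) p :=
    fun k _ hf => hω.contDiffAt_covDeriv 0 k hf
  have Δ : ∀ k {c f}, ContDiffAt ℝ ∞ c p → ContDiffAt ℝ ∞ f p →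
    ContDiffAt ℝ ∞ (deltaOp ω₁ ω₂ c k f) p := fun k _ _ hc hf => hω.contDiffAt_deltaOp k hc hf
  have t : ∀ {f}, ContDiffAt ℝ ∞ f p → ContDiffAt ℝ ∞ (deltaOp ω₁ ω₂ 1 4
      (deltaOp ω₁ ω₂ a 3 (deltaOp ω₁ ω₂ b 2 (covDeriv ω₁ ω₂ 0 1 f)))) p :=
    fun hf => Δ 4 h1 (Δ 3 ha (Δ 2 hb (δ 1 hf)))
  exact (((t hw).sub (δ 4 (Δ 3 ha (Δ 2 hb (Δ 1 h1 hw))))).add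
    ((t hu).sub (Δ 4 h1 (δ 3 (Δ 2 hb (Δ 1 ha hu)))))).add
    ((t hv).sub (Δ 4 h1 (Δ 3 ha (δ 2 (Δ 1 hb hv)))))

/-- The weights 1, 2, 3, 4 written into `multiBracket` are the degrees of the monomials that each
operator meets, so the algebraic and the analytic bracket agree term by term. -/
theorem bracket_germ (ha : ContDiffAt ℝ ∞ a p) (hb : ContDiffAt ℝ ∞ b p)
    (hw : ContDiffAt ℝ ∞ w p) (hu : ContDiffAt ℝ ∞ u p) (hv : ContDiffAt ℝ ∞ v p) :
    hω.calculus.bracket (monomial 0 (germ ha)) (monomial 0 (germ hb)) (monomial 1 (germ hw))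
        (monomial 1 (germ hu)) (monomial 1 (germ hv)) =
      monomial 5 (germ (hω.contDiffAt_multiBracket ha hb hw hu hv)) := by
  simp only [WeightedCalculus.bracket, d₁_germ, delta_germ, delta_one_germ]
  simp only [← map_sub, ← map_add, germ_sub, germ_add]
  rfl

/-- The left-hand sides of the abelian equation as weighted germs. -/
theorem contDiffAt_abelianLHS (hω : IsCoframeAt ω₁ ω₂ p) (ha : ContDiffAt ℝ ∞ a p)
    (hb : ContDiffAt ℝ ∞ b p) (hw : ContDiffAt ℝ ∞ w p) (hu : ContDiffAt ℝ ∞ u p)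
    (hv : ContDiffAt ℝ ∞ v p) (j : Fin 4) :
    ContDiffAt ℝ ∞ (abelianLHS ω₁ ω₂ a b w u v j) p := by
  fin_cases j
  · exact hω.contDiffAt_deltaOp (a := 1) 1 contDiffAt_const hw
  · exact hω.contDiffAt_deltaOp 1 ha hu
  · exact hω.contDiffAt_deltaOp 1 hb hv
  · exact ((hω.contDiffAt_covDeriv 0 1 hw).add (hω.contDiffAt_covDeriv 0 1 hu)).add
      (hω.contDiffAt_covDeriv 0 1 hv)

theorem killsEquations_iff {Q : Type*} [CommRing Q] (π : (SmoothGerm p)[X] →+* Q)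
    (ha : ContDiffAt ℝ ∞ a p)
    (hb : ContDiffAt ℝ ∞ b p) (hw : ContDiffAt ℝ ∞ w p) (hu : ContDiffAt ℝ ∞ u p)
    (hv : ContDiffAt ℝ ∞ v p) :
    hω.calculus.KillsEquations π (monomial 0 (germ ha)) (monomial 0 (germ hb))
        (monomial 1 (germ hw)) (monomial 1 (germ hu)) (monomial 1 (germ hv)) ↔
      ∀ j, hω.calculus.KillsTwoJet π
        (monomial 2 (germ (hω.contDiffAt_abelianLHS ha hb hw hu hv j))) := by
  have h₁ := hω.delta_one_germ 1 hw
  have h₂ := hω.delta_germ 1 ha hu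
  have h₃ := hω.delta_germ 1 hb hv
  have h₄ : hω.calculus.d₁ (monomial 1 (germ hw)) + hω.calculus.d₁ (monomial 1 (germ hu)) +
      hω.calculus.d₁ (monomial 1 (germ hv)) =
      monomial 2 (germ (hω.contDiffAt_abelianLHS ha hb hw hu hv 3)) := by
    simp only [d₁_germ, ← map_add, germ_add]
    rfl
  constructor
  · rintro ⟨e₁, e₂, e₃, e₄⟩ j
    rw [h₁] at e₁
    rw [h₂] at e₂
    rw [h₃] at e₃
    rw [h₄] at e₄
    fin_cases j
    exacts [e₁, e₂, e₃, e₄]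
  · intro e
    exact ⟨h₁ ▸ e 0, h₂ ▸ e 1, h₃ ▸ e 2, h₄ ▸ e 3⟩

/-- The `2`-jet of a function at `p`, in terms of the frame derivatives of its germ. -/
theorem twoJet_eq_zero_iff (hω : IsCoframeAt ω₁ ω₂ p) (hf : ContDiffAt ℝ ∞ f p) :
    (∀ k ≤ 2, iteratedFDeriv ℝ k f p = 0) ↔
      (f p = 0 ∧ ∀ i, frameDeriv ω₁ ω₂ i f p = 0 ∧
        ∀ j, frameDeriv ω₁ ω₂ j (frameDeriv ω₁ ω₂ i f) p = 0) := by
  have hz : ∀ h : Plane → ℝ, fderiv ℝ h p = 0 ↔ ∀ i, frameDeriv ω₁ ω₂ i h p = 0 := by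
    intro h
    constructor
    · intro h0 i
      fin_cases i <;> simp [frameDeriv, wedge, h0]
    · intro h0
      rw [fderiv_eq_frameDeriv ω₁ ω₂ h p hω.wedge_ne_zero, h0 0, h0 1]
      simp
  have h1 : iteratedFDeriv ℝ 1 f p = 0 ↔ fderiv ℝ f p = 0 := by
    rw [← norm_eq_zero, norm_iteratedFDeriv_one, norm_eq_zero]
  have h2 : iteratedFDeriv ℝ 2 f p = 0 ↔ fderiv ℝ (fderiv ℝ f) p = 0 := by
    rw [← norm_eq_zero, ← norm_iteratedFDeriv_fderiv, norm_iteratedFDeriv_one, norm_eq_zero]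
  have h0 : iteratedFDeriv ℝ 0 f p = 0 ↔ f p = 0 := by
    rw [← norm_eq_zero, norm_iteratedFDeriv_zero, norm_eq_zero]
  have hall : (∀ k ≤ 2, iteratedFDeriv ℝ k f p = 0) ↔
      f p = 0 ∧ fderiv ℝ f p = 0 ∧ fderiv ℝ (fderiv ℝ f) p = 0 := by
    rw [← h0, ← h1, ← h2]
    refine ⟨fun h => ⟨h 0 (by simp), h 1 (by simp), h 2 le_rfl⟩, ?_⟩
    rintro ⟨k0, k1, k2⟩ k hk
    interval_cases k <;> assumption
  rw [hall]
  refine and_congr_right fun _ => ?_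
  constructor
  · rintro ⟨hd, hdd⟩ i
    refine ⟨(hz f).1 hd i, (hz _).1 ?_⟩
    have hdf := (contDiffAt_fderiv hf).differentiableAt (by simp)
    -- The frame derivatives are combinations of such products. The first factor vanishes at `p`
    -- together with its derivative, so the product has zero derivative for every differentiable
    -- `c`.
    have key : ∀ (v : Plane) (c : Plane → ℝ), DifferentiableAt ℝ c p →
        HasFDerivAt (fun q => fderiv ℝ f q v * c q) (0 : Plane →L[ℝ] ℝ) p := by
      intro v c hc
      have h3 : HasFDerivAt (fun q => fderiv ℝ f q v) (0 : Plane →L[ℝ] ℝ) p := by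
        have := hdf.hasFDerivAt.clm_apply (hasFDerivAt_const v p)
        simpa [hdd] using this
      refine (h3.mul hc.hasFDerivAt).congr_fderiv ?_
      simp [hd]
    have hc : ∀ (α : OneForm) (_ : ContDiffAt ℝ ∞ α p) (v : Plane),
        DifferentiableAt ℝ (fun q => α q v / wedge ω₁ ω₂ q) p := fun _ h v =>
      ((h.clm_apply contDiffAt_const).div (contDiffAt_wedge hω.smooth₁ hω.smooth₂)
        hω.wedge_ne_zero).differentiableAt (by simp)
    have k1 := hc ω₁ hω.smooth₁
    have k2 := hc ω₂ hω.smooth₂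
    fin_cases i
    · have := ((key ex _ (k2 ey)).sub (key ey _ (k2 ex))).fderiv
      rw [sub_zero] at this
      rw [← this]
      congr 1
      ext q
      simp only [frameDeriv, wedge, Fin.zero_eta, Matrix.cons_val_zero, Pi.sub_apply]
      ring
    · have := ((key ey _ (k1 ex)).sub (key ex _ (k1 ey))).fderiv
      rw [sub_zero] at this
      rw [← this]
      congr 1
      ext q
      simp only [frameDeriv, wedge, Fin.mk_one, Matrix.cons_val_one, Matrix.cons_val_fin_one,
        Pi.sub_apply]
      ring
  · intro h
    refine ⟨(hz f).2 fun i => (h i).1, ?_⟩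
    have he : fderiv ℝ f =ᶠ[𝓝 p] fun q => frameDeriv ω₁ ω₂ 0 f q • ω₁ q +
        frameDeriv ω₁ ω₂ 1 f q • ω₂ q := by
      filter_upwards [hω.eventually_wedge_ne_zero] with q hq
      exact fderiv_eq_frameDeriv ω₁ ω₂ f q hq
    have s1 := hω.smooth₁.differentiableAt (by simp)
    have s2 := hω.smooth₂.differentiableAt (by simp)
    have t1 := (hω.contDiffAt_frameDeriv 0 hf).differentiableAt (by simp)
    have t2 := (hω.contDiffAt_frameDeriv 1 hf).differentiableAt (by simp)
    rw [he.fderiv_eq, fderiv_fun_add (f := fun q => frameDeriv ω₁ ω₂ 0 f q • ω₁ q)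
      (g := fun q => frameDeriv ω₁ ω₂ 1 f q • ω₂ q) (t1.smul s1) (t2.smul s2), fderiv_fun_smul t1 s1,
      fderiv_fun_smul t2 s2, (h 0).1, (h 1).1, (hz _).2 (h 0).2, (hz _).2 (h 1).2]
    simp

/-- Covariant and plain frame derivatives differ by terms of lower order, which vanish successively.
The mixed derivative ∂₁∂₂, absent from `KillsTwoJet`, is recovered from ∂₂∂₁ by the commutator. -/
theorem killsTwoJet_iff (hω : IsCoframeAt ω₁ ω₂ p) (k : ℕ) (hf : ContDiffAt ℝ ∞ f p) :
    hω.calculus.KillsTwoJet (forget (evalGerm p).toRingHom) (monomial k (germ hf)) ↔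
      ∀ k ≤ 2, iteratedFDeriv ℝ k f p = 0 := by
  rw [hω.twoJet_eq_zero_iff hf]
  have e0 : ∀ i, frameDeriv ω₁ ω₂ i f p = evalGerm p (hω.deriv i (germ hf)) := by
    intro i
    rw [deriv_germ, evalGerm_germ]
  have e1 : ∀ i j, frameDeriv ω₁ ω₂ j (frameDeriv ω₁ ω₂ i f) p =
      evalGerm p (hω.deriv j (hω.deriv i (germ hf))) := by
    intro i j
    rw [deriv_germ, deriv_germ, evalGerm_germ]
  have e : f p = evalGerm p (germ hf) := rfl
  have hc := congrArg (evalGerm p) (hω.commutator (germ hf))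
  simp only [e0, e1, e]
  generalize germ hf = x at *
  simp only [map_sub, map_mul] at hc
  have S : ∀ y, (evalGerm p).toRingHom y = evalGerm p y := fun _ => rfl
  constructor
  · rintro ⟨h, h₁, h₂, h₁₁, h₂₁, h₂₂⟩
    simp only [d₁_monomial, d₂_monomial, forget_monomial, S, map_sub, map_mul, map_natCast,
      Derivation.leibniz, Derivation.map_natCast, smul_eq_mul, map_add] at h h₁ h₂ h₁₁ h₂₁ h₂₂
    simp only [h, mul_zero, sub_zero] at h₁ h₂
    simp only [h, h₁, h₂, mul_zero, sub_zero, zero_mul, add_zero] at h₁₁ h₂₁ h₂₂ hc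
    rw [h₂₁, sub_zero] at hc
    refine ⟨h, fun i => ?_⟩
    fin_cases i
    · refine ⟨h₁, fun j => ?_⟩
      fin_cases j
      exacts [h₁₁, h₂₁]
    · refine ⟨h₂, fun j => ?_⟩
      fin_cases j
      exacts [hc, h₂₂]
  · rintro ⟨h, hi⟩
    constructor <;> simp [d₁_monomial, d₂_monomial, forget_monomial, h, hi]

theorem jetMemA₃_iff (ha : ContDiffAt ℝ ∞ a p) (hb : ContDiffAt ℝ ∞ b p)
    (hw : ContDiffAt ℝ ∞ w p) (hu : ContDiffAt ℝ ∞ u p) (hv : ContDiffAt ℝ ∞ v p) :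
    JetMemA₃ ω₁ ω₂ a b w u v p ↔
      hω.calculus.KillsEquations (forget (evalGerm p).toRingHom) (monomial 0 (germ ha))
        (monomial 0 (germ hb)) (monomial 1 (germ hw)) (monomial 1 (germ hu))
        (monomial 1 (germ hv)) := by
  rw [hω.killsEquations_iff]
  exact forall_congr' fun j => (hω.killsTwoJet_iff 2 _).symm

end IsCoframeAt
end
end PlanarWebs

namespace PlanarWebs
noncomputable section

open Filter Topology Polynomial

variable {p : Plane}

/-! ### Linear algebra of jets: the coordinates on 𝔄₃ -/

/-- If `Φ` determines a surjective map `T` and the dimension of its target is that of the target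
of `T`, then `Φ` is surjective. -/
theorem surjective_of_ker_le {V E F : Type*} [AddCommGroup V] [Module ℝ V]
    [AddCommGroup E] [Module ℝ E] [FiniteDimensional ℝ E] [AddCommGroup F] [Module ℝ F]
    (Φ : V →ₗ[ℝ] E) (T : V →ₗ[ℝ] F) (hT : Function.Surjective T)
    (hk : LinearMap.ker Φ ≤ LinearMap.ker T)
    (hd : Module.finrank ℝ E = Module.finrank ℝ F) : Function.Surjective Φ := by
  -- By the inclusion of kernels `T` factors through the range of `Φ`, whose dimension is therefore
  -- at least that of `F`, hence that of `E`.
  let L : LinearMap.range Φ →ₗ[ℝ] F :=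
    ((LinearMap.ker Φ).liftQ T hk).comp Φ.quotKerEquivRange.symm.toLinearMap
  have hL : Function.Surjective L := by
    intro y
    obtain ⟨x, rfl⟩ := hT y
    refine ⟨Φ.quotKerEquivRange (Submodule.Quotient.mk x), ?_⟩
    simp [L]
  rw [← LinearMap.range_eq_top]
  apply Submodule.eq_top_of_finrank_eq
  apply le_antisymm (Submodule.finrank_le _)
  rw [hd]
  exact LinearMap.finrank_le_finrank_of_surjective hL

namespace IsCoframeAt

variable {ω₁ ω₂ : OneForm} (hω : IsCoframeAt ω₁ ω₂ p)

/-- The components of the connection form, as germs. -/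
def connection : Fin 2 → SmoothGerm p := ![germ hω.contDiffAt_g₁, germ hω.contDiffAt_g₂]

/-- The covariant derivative of germs of weight `k`. -/
def nabla (i : Fin 2) (k : ℕ) : SmoothGerm p →ₗ[ℝ] SmoothGerm p :=
  (hω.deriv i).toLinearMap - LinearMap.mulLeft ℝ (k * hω.connection i)

theorem nabla_apply (i : Fin 2) (k : ℕ) (x : SmoothGerm p) :
    hω.nabla i k x = hω.deriv i x - k * hω.connection i * x := rfl

theorem nabla_germ (i : Fin 2) (k : ℕ) {f : Plane → ℝ} (hf : ContDiffAt ℝ ∞ f p) :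
    hω.nabla i k (germ hf) = germ (hω.contDiffAt_covDeriv i k hf) := by
  rw [nabla_apply, deriv_germ, germ_natCast, connection]
  fin_cases i <;> rfl

theorem d₁_monomial_nabla (k : ℕ) (x : SmoothGerm p) :
    hω.calculus.d₁ (monomial k x) = monomial (k + 1) (hω.nabla 0 k x) :=
  hω.d₁_monomial k x

theorem d₂_monomial_nabla (k : ℕ) (x : SmoothGerm p) :
    hω.calculus.d₂ (monomial k x) = monomial (k + 1) (hω.nabla 1 k x) :=
  hω.d₂_monomial k x

/-- The operator `δ₁ - δ₂ ∘ a` on germs of weight `k`. -/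
def deltaGerm (a : SmoothGerm p) (k : ℕ) : SmoothGerm p →ₗ[ℝ] SmoothGerm p :=
  hω.nabla 0 k - (hω.nabla 1 k).comp (LinearMap.mulLeft ℝ a)

theorem delta_monomial (a : SmoothGerm p) (k : ℕ) (x : SmoothGerm p) :
    hω.calculus.delta (monomial 0 a) (monomial k x) = monomial (k + 1) (hω.deltaGerm a k x) := by
  rw [WeightedCalculus.delta, monomial_mul_monomial, zero_add, d₁_monomial_nabla,
    d₂_monomial_nabla, ← map_sub]
  rfl

theorem delta_one_monomial (k : ℕ) (x : SmoothGerm p) :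
    hω.calculus.delta 1 (monomial k x) = monomial (k + 1) (hω.deltaGerm 1 k x) :=
  hω.delta_monomial 1 k x

/-- The multi-bracket of the abelian equation as a linear map of germs. -/
def bracketGerm (a b : SmoothGerm p) :
    (SmoothGerm p × SmoothGerm p × SmoothGerm p) →ₗ[ℝ] SmoothGerm p :=
  let δ := hω.nabla 0
  let Δ₁ := hω.deltaGerm 1
  let Δ₂ := hω.deltaGerm a
  let Δ₃ := hω.deltaGerm b
  (Δ₁ 4 ∘ₗ Δ₂ 3 ∘ₗ Δ₃ 2 ∘ₗ δ 1 - δ 4 ∘ₗ Δ₂ 3 ∘ₗ Δ₃ 2 ∘ₗ Δ₁ 1) ∘ₗ LinearMap.fst ℝ _ _ +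
  (Δ₁ 4 ∘ₗ Δ₂ 3 ∘ₗ Δ₃ 2 ∘ₗ δ 1 - Δ₁ 4 ∘ₗ δ 3 ∘ₗ Δ₃ 2 ∘ₗ Δ₂ 1) ∘ₗ
    LinearMap.fst ℝ _ _ ∘ₗ LinearMap.snd ℝ _ _ +
  (Δ₁ 4 ∘ₗ Δ₂ 3 ∘ₗ Δ₃ 2 ∘ₗ δ 1 - Δ₁ 4 ∘ₗ Δ₂ 3 ∘ₗ δ 2 ∘ₗ Δ₃ 1) ∘ₗ
    LinearMap.snd ℝ _ _ ∘ₗ LinearMap.snd ℝ _ _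

theorem bracket_monomial (a b w u v : SmoothGerm p) :
    hω.calculus.bracket (monomial 0 a) (monomial 0 b) (monomial 1 w) (monomial 1 u)
      (monomial 1 v) = monomial 5 (hω.bracketGerm a b (w, u, v)) := by
  simp only [WeightedCalculus.bracket, d₁_monomial_nabla, delta_monomial, delta_one_monomial]
  simp only [← map_sub (monomial _), ← map_add (monomial _)]
  simp only [bracketGerm, LinearMap.add_apply, LinearMap.comp_apply, LinearMap.sub_apply,
    LinearMap.fst_apply, LinearMap.snd_apply]

/-- The left-hand sides of the abelian equation as a linear map of germs. -/
def abelianGerm (a b : SmoothGerm p) :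
    (SmoothGerm p × SmoothGerm p × SmoothGerm p) →ₗ[ℝ] Fin 4 → SmoothGerm p :=
  LinearMap.pi ![hω.deltaGerm 1 1 ∘ₗ LinearMap.fst ℝ _ _,
    hω.deltaGerm a 1 ∘ₗ LinearMap.fst ℝ _ _ ∘ₗ LinearMap.snd ℝ _ _,
    hω.deltaGerm b 1 ∘ₗ LinearMap.snd ℝ _ _ ∘ₗ LinearMap.snd ℝ _ _,
    hω.nabla 0 1 ∘ₗ LinearMap.fst ℝ _ _ +
      hω.nabla 0 1 ∘ₗ LinearMap.fst ℝ _ _ ∘ₗ LinearMap.snd ℝ _ _ +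
      hω.nabla 0 1 ∘ₗ LinearMap.snd ℝ _ _ ∘ₗ LinearMap.snd ℝ _ _]

theorem killsEquations_monomial_iff {Q : Type*} [CommRing Q] (π : (SmoothGerm p)[X] →+* Q)
    (a b w u v : SmoothGerm p) :
    hω.calculus.KillsEquations π (monomial 0 a) (monomial 0 b) (monomial 1 w) (monomial 1 u)
      (monomial 1 v) ↔
      ∀ j, hω.calculus.KillsTwoJet π (monomial 2 (hω.abelianGerm a b (w, u, v) j)) := by
  have h₁ : hω.calculus.delta 1 (monomial 1 w) =
      monomial 2 (hω.abelianGerm a b (w, u, v) 0) := hω.delta_one_monomial 1 w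
  have h₂ : hω.calculus.delta (monomial 0 a) (monomial 1 u) =
      monomial 2 (hω.abelianGerm a b (w, u, v) 1) := hω.delta_monomial a 1 u
  have h₃ : hω.calculus.delta (monomial 0 b) (monomial 1 v) =
      monomial 2 (hω.abelianGerm a b (w, u, v) 2) := hω.delta_monomial b 1 v
  have h₄ : hω.calculus.d₁ (monomial 1 w) + hω.calculus.d₁ (monomial 1 u) +
      hω.calculus.d₁ (monomial 1 v) = monomial 2 (hω.abelianGerm a b (w, u, v) 3) := by
    simp only [d₁_monomial_nabla, ← map_add (monomial _)]
    rfl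
  constructor
  · rintro ⟨e₁, e₂, e₃, e₄⟩ j
    rw [h₁] at e₁
    rw [h₂] at e₂
    rw [h₃] at e₃
    rw [h₄] at e₄
    fin_cases j
    exacts [e₁, e₂, e₃, e₄]
  · intro e
    exact ⟨h₁ ▸ e 0, h₂ ▸ e 1, h₃ ▸ e 2, h₄ ▸ e 3⟩

/-- The `2`-jet at `p` of a germ of weight `k`, in terms of covariant derivatives. -/
def twoJet (k : ℕ) : SmoothGerm p →ₗ[ℝ] Fin 6 → ℝ :=
  let D := hω.nabla
  LinearMap.pi fun i => (evalGerm p).toLinearMap ∘ₗ ![LinearMap.id, D 0 k, D 1 k,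
    D 0 (k + 1) ∘ₗ D 0 k, D 1 (k + 1) ∘ₗ D 0 k, D 1 (k + 1) ∘ₗ D 1 k] i

theorem killsTwoJet_monomial_iff (k : ℕ) (x : SmoothGerm p) :
    hω.calculus.KillsTwoJet (forget (evalGerm p).toRingHom) (monomial k x) ↔
      hω.twoJet k x = 0 := by
  constructor
  · rintro ⟨h, h₁, h₂, h₁₁, h₂₁, h₂₂⟩
    simp only [d₁_monomial_nabla, d₂_monomial_nabla, forget_monomial] at h h₁ h₂ h₁₁ h₂₁ h₂₂
    ext i
    fin_cases i
    exacts [h, h₁, h₂, h₁₁, h₂₁, h₂₂]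
  · intro h
    constructor <;> simp only [d₁_monomial_nabla, d₂_monomial_nabla, forget_monomial]
    exacts [congrFun h 0, congrFun h 1, congrFun h 2, congrFun h 3, congrFun h 4, congrFun h 5]

/-- The derivatives of order three at `p` of a germ of weight `k`. -/
def thirdDerivatives (k : ℕ) : SmoothGerm p →ₗ[ℝ] Fin 4 → ℝ :=
  let D := hω.nabla
  LinearMap.pi fun i => (evalGerm p).toLinearMap ∘ₗ ![D 0 (k + 2) ∘ₗ D 0 (k + 1) ∘ₗ D 0 k,
    D 1 (k + 2) ∘ₗ D 0 (k + 1) ∘ₗ D 0 k, D 1 (k + 2) ∘ₗ D 1 (k + 1) ∘ₗ D 0 k,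
    D 1 (k + 2) ∘ₗ D 1 (k + 1) ∘ₗ D 1 k] i

theorem thirdDerivatives_eq_zero (k : ℕ) (x : SmoothGerm p)
    (h : hω.calculus.KillsThreeJet (forget (evalGerm p).toRingHom) (monomial k x)) :
    hω.thirdDerivatives k x = 0 := by
  obtain ⟨-, h₁, h₂, h₃, h₄⟩ := h
  simp only [d₁_monomial_nabla, d₂_monomial_nabla, forget_monomial] at h₁ h₂ h₃ h₄
  ext i
  fin_cases i
  exacts [h₁, h₂, h₃, h₄]

/-- The coordinates `w₂₂, w₂, v₂, w, u, v` on the second prolongation of the abelian equation. -/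
def coordinates : (SmoothGerm p × SmoothGerm p × SmoothGerm p) →ₗ[ℝ] Fin 6 → ℝ :=
  LinearMap.pi fun i => (evalGerm p).toLinearMap ∘ₗ
    ![hω.nabla 1 2 ∘ₗ hω.nabla 1 1 ∘ₗ LinearMap.fst ℝ _ _, hω.nabla 1 1 ∘ₗ LinearMap.fst ℝ _ _,
      hω.nabla 1 1 ∘ₗ LinearMap.snd ℝ _ _ ∘ₗ LinearMap.snd ℝ _ _, LinearMap.fst ℝ _ _,
      LinearMap.fst ℝ _ _ ∘ₗ LinearMap.snd ℝ _ _, LinearMap.snd ℝ _ _ ∘ₗ LinearMap.snd ℝ _ _] i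

/-- The `2`-jets at `p` of the left-hand sides of the abelian equation. -/
def equations (a b : SmoothGerm p) :
    (SmoothGerm p × SmoothGerm p × SmoothGerm p) →ₗ[ℝ] Fin 4 → Fin 6 → ℝ :=
  LinearMap.pi fun j => hω.twoJet 2 ∘ₗ LinearMap.proj j ∘ₗ hω.abelianGerm a b

theorem equations_eq_zero_iff (a b w u v : SmoothGerm p) :
    hω.equations a b (w, u, v) = 0 ↔
      hω.calculus.KillsEquations (forget (evalGerm p).toRingHom) (monomial 0 a) (monomial 0 b)
        (monomial 1 w) (monomial 1 u) (monomial 1 v) := by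
  rw [killsEquations_monomial_iff, funext_iff]
  exact forall_congr' fun j => (hω.killsTwoJet_monomial_iff 2 _).symm

/-- Germs of functions that vanish at `p` and have there the given coframe as differentials. -/
theorem exists_adapted_germs : ∃ ξ η : SmoothGerm p, evalGerm p ξ = 0 ∧ evalGerm p η = 0 ∧
    evalGerm p (hω.deriv 0 ξ) = 1 ∧ evalGerm p (hω.deriv 1 ξ) = 0 ∧
    evalGerm p (hω.deriv 0 η) = 0 ∧ evalGerm p (hω.deriv 1 η) = 1 := by
  have hs : ∀ l : Plane →L[ℝ] ℝ, ContDiffAt ℝ ∞ (fun q => l (q - p)) p := fun l =>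
    (l.contDiff.comp (contDiff_id.sub contDiff_const)).contDiffAt
  have hd : ∀ l : Plane →L[ℝ] ℝ, fderiv ℝ (fun q => l (q - p)) p = l := by
    intro l
    have h := l.hasFDerivAt.comp p ((hasFDerivAt_id p).sub_const p)
    exact h.fderiv
  have hW := hω.wedge_ne_zero
  refine ⟨germ (hs (ω₁ p)), germ (hs (ω₂ p)), ?_, ?_, ?_, ?_, ?_, ?_⟩
  · simp [evalGerm_germ]
  · simp [evalGerm_germ]
  · rw [deriv_germ, evalGerm_germ]
    simp only [frameDeriv, Matrix.cons_val_zero]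
    rw [div_eq_one_iff_eq hW, wedge, wedge, hd]
  · rw [deriv_germ, evalGerm_germ]
    simp only [frameDeriv, Matrix.cons_val_one, Matrix.cons_val_fin_one]
    rw [wedge, hd, mul_comm, sub_self, zero_div]
  · rw [deriv_germ, evalGerm_germ]
    simp only [frameDeriv, Matrix.cons_val_zero]
    rw [wedge, hd, mul_comm, sub_self, zero_div]
  · rw [deriv_germ, evalGerm_germ]
    simp only [frameDeriv, Matrix.cons_val_one, Matrix.cons_val_fin_one]
    rw [div_eq_one_iff_eq hW, wedge, wedge, hd]

theorem nabla_mul (i : Fin 2) (k : ℕ) (x y : SmoothGerm p) :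
    hω.nabla i k (x * y) = hω.deriv i x * y + x * hω.nabla i k y := by
  rw [nabla_apply, nabla_apply, Derivation.leibniz, smul_eq_mul, smul_eq_mul]
  ring

theorem evalGerm_nabla (i : Fin 2) (k : ℕ) {x : SmoothGerm p} (hx : evalGerm p x = 0) :
    evalGerm p (hω.nabla i k x) = evalGerm p (hω.deriv i x) := by
  rw [nabla_apply, map_sub, map_mul, hx, mul_zero, sub_zero]

/-- At `p` only those terms survive in which each factor is differentiated exactly once; the
connection terms keep an undifferentiated factor. The weights therefore play no role. -/
theorem evalGerm_nabla_nabla_mul (i j : Fin 2) (k l : ℕ) {x y : SmoothGerm p}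
    (hx : evalGerm p x = 0) (hy : evalGerm p y = 0) :
    evalGerm p (hω.nabla i l (hω.nabla j k (x * y))) =
      evalGerm p (hω.deriv j x) * evalGerm p (hω.deriv i y) +
        evalGerm p (hω.deriv i x) * evalGerm p (hω.deriv j y) := by
  simp only [nabla_mul, map_add, map_mul, hx, hy, hω.evalGerm_nabla _ _ hy, mul_zero, zero_mul,
    add_zero, zero_add]

theorem evalGerm_nabla_nabla_nabla_mul (i j h : Fin 2) (k l m : ℕ) {x y z : SmoothGerm p}
    (hx : evalGerm p x = 0) (hy : evalGerm p y = 0) (hz : evalGerm p z = 0) :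
    evalGerm p (hω.nabla i m (hω.nabla j l (hω.nabla h k (x * (y * z))))) =
      evalGerm p (hω.deriv h x) * (evalGerm p (hω.deriv j y) * evalGerm p (hω.deriv i z) +
        evalGerm p (hω.deriv i y) * evalGerm p (hω.deriv j z)) +
      evalGerm p (hω.deriv j x) * (evalGerm p (hω.deriv h y) * evalGerm p (hω.deriv i z) +
        evalGerm p (hω.deriv i y) * evalGerm p (hω.deriv h z)) +
      evalGerm p (hω.deriv i x) * (evalGerm p (hω.deriv h y) * evalGerm p (hω.deriv j z) +
        evalGerm p (hω.deriv j y) * evalGerm p (hω.deriv h z)) := by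
  simp only [nabla_mul, map_add, map_mul, hx, hy, hz, hω.evalGerm_nabla _ _ hz, mul_zero,
    zero_mul, add_zero, zero_add]
  ring

/-- Every `3`-jet at `p` is the jet of a germ. -/
theorem exists_threeJet (k : ℕ) (s : Fin 6 → ℝ) (t : Fin 4 → ℝ) :
    ∃ x, hω.twoJet k x = s ∧ hω.thirdDerivatives k x = t := by
  obtain ⟨ξ, η, hξ, hη, hξ₁, hξ₂, hη₁, hη₂⟩ := hω.exists_adapted_germs
  -- Cubic monomials in the adapted germs have zero 2-jet. The denominators 6, 2, 2, 6 are the third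
  -- derivatives of ξ³, ξ²η, ξη², η³.
  have three : ∀ t : Fin 4 → ℝ, ∃ x, hω.twoJet k x = 0 ∧ hω.thirdDerivatives k x = t := by
    intro t
    have hm : ∀ {x y}, evalGerm p x = 0 → evalGerm p (x * y) = 0 := fun h => by
      rw [map_mul, h, zero_mul]
    have hd : ∀ {x y}, evalGerm p x = 0 → evalGerm p y = 0 →
        ∀ i, evalGerm p (hω.deriv i (x * y)) = 0 := fun h h' i => by
      rw [Derivation.leibniz, smul_eq_mul, smul_eq_mul, map_add, map_mul, map_mul, h, h', zero_mul,
        zero_mul, zero_add]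
    have h2 : ∀ {x y z}, evalGerm p x = 0 → evalGerm p y = 0 → evalGerm p z = 0 →
        hω.twoJet k (x * (y * z)) = 0 := by
      intro x y z hx hy hz
      ext i
      fin_cases i
      · exact hm hx
      · exact (hω.evalGerm_nabla 0 k (hm hx)).trans (hd hx (hm hy) 0)
      · exact (hω.evalGerm_nabla 1 k (hm hx)).trans (hd hx (hm hy) 1)
      · refine (hω.evalGerm_nabla_nabla_mul 0 0 k (k + 1) hx (hm hy)).trans ?_
        rw [hd hy hz, mul_zero, add_zero]
        rfl
      · refine (hω.evalGerm_nabla_nabla_mul 1 0 k (k + 1) hx (hm hy)).trans ?_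
        rw [hd hy hz, hd hy hz, mul_zero, mul_zero, add_zero]
        rfl
      · refine (hω.evalGerm_nabla_nabla_mul 1 1 k (k + 1) hx (hm hy)).trans ?_
        rw [hd hy hz, mul_zero, add_zero]
        rfl
    refine ⟨(t 0 / 6) • (ξ * (ξ * ξ)) + (t 1 / 2) • (ξ * (ξ * η)) + (t 2 / 2) • (ξ * (η * η))
      + (t 3 / 6) • (η * (η * η)), ?_, ?_⟩
    · simp only [map_add, map_smul, h2 hξ hξ hξ, h2 hξ hξ hη, h2 hξ hη hη, h2 hη hη hη, smul_zero,
        add_zero]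
    · ext i
      fin_cases i <;>
      simp [thirdDerivatives, evalGerm_nabla_nabla_nabla_mul, hξ, hη, hξ₁, hξ₂, hη₁, hη₂] <;> ring
  -- A quadratic germ adjusts the second order part; a cubic one repairs the third order part
  -- without disturbing it.
  have two : ∀ (c : Fin 3 → ℝ) (t : Fin 4 → ℝ),
      ∃ x, hω.twoJet k x = ![0, 0, 0, c 0, c 1, c 2] ∧ hω.thirdDerivatives k x = t := by
    intro c t
    set y := (c 0 / 2) • (ξ * ξ) + c 1 • (ξ * η) + (c 2 / 2) • (η * η) with hy
    obtain ⟨z, hz, hz'⟩ := three (t - hω.thirdDerivatives k y)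
    refine ⟨y + z, ?_, by rw [map_add, hz', add_sub_cancel]⟩
    rw [map_add, hz, add_zero, hy]
    ext i
    fin_cases i <;>
    simp [twoJet, nabla_mul, hω.evalGerm_nabla _ _ hξ, hω.evalGerm_nabla _ _ hη, hξ, hη, hξ₁, hξ₂,
      hη₁, hη₂]
  -- The linear coefficients compensate for the covariant derivative of the constant `s 0`, which in
  -- weight k is -k gᵢ times it.
  set y := s 0 • (1 : SmoothGerm p) + (s 1 + k * evalGerm p (hω.connection 0) * s 0) • ξ +
    (s 2 + k * evalGerm p (hω.connection 1) * s 0) • η with hy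
  obtain ⟨z, hz, hz'⟩ := two ![s 3 - hω.twoJet k y 3, s 4 - hω.twoJet k y 4,
    s 5 - hω.twoJet k y 5] (t - hω.thirdDerivatives k y)
  refine ⟨y + z, ?_, by rw [map_add, hz', add_sub_cancel]⟩
  rw [map_add, hz]
  have h0 : hω.twoJet k y 0 = s 0 := by
    simp [twoJet, hy, hξ, hη]
  have h1 : hω.twoJet k y 1 = s 1 := by
    simp [twoJet, nabla_apply, hy, hξ, hη, hξ₁, hη₁]
  have h2 : hω.twoJet k y 2 = s 2 := by
    simp [twoJet, nabla_apply, hy, hξ, hη, hξ₂, hη₂]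
  clear_value y
  ext i
  fin_cases i <;> simp [h0, h1, h2]

theorem euler_monomial_zero (x : SmoothGerm p) : hω.calculus.euler (monomial 0 x) = 0 := by
  rw [euler_monomial, Nat.cast_zero, zero_mul, map_zero]

theorem euler_monomial_one (x : SmoothGerm p) :
    hω.calculus.euler (monomial 1 x) = monomial 1 x := by
  rw [euler_monomial, Nat.cast_one, one_mul]

/-- The `3`-jets of the elements of the second prolongation are determined by the coordinates,
which can be prescribed arbitrarily. -/
theorem coordinates_surjective {a b : SmoothGerm p}
    (g : WeightedCalculus.Generic (evalGerm p a) (evalGerm p b)) (c : Fin 6 → ℝ) :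
    ∃ x, hω.equations a b x = 0 ∧ hω.coordinates x = c := by
  let T₁ := (hω.twoJet 1).prod (hω.thirdDerivatives 1)
  have hT₁ : Function.Surjective T₁ := fun y => by
    obtain ⟨x, h1, h2⟩ := hω.exists_threeJet 1 y.1 y.2
    exact ⟨x, Prod.ext h1 h2⟩
  let T := T₁.prodMap (T₁.prodMap T₁)
  have hT : Function.Surjective T := hT₁.prodMap (hT₁.prodMap hT₁)
  -- Both targets have dimension 30: 4·6 + 6 for equations with coordinates, and 3·(6 + 4) for the
  -- three 3-jets.
  have hs := surjective_of_ker_le ((hω.equations a b).prod hω.coordinates) T hT ?_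
    (by simp [Module.finrank_pi_fintype])
  · obtain ⟨x, hx⟩ := hs (0, c)
    exact ⟨x, congrArg Prod.fst hx, congrArg Prod.snd hx⟩
  · rintro ⟨w, u, v⟩ hx
    have he : hω.equations a b (w, u, v) = 0 := congrArg Prod.fst hx
    have hc : ∀ i, hω.coordinates (w, u, v) i = 0 := congrFun (congrArg Prod.snd hx)
    rw [equations_eq_zero_iff] at he
    obtain ⟨kw, ku, kv⟩ := hω.calculus.killsThreeJet_of_coordinates
      (forget (evalGerm p).toRingHom) (hω.euler_monomial_zero a) (hω.euler_monomial_zero b)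
      (hω.euler_monomial_one w) (hω.euler_monomial_one u) (hω.euler_monomial_one v)
      (by rw [forget_monomial, forget_monomial]; exact g) he
      (by rw [forget_monomial]; exact hc 3) (by rw [forget_monomial]; exact hc 4)
      (by rw [forget_monomial]; exact hc 5)
      (by rw [d₂_monomial_nabla, forget_monomial]; exact hc 1)
      (by rw [d₂_monomial_nabla, forget_monomial]; exact hc 2)
      (by rw [d₂_monomial_nabla, d₂_monomial_nabla, forget_monomial]; exact hc 0)
    have k : ∀ y, hω.calculus.KillsThreeJet (forget (evalGerm p).toRingHom) (monomial 1 y) →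
        T₁ y = 0 := fun y hy =>
      Prod.ext ((hω.killsTwoJet_monomial_iff 1 y).1 hy.toKillsTwoJet)
        (hω.thirdDerivatives_eq_zero 1 y hy)
    exact Prod.ext (k w kw) (Prod.ext (k u ku) (k v kv))

/-! ### The coefficients of the obstruction -/

/-- The quadratic terms g₁g₂ of dγ cancel, which leaves ∂₁g₂ - ∂₂g₁, the `κ` of the weighted
calculus. -/
theorem curvatureFunction_eq : curvatureFunction ω₁ ω₂ p =
    evalGerm p (hω.deriv 0 (germ hω.contDiffAt_g₂) - hω.deriv 1 (germ hω.contDiffAt_g₁)) := by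
  rw [deriv_germ, deriv_germ, map_sub, evalGerm_germ, evalGerm_germ, curvatureFunction,
    show connectionForm ω₁ ω₂ = fun q => g₁ ω₁ ω₂ q • ω₁ q + g₂ ω₁ ω₂ q • ω₂ q from rfl, extD_components hω.wedge_ne_zero (hω.smooth₁.differentiableAt (by simp))
      (hω.smooth₂.differentiableAt (by simp)) (hω.contDiffAt_g₁.differentiableAt (by simp))
      (hω.contDiffAt_g₂.differentiableAt (by simp)), mul_div_cancel_right₀ _ hω.wedge_ne_zero]
  ring

/-- The restriction of the multi-bracket to the elements of the second prolongation of the abelian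
equation with `w₂ = v₂ = w = u = v = 0`. -/
theorem evalGerm_bracketGerm {a b : Plane → ℝ} (ha : ContDiffAt ℝ ∞ a p)
    (hb : ContDiffAt ℝ ∞ b p) (g : WeightedCalculus.Generic (a p) (b p))
    {x : SmoothGerm p × SmoothGerm p × SmoothGerm p}
    (he : hω.equations (germ ha) (germ hb) x = 0) (hx : ∀ i ≠ 0, hω.coordinates x i = 0) :
    evalGerm p (hω.bracketGerm (germ ha) (germ hb) x) =
      -10 * (1 - a p) * (1 - b p) * c₀Expression ω₁ ω₂ a b p * hω.coordinates x 0 := by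
  obtain ⟨w, u, v⟩ := x
  rw [equations_eq_zero_iff] at he
  have h := hω.calculus.bracket_eq
      (forget (evalGerm p).toRingHom) (hω.euler_monomial_zero (germ ha))
      (hω.euler_monomial_zero (germ hb))
      (hω.euler_monomial_one w) (hω.euler_monomial_one u) (hω.euler_monomial_one v)
      (by rw [forget_monomial, forget_monomial]; exact g) he
      (by rw [forget_monomial]; exact hx 3 (by decide))
      (by rw [forget_monomial]; exact hx 4 (by decide))
      (by rw [forget_monomial]; exact hx 5 (by decide))
      (by rw [d₂_monomial_nabla, forget_monomial]; exact hx 1 (by decide))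
      (by rw [d₂_monomial_nabla, forget_monomial]; exact hx 2 (by decide))
  -- On weight 0 the curvature term is absent, so ∇₂∇₁ in the algebraic formula may be replaced by
  -- the ∇₁∇₂ of `c₀Expression`.
  have hc : ∀ f (hf : ContDiffAt ℝ ∞ f p), forget (evalGerm p).toRingHom
      (hω.calculus.d₂ (hω.calculus.d₁ (monomial 0 (germ hf)))) =
      covDeriv ω₁ ω₂ 0 1 (covDeriv ω₁ ω₂ 1 0 f) p := by
    intro f hf
    have hcomm := hω.calculus.comm (monomial 0 (germ hf))
    rw [euler_monomial_zero, mul_zero, sub_zero] at hcomm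
    rw [← hcomm, d₂_germ, d₁_germ, forget_monomial]
    rfl
  have hκ : forget (evalGerm p).toRingHom hω.calculus.κ = curvatureFunction ω₁ ω₂ p := by
    rw [hω.curvatureFunction_eq]
    exact forget_monomial _ 2 _
  rw [hc, hc, hκ, bracket_monomial] at h
  simp only [d₁_germ, d₂_germ, forget_monomial] at h
  rw [d₂_monomial_nabla, d₂_monomial_nabla, forget_monomial] at h
  exact h

/-- This makes the multi-bracket on 𝔄₃ a function of the six coordinates alone, although it is an
operator of higher order. -/
theorem evalGerm_bracketGerm_eq_zero {a b : Plane → ℝ} (ha : ContDiffAt ℝ ∞ a p)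
    (hb : ContDiffAt ℝ ∞ b p) (g : WeightedCalculus.Generic (a p) (b p))
    {x : SmoothGerm p × SmoothGerm p × SmoothGerm p}
    (he : hω.equations (germ ha) (germ hb) x = 0) (hx : hω.coordinates x = 0) :
    evalGerm p (hω.bracketGerm (germ ha) (germ hb) x) = 0 := by
  rw [hω.evalGerm_bracketGerm ha hb g he (fun i _ => congrFun hx i), hx, Pi.zero_apply, mul_zero]

theorem isObstructionCoefficients_iff {a b : Plane → ℝ} (ha : ContDiffAt ℝ ∞ a p)
    (hb : ContDiffAt ℝ ∞ b p) (c : Fin 6 → ℝ) :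
    IsObstructionCoefficients ω₁ ω₂ a b p c ↔ ∀ x, hω.equations (germ ha) (germ hb) x = 0 →
      evalGerm p (hω.bracketGerm (germ ha) (germ hb) x) / (-10 * (1 - a p) * (1 - b p)) =
        ∑ i, c i * hω.coordinates x i := by
  have key : ∀ {w u v : Plane → ℝ} (hw : ContDiffAt ℝ ∞ w p) (hu : ContDiffAt ℝ ∞ u p)
      (hv : ContDiffAt ℝ ∞ v p),
      (JetMemA₃ ω₁ ω₂ a b w u v p ↔
        hω.equations (germ ha) (germ hb) (germ hw, germ hu, germ hv) = 0) ∧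
      obstruction ω₁ ω₂ a b w u v p = evalGerm p (hω.bracketGerm (germ ha) (germ hb)
        (germ hw, germ hu, germ hv)) / (-10 * (1 - a p) * (1 - b p)) ∧
      ∑ i, c i * hω.coordinates (germ hw, germ hu, germ hv) i =
        c 0 * covDeriv ω₁ ω₂ 1 2 (covDeriv ω₁ ω₂ 1 1 w) p + c 1 * covDeriv ω₁ ω₂ 1 1 w p +
        c 2 * covDeriv ω₁ ω₂ 1 1 v p + c 3 * w p + c 4 * u p + c 5 * v p := by
    intro w u v hw hu hv
    refine ⟨?_, ?_, ?_⟩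
    · rw [hω.jetMemA₃_iff ha hb hw hu hv, equations_eq_zero_iff]
    · have h := hω.bracket_germ ha hb hw hu hv
      rw [bracket_monomial] at h
      rw [obstruction, monomial_injective 5 h]
      rfl
    · have h2 : hω.coordinates (germ hw, germ hu, germ hv) 0 =
          covDeriv ω₁ ω₂ 1 2 (covDeriv ω₁ ω₂ 1 1 w) p := by
        change evalGerm p (hω.nabla 1 2 (hω.nabla 1 1 (germ hw))) = _
        rw [nabla_germ, nabla_germ, evalGerm_germ]
      have h1 : ∀ {f} (hf : ContDiffAt ℝ ∞ f p), evalGerm p (hω.nabla 1 1 (germ hf)) =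
          covDeriv ω₁ ω₂ 1 1 f p := fun hf => by rw [nabla_germ, evalGerm_germ]
      rw [Fin.sum_univ_six, h2, ← h1 hw, ← h1 hv]
      rfl
  constructor
  · rintro h ⟨w, u, v⟩ he
    obtain ⟨w, hw, rfl⟩ := exists_germ w
    obtain ⟨u, hu, rfl⟩ := exists_germ u
    obtain ⟨v, hv, rfl⟩ := exists_germ v
    obtain ⟨k1, k2, k3⟩ := key hw hu hv
    rw [k3, ← k2]
    exact h w u v hw hu hv (k1.2 he)
  · intro h w u v hw hu hv hj
    obtain ⟨k1, k2, k3⟩ := key hw hu hv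
    rw [← k3, k2]
    exact h _ (k1.1 hj)

/-- Elements `e i` of 𝔄₃ dual to the coordinates force the coefficient `c i` to be the value of the
obstruction at `e i`, which gives uniqueness and, for `e 0`, the formula for c₀. Conversely an
element of 𝔄₃ minus its expansion in the `e i` has zero coordinates, so its bracket vanishes. -/
theorem exists_obstructionCoefficients (hω : IsCoframeAt ω₁ ω₂ p) {a b : Plane → ℝ}
    (ha : ContDiffAt ℝ ∞ a p)
    (hb : ContDiffAt ℝ ∞ b p) (g : WeightedCalculus.Generic (a p) (b p)) :
    ∃ c : Fin 6 → ℝ, IsObstructionCoefficients ω₁ ω₂ a b p c ∧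
      (∀ c', IsObstructionCoefficients ω₁ ω₂ a b p c' → c' = c) ∧
      c 0 = c₀Expression ω₁ ω₂ a b p := by
  choose e he hc using fun i : Fin 6 =>
    hω.coordinates_surjective (a := germ ha) (b := germ hb) g (Pi.single i 1)
  set N := -10 * (1 - a p) * (1 - b p) with hN
  set B : (SmoothGerm p × SmoothGerm p × SmoothGerm p) →ₗ[ℝ] ℝ :=
    (evalGerm p).toLinearMap ∘ₗ hω.bracketGerm (germ ha) (germ hb) with hB
  have hBx : ∀ x, evalGerm p (hω.bracketGerm (germ ha) (germ hb) x) = B x := fun _ => rfl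
  have hN0 : N ≠ 0 := by
    have h1 := g.a_sub_one.ne_zero
    have h2 := g.b_sub_one.ne_zero
    refine mul_ne_zero (mul_ne_zero (by norm_num) ?_) ?_
    · rwa [← neg_sub, neg_ne_zero]
    · rwa [← neg_sub, neg_ne_zero]
  have hex : IsObstructionCoefficients ω₁ ω₂ a b p fun i => B (e i) / N := by
    rw [hω.isObstructionCoefficients_iff ha hb]
    intro x hx
    have h0 : B (x - ∑ i, hω.coordinates x i • e i) = 0 := by
      refine hω.evalGerm_bracketGerm_eq_zero ha hb g ?_ ?_
      · simp [hx, he]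
      · ext j
        simp [hc, Pi.single_apply]
    rw [map_sub, map_sum, sub_eq_zero] at h0
    rw [hBx, h0, Finset.sum_div]
    refine Finset.sum_congr rfl fun i _ => ?_
    rw [map_smul, smul_eq_mul]
    ring
  refine ⟨_, hex, fun c' hc' => ?_, ?_⟩
  · rw [hω.isObstructionCoefficients_iff ha hb] at hc'
    ext i
    have h := hc' (e i) (he i)
    simp only [hc, Pi.single_apply, mul_ite, mul_one, mul_zero, Finset.sum_ite_eq',
      Finset.mem_univ, if_true] at h
    exact h.symm
  · have h := hω.evalGerm_bracketGerm ha hb g (he 0) (fun i hi => by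
      rw [hc, Pi.single_eq_of_ne hi])
    rw [hc, Pi.single_eq_same, mul_one, hBx] at h
    simp only [h]
    exact mul_div_cancel_left₀ _ hN0

/-! ### Curvatures of the ten 3-subwebs -/

/-- The germs `x, y` are the components of the form `ρ` in the coframe `ω₁, ω₂` near `p`. -/
def HasComponents (ω₁ ω₂ ρ : OneForm) (x y : SmoothGerm p) : Prop :=
  ∃ (f g : Plane → ℝ) (hf : ContDiffAt ℝ ∞ f p) (hg : ContDiffAt ℝ ∞ g p),
    germ hf = x ∧ germ hg = y ∧ ρ =ᶠ[𝓝 p] fun q => f q • ω₁ q + g q • ω₂ q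

theorem HasComponents.smul {ρ : OneForm} {x y : SmoothGerm p} (h : HasComponents ω₁ ω₂ ρ x y)
    {c : Plane → ℝ} (hc : ContDiffAt ℝ ∞ c p) :
    HasComponents ω₁ ω₂ (fun q => c q • ρ q) (germ hc * x) (germ hc * y) := by
  obtain ⟨f, g, hf, hg, rfl, rfl, h⟩ := h
  refine ⟨c * f, c * g, hc.mul hf, hc.mul hg, rfl, rfl, ?_⟩
  filter_upwards [h] with q hq
  simp [hq, mul_smul]

theorem HasComponents.neg {ρ : OneForm} {x y : SmoothGerm p} (h : HasComponents ω₁ ω₂ ρ x y) :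
    HasComponents ω₁ ω₂ (fun q => -ρ q) (-x) (-y) := by
  obtain ⟨f, g, hf, hg, rfl, rfl, h⟩ := h
  refine ⟨-f, -g, hf.neg, hg.neg, rfl, rfl, ?_⟩
  filter_upwards [h] with q hq
  rw [hq]
  simp only [Pi.neg_apply]
  module

/-- The curvature of the `3`-web with the coframe `ρ₁, ρ₂`, whose connection form has the
components `g₁ + s₁`, `g₂ + s₂` in the coframe `ω₁, ω₂`. -/
theorem curvatureFunction_mul_wedge {ρ₁ ρ₂ : OneForm} {x₁ y₁ x₂ y₂ : SmoothGerm p}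
    (h₁ : HasComponents ω₁ ω₂ ρ₁ x₁ y₁) (h₂ : HasComponents ω₁ ω₂ ρ₂ x₂ y₂)
    (s₁ s₂ : SmoothGerm p) (hne : evalGerm p (x₁ * y₂ - y₁ * x₂) ≠ 0)
    (e₁ : x₁ * s₂ - y₁ * s₁ = hω.nabla 0 0 y₁ - hω.nabla 1 0 x₁)
    (e₂ : x₂ * s₂ - y₂ * s₁ = hω.nabla 0 0 y₂ - hω.nabla 1 0 x₂) :
    curvatureFunction ρ₁ ρ₂ p * wedge ρ₁ ρ₂ p =
      (curvatureFunction ω₁ ω₂ p + evalGerm p (hω.nabla 0 1 s₂ - hω.nabla 1 1 s₁)) *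
        wedge ω₁ ω₂ p := by
  obtain ⟨f₁, k₁, hf₁, hk₁, rfl, rfl, h₁⟩ := h₁
  obtain ⟨f₂, k₂, hf₂, hk₂, rfl, rfl, h₂⟩ := h₂
  obtain ⟨σ₁, hσ₁, rfl⟩ := exists_germ s₁
  obtain ⟨σ₂, hσ₂, rfl⟩ := exists_germ s₂
  simp only [nabla_apply, Nat.cast_zero, zero_mul, sub_zero, deriv_germ, germ_mul, germ_sub,
    germ_eq_iff] at e₁ e₂
  have hw : ∀ q, ρ₁ q = f₁ q • ω₁ q + k₁ q • ω₂ q → ρ₂ q = f₂ q • ω₁ q + k₂ q • ω₂ q →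
      wedge ρ₁ ρ₂ q = (f₁ q * k₂ q - k₁ q * f₂ q) * wedge ω₁ ω₂ q := by
    intro q r₁ r₂
    simp only [wedge, r₁, r₂, add_apply, smul_apply, smul_eq_mul]
    ring
  have hne' : f₁ p * k₂ p - k₁ p * f₂ p ≠ 0 := hne
  have hev : ∀ᶠ q in 𝓝 p, f₁ q * k₂ q - k₁ q * f₂ q ≠ 0 :=
    ((hf₁.mul hk₂).sub (hk₁.mul hf₂)).continuousAt.eventually_ne hne'
  have hG₁ : ContDiffAt ℝ ∞ (g₁ ω₁ ω₂ + σ₁) p := hω.contDiffAt_g₁.add hσ₁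
  have hG₂ : ContDiffAt ℝ ∞ (g₂ ω₁ ω₂ + σ₂) p := hω.contDiffAt_g₂.add hσ₂
  -- Relative to γ, the structure equations for `ρ₁` and `ρ₂` are precisely `e₁` and `e₂`;
  -- uniqueness of the connection form does the rest.
  have hconn : connectionForm ρ₁ ρ₂ =ᶠ[𝓝 p] fun q =>
      (g₁ ω₁ ω₂ + σ₁) q • ω₁ q + (g₂ ω₁ ω₂ + σ₂) q • ω₂ q := by
    filter_upwards [h₁, h₂, h₁.eventually_nhds, h₂.eventually_nhds, hev,
      hω.eventually_wedge_ne_zero, hω.extD_components_eventually hf₁ hk₁,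
      hω.extD_components_eventually hf₂ hk₂, e₁, e₂] with q r₁ r₂ n₁ n₂ hne hW d₁ d₂ e₁ e₂
    have hwq : wedge ρ₁ ρ₂ q ≠ 0 := by
      rw [hw q r₁ r₂]
      exact mul_ne_zero hne hW
    refine ((structure_equations_iff ρ₁ ρ₂ (fun q =>
      (g₁ ω₁ ω₂ + σ₁) q • ω₁ q + (g₂ ω₁ ω₂ + σ₂) q • ω₂ q) q hwq).1 ⟨?_, ?_⟩).symm
    · rw [extD_congr n₁, d₁]
      simp only [wedge, r₁, add_apply, smul_apply, smul_eq_mul, Pi.add_apply]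
      linear_combination -(ω₁ q ex * ω₂ q ey - ω₁ q ey * ω₂ q ex) * e₁
    · rw [extD_congr n₂, d₂]
      simp only [wedge, r₂, add_apply, smul_apply, smul_eq_mul, Pi.add_apply]
      linear_combination -(ω₁ q ex * ω₂ q ey - ω₁ q ey * ω₂ q ex) * e₂
  have hwp : wedge ρ₁ ρ₂ p ≠ 0 := by
    rw [hw p h₁.eq_of_nhds h₂.eq_of_nhds]
    exact mul_ne_zero hne' hω.wedge_ne_zero
  have hd : ∀ {f : Plane → ℝ}, ContDiffAt ℝ ∞ f p → DifferentiableAt ℝ f p :=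
    fun h => h.differentiableAt (by simp)
  rw [curvatureFunction, div_mul_cancel₀ _ hwp, extD_congr hconn,
    extD_components hω.wedge_ne_zero (hω.smooth₁.differentiableAt (by simp))
      (hω.smooth₂.differentiableAt (by simp)) (hd hG₁) (hd hG₂),
    frameDeriv_add _ _ _ (hd hω.contDiffAt_g₁) (hd hσ₁),
    frameDeriv_add _ _ _ (hd hω.contDiffAt_g₂) (hd hσ₂), hω.curvatureFunction_eq]
  -- The exterior derivative of σ₁ω₁ + σ₂ω₂ has the coefficient ∇₁σ₂ - ∇₂σ₁, where the components
  -- have weight 1.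
  congr 1
  simp only [nabla_apply, deriv_germ, map_sub, map_mul, evalGerm_germ, connection, Nat.cast_one,
    one_mul, Matrix.cons_val_zero, Matrix.cons_val_one, Matrix.cons_val_fin_one, Pi.add_apply]
  ring

/-- Curvature acts through the weight, hence not at all on weight 0. -/
theorem nabla_nabla_comm (x : SmoothGerm p) :
    hω.nabla 1 1 (hω.nabla 0 0 x) = hω.nabla 0 1 (hω.nabla 1 0 x) := by
  have h := hω.calculus.comm (monomial 0 x)
  rw [euler_monomial_zero, mul_zero, sub_zero, d₁_monomial_nabla, d₂_monomial_nabla,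
    d₁_monomial_nabla, d₂_monomial_nabla] at h
  exact (monomial_injective 2 h).symm

theorem nabla_zero_mul (i : Fin 2) (x y : SmoothGerm p) :
    hω.nabla i 0 (x * y) = x * hω.nabla i 0 y + y * hω.nabla i 0 x := by
  simp only [nabla_apply, Nat.cast_zero, zero_mul, sub_zero, Derivation.leibniz, smul_eq_mul]

theorem nabla_zero_one (i : Fin 2) : hω.nabla i 0 1 = 0 := by
  simp [nabla_apply]

/-- The Leibniz rule for the product of functions of weights `0` and `1`. -/
theorem nabla_one_mul (i : Fin 2) (x y : SmoothGerm p) :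
    hω.nabla i 1 (x * y) = hω.nabla i 0 x * y + x * hω.nabla i 1 y := by
  rw [nabla_mul, nabla_apply (k := 0), Nat.cast_zero, zero_mul, zero_mul, sub_zero]

theorem nabla_inverse (i : Fin 2) {x y : SmoothGerm p} (h : x * y = 1) :
    hω.nabla i 0 y = -(y * y) * hω.nabla i 0 x := by
  have h1 := hω.nabla_zero_mul i x y
  rw [h, nabla_zero_one] at h1
  linear_combination -hω.nabla i 0 y * h - y * h1

/-- The components of the forms `ρ₁, ρ₂` that define the ten `3`-subwebs, where `i = 1 / b`. -/
def subwebComponents (a b i : SmoothGerm p) :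
    Fin 10 → (SmoothGerm p × SmoothGerm p) × (SmoothGerm p × SmoothGerm p) :=
  ![((1, 0), (0, 1)), ((a, 0), (0, 1)), ((a - 1, 0), (1, 1)), ((0, a - 1), (-a, -a)),
    ((b, 0), (0, 1)), ((b - 1, 0), (1, 1)), ((0, b - 1), (-b, -b)), ((a - b, 0), (-a, -1)),
    ((0, (b - a) * i), (-a, -1)), ((-(a - b), -(a - b)), ((1 - b) * a, 1 - b))]

/-- The differences between the components of the connection forms of the ten `3`-subwebs and of
`[1,2,3]`, where `i, j, k, l, h` are the inverses of `a, a - 1, b, b - 1, a - b`. -/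
def connectionShift (a b i j k l h : SmoothGerm p) : Fin 10 → SmoothGerm p × SmoothGerm p :=
  let a₁ := hω.nabla 0 0 a
  let a₂ := hω.nabla 1 0 a
  let b₁ := hω.nabla 0 0 b
  let b₂ := hω.nabla 1 0 b
  ![(0, 0), (0, -(i * a₂)), (-(j * a₂), -(j * a₂)), (-(j * a₁), (i - j) * a₁ - i * a₂),
    (0, -(k * b₂)), (-(l * b₂), -(l * b₂)), (-(l * b₁), (k - l) * b₁ - k * b₂),
    (a₂ - a * h * a₂ + a * h * b₂, h * b₂ - h * a₂),
    (a * h * k * b₁ - h * a₁, h * k * b₁ - i * h * a₁ - i * a₂),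
    (j * l * b₁ - a * j * l * b₂ - j * a₂ - j * h * a₁ + j * h * b₁ + j * h * a₂ - j * h * b₂
        - h * a₁ + h * b₁ + h * a₂ - h * b₂,
      j * l * b₁ - a * j * l * b₂ - j * a₂ - j * h * a₁ + j * h * b₁ + j * h * a₂
        - j * h * b₂)]

/-- For each subweb the shift solves two linear equations in two unknowns. With the inverses treated
as variables, the verification is polynomial algebra modulo the five relations. -/
theorem connectionShift_spec {a b i j k l h : SmoothGerm p} (hi : a * i = 1)
    (hj : (a - 1) * j = 1) (hk : b * k = 1) (hl : (b - 1) * l = 1) (hh : (a - b) * h = 1)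
    (n : Fin 10) :
    let x := subwebComponents a b k n
    let s := hω.connectionShift a b i j k l h n
    x.1.1 * s.2 - x.1.2 * s.1 = hω.nabla 0 0 x.1.2 - hω.nabla 1 0 x.1.1 ∧
      x.2.1 * s.2 - x.2.2 * s.1 = hω.nabla 0 0 x.2.2 - hω.nabla 1 0 x.2.1 := by
  fin_cases n <;>
  simp [subwebComponents, connectionShift, nabla_zero_mul, nabla_zero_one, hω.nabla_inverse _ hk]
    <;> generalize hω.nabla 0 0 a = a₁ <;> generalize hω.nabla 1 0 a = a₂ <;>
    generalize hω.nabla 0 0 b = b₁ <;> generalize hω.nabla 1 0 b = b₂ <;>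
    (try constructor) <;> grind

/-- These ten corrections are all that separates 10 L from 10 K. The Leibniz rule and the
derivatives of inverses reduce the claim to an identity of rational functions in the values at `p`
of `a`, `b` and their derivatives. -/
theorem sum_connectionShift {a b i j k l h : SmoothGerm p} (hi : a * i = 1)
    (hj : (a - 1) * j = 1) (hk : b * k = 1) (hl : (b - 1) * l = 1) (hh : (a - b) * h = 1) :
    let E := evalGerm p
    let D := hω.nabla
    let a₁₁ := E (D 0 1 (D 0 0 a))
    let a₁₂ := E (D 0 1 (D 1 0 a))
    let a₂₂ := E (D 1 1 (D 1 0 a))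
    let b₁₁ := E (D 0 1 (D 0 0 b))
    let b₁₂ := E (D 0 1 (D 1 0 b))
    let b₂₂ := E (D 1 1 (D 1 0 b))
    let A := E a
    let a₁ := E (D 0 0 a)
    let a₂ := E (D 1 0 a)
    let B := E b
    let b₁ := E (D 0 0 b)
    let b₂ := E (D 1 0 b)
    ∑ n, E (D 0 1 (hω.connectionShift a b i j k l h n).2 -
        D 1 1 (hω.connectionShift a b i j k l h n).1) =
      10 * (exprR A a₁ a₂ a₁₁ a₁₂ a₂₂ B b₂ + exprR B b₁ b₂ b₁₁ b₁₂ b₂₂ A a₂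
        - (A - A ^ 2 + B - B ^ 2 - 4 * A * B + 2 * A ^ 2 * B + 2 * A * B ^ 2)
          / (10 * (-1 + A) * A * (A - B) ^ 2 * (-1 + B) * B) * (a₁ * b₁)
        + (2 * A - A ^ 2 + 2 * B - B ^ 2 - 4 * A * B + A ^ 2 * B + A * B ^ 2)
          / (10 * (-1 + A) * (A - B) ^ 2 * (-1 + B)) * (a₂ * b₂)) := by
  intro E D a₁₁ a₁₂ a₂₂ b₁₁ b₁₂ b₂₂ A a₁ a₂ B b₁ b₂
  have ev : ∀ {x y : SmoothGerm p}, x * y = 1 → E x ≠ 0 ∧ E y = (E x)⁻¹ := by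
    intro x y hxy
    have h1 := congrArg E hxy
    rw [map_mul, map_one] at h1
    exact ⟨left_ne_zero_of_mul_eq_one h1, eq_inv_of_mul_eq_one_right h1⟩
  obtain ⟨ni, ei⟩ := ev hi
  obtain ⟨nj, ej⟩ := ev hj
  obtain ⟨nk, ek⟩ := ev hk
  obtain ⟨nl, el⟩ := ev hl
  obtain ⟨nh, eh⟩ := ev hh
  simp only [Fin.sum_univ_succ, Fin.sum_univ_zero, connectionShift]
  simp [nabla_one_mul, nabla_zero_mul, nabla_zero_one, hω.nabla_inverse _ hi,
    hω.nabla_inverse _ hj, hω.nabla_inverse _ hk, hω.nabla_inverse _ hl, hω.nabla_inverse _ hh,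
    nabla_nabla_comm, D, a₁₁, a₁₂, a₂₂, b₁₁, b₁₂, b₂₂, A, a₁, a₂, B, b₁, b₂]
  simp only [map_sub, map_one] at nj nl nh ej el eh
  simp only [ei, ej, ek, el, eh, exprR]
  clear ei ej ek el eh hi hj hk hl hh a₁₁ a₁₂ a₂₂ b₁₁ b₁₂ b₂₂ A a₁ a₂ B b₁ b₂ ev
  generalize E a = A at *
  generalize E b = B at *
  generalize E (hω.nabla 0 0 a) = a₁
  generalize E (hω.nabla 1 0 a) = a₂
  generalize E (hω.nabla 0 0 b) = b₁
  generalize E (hω.nabla 1 0 b) = b₂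
  generalize E (hω.nabla 0 1 (hω.nabla 0 0 a)) = a₁₁
  generalize E (hω.nabla 0 1 (hω.nabla 1 0 a)) = a₁₂
  generalize E (hω.nabla 1 1 (hω.nabla 1 0 a)) = a₂₂
  generalize E (hω.nabla 0 1 (hω.nabla 0 0 b)) = b₁₁
  generalize E (hω.nabla 0 1 (hω.nabla 1 0 b)) = b₁₂
  generalize E (hω.nabla 1 1 (hω.nabla 1 0 b)) = b₂₂
  have nj' : -1 + A ≠ 0 := by rwa [neg_add_eq_sub]
  have nl' : -1 + B ≠ 0 := by rwa [neg_add_eq_sub]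
  rw [← neg_add_eq_sub 1 A, ← neg_add_eq_sub 1 B, ← neg_sub A B]
  field_simp
  ring

end IsCoframeAt

/-! ### Normalized webs and the equality of c₀ with the curvature -/

theorem wedge_ne_zero_of_linearIndependent {α β : OneForm}
    (h : LinearIndependent ℝ ![α p, β p]) : wedge α β p ≠ 0 := by
  intro h0
  rw [LinearIndependent.pair_iff] at h
  have h1 := h (β p ex) (-α p ex) (covector_ext
    (by simp only [add_apply, smul_apply, smul_eq_mul, zero_apply]; ring)
    (by
      simp only [add_apply, smul_apply, smul_eq_mul, zero_apply]
      rw [wedge] at h0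
      linear_combination -h0))
  have h2 := h (β p ey) (-α p ey) (covector_ext
    (by
      simp only [add_apply, smul_apply, smul_eq_mul, zero_apply]
      rw [wedge] at h0
      linear_combination h0)
    (by simp only [add_apply, smul_apply, smul_eq_mul, zero_apply]; ring))
  have h3 := h 0 1 (by
    rw [zero_smul, zero_add, one_smul]
    exact covector_ext (by rw [h1.1, zero_apply]) (by rw [h2.1, zero_apply]))
  exact one_ne_zero h3.2

namespace IsNormalization

variable {W : PlanarWeb 5} {θ : Fin 5 → OneForm} {a b : Plane → ℝ} (h : IsNormalization W θ a b)
include h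

theorem wedge_ne_zero (hp : p ∈ W.domain) {i j : Fin 5} (hij : i ≠ j) :
    wedge (θ i) (θ j) p ≠ 0 := by
  obtain ⟨s, hs, hs'⟩ := h.same_foliations i p hp
  obtain ⟨t, ht, ht'⟩ := h.same_foliations j p hp
  have hw : wedge (θ i) (θ j) p = s * t * wedge (W.form i) (W.form j) p := by
    simp only [wedge, hs', ht', smul_apply, smul_eq_mul]
    ring
  rw [hw]
  exact mul_ne_zero (mul_ne_zero hs ht)
    (wedge_ne_zero_of_linearIndependent (W.general_position i j hij p hp))

theorem smoothAt (hp : p ∈ W.domain) (i : Fin 5) : ContDiffAt ℝ ∞ (θ i) p :=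
  (h.smooth i).contDiffAt (W.isOpen_domain.mem_nhds hp)

theorem isCoframeAt (hp : p ∈ W.domain) : IsCoframeAt (θ 0) (θ 1) p :=
  ⟨h.smoothAt hp 0, h.smoothAt hp 1, h.wedge_ne_zero hp (by decide)⟩

theorem form₂_eq (hp : p ∈ W.domain) : θ 2 p = -θ 0 p - θ 1 p := by
  rw [← sub_eq_zero, ← h.relation₃ p hp]; abel

theorem form₃_eq (hp : p ∈ W.domain) : θ 3 p = -(a p • θ 0 p) - θ 1 p := by
  rw [← sub_eq_zero, ← h.relation₄ p hp]; abel

theorem form₄_eq (hp : p ∈ W.domain) : θ 4 p = -(b p • θ 0 p) - θ 1 p := by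
  rw [← sub_eq_zero, ← h.relation₅ p hp]; abel

theorem a_eq (hp : p ∈ W.domain) : a p = -wedge (θ 3) (θ 1) p / wedge (θ 0) (θ 1) p := by
  rw [eq_div_iff (h.wedge_ne_zero hp (by decide))]
  simp only [wedge, h.form₃_eq hp, sub_apply, neg_apply, smul_apply, smul_eq_mul]
  ring

theorem b_eq (hp : p ∈ W.domain) : b p = -wedge (θ 4) (θ 1) p / wedge (θ 0) (θ 1) p := by
  rw [eq_div_iff (h.wedge_ne_zero hp (by decide))]
  simp only [wedge, h.form₄_eq hp, sub_apply, neg_apply, smul_apply, smul_eq_mul]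
  ring

theorem contDiffAt_a (hp : p ∈ W.domain) : ContDiffAt ℝ ∞ a p := by
  refine ((contDiffAt_wedge (h.smoothAt hp 3) (h.smoothAt hp 1)).neg.div
    (contDiffAt_wedge (h.smoothAt hp 0) (h.smoothAt hp 1))
    (h.wedge_ne_zero hp (by decide))).congr_of_eventuallyEq ?_
  filter_upwards [W.isOpen_domain.mem_nhds hp] with q hq
  exact h.a_eq hq

theorem contDiffAt_b (hp : p ∈ W.domain) : ContDiffAt ℝ ∞ b p := by
  refine ((contDiffAt_wedge (h.smoothAt hp 4) (h.smoothAt hp 1)).neg.div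
    (contDiffAt_wedge (h.smoothAt hp 0) (h.smoothAt hp 1))
    (h.wedge_ne_zero hp (by decide))).congr_of_eventuallyEq ?_
  filter_upwards [W.isOpen_domain.mem_nhds hp] with q hq
  exact h.b_eq hq

/-- Each of the five quantities is the ratio of the wedge product of two of the normalized forms to
ω₁∧ω₂, so it is nonzero by general position. -/
theorem generic (hp : p ∈ W.domain) : WeightedCalculus.Generic (a p) (b p) := by
  have key : ∀ {i j : Fin 5} (_ : i ≠ j) (c : ℝ),
      wedge (θ i) (θ j) p = c * wedge (θ 0) (θ 1) p → IsUnit c := by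
    intro i j hij c hc
    rw [isUnit_iff_ne_zero]
    rintro rfl
    exact h.wedge_ne_zero hp hij (by rw [hc, zero_mul])
  constructor
  · refine key (i := 1) (j := 3) (by decide) _ ?_
    simp only [wedge, h.form₃_eq hp, sub_apply, neg_apply, smul_apply, smul_eq_mul]
    ring
  · refine key (i := 1) (j := 4) (by decide) _ ?_
    simp only [wedge, h.form₄_eq hp, sub_apply, neg_apply, smul_apply, smul_eq_mul]
    ring
  · refine key (i := 3) (j := 2) (by decide) _ ?_
    simp only [wedge, h.form₃_eq hp, h.form₂_eq hp, sub_apply, neg_apply, smul_apply, smul_eq_mul]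
    ring
  · refine key (i := 4) (j := 2) (by decide) _ ?_
    simp only [wedge, h.form₄_eq hp, h.form₂_eq hp, sub_apply, neg_apply, smul_apply, smul_eq_mul]
    ring
  · refine key (i := 3) (j := 4) (by decide) _ ?_
    simp only [wedge, h.form₃_eq hp, h.form₄_eq hp, sub_apply, neg_apply, smul_apply, smul_eq_mul]
    ring

open IsCoframeAt in
/-- The curvature of the `5`-web in terms of the basic invariants. -/
theorem webCurvature_eq (hp : p ∈ W.domain) :
    webCurvature θ a b p = c₀Expression (θ 0) (θ 1) a b p := by
  have hω := h.isCoframeAt hp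
  have ha := h.contDiffAt_a hp
  have hb := h.contDiffAt_b hp
  have g := h.generic hp
  have hdom := W.isOpen_domain.mem_nhds hp
  have hone : germ (contDiffAt_const (c := (1 : ℝ))) = (1 : SmoothGerm p) := rfl
  have inv : ∀ {x : SmoothGerm p}, IsUnit (evalGerm p x) → ∃ y, x * y = 1 := fun hx =>
    (isUnit_germ hx.ne_zero).exists_right_inv
  obtain ⟨i, hi⟩ := inv (x := germ ha) g.a_unit
  obtain ⟨j, hj⟩ := inv (x := germ ha - 1) (by rw [map_sub, map_one]; exact g.a_sub_one)
  obtain ⟨l, hl⟩ := inv (x := germ hb - 1) (by rw [map_sub, map_one]; exact g.b_sub_one)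
  obtain ⟨m, hm⟩ := inv (x := germ ha - germ hb) (by rw [map_sub]; exact g.a_sub_b)
  have hb0 := g.b_unit.ne_zero
  have hk : germ hb * germ (hb.inv hb0) = 1 := by
    rw [germ_mul, ← hone, germ_eq_iff]
    filter_upwards [hb.continuousAt.eventually_ne hb0] with q hq
    exact mul_inv_cancel₀ hq
  have c0 : HasComponents (θ 0) (θ 1) (θ 0) (1 : SmoothGerm p) 0 :=
    ⟨fun _ => 1, fun _ => 0, contDiffAt_const, contDiffAt_const, rfl, rfl,
      Eventually.of_forall fun q => by simp⟩
  have c1 : HasComponents (θ 0) (θ 1) (θ 1) (0 : SmoothGerm p) 1 :=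
    ⟨fun _ => 0, fun _ => 1, contDiffAt_const, contDiffAt_const, rfl, rfl,
      Eventually.of_forall fun q => by simp⟩
  have c2 : HasComponents (θ 0) (θ 1) (θ 2) (-1 : SmoothGerm p) (-1) := by
    refine ⟨fun _ => -1, fun _ => -1, contDiffAt_const, contDiffAt_const, rfl, rfl, ?_⟩
    filter_upwards [hdom] with q hq
    rw [h.form₂_eq hq]
    module
  have c3 : HasComponents (θ 0) (θ 1) (θ 3) (-germ ha) (-1) := by
    refine ⟨-a, fun _ => -1, ha.neg, contDiffAt_const, rfl, rfl, ?_⟩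
    filter_upwards [hdom] with q hq
    rw [h.form₃_eq hq, Pi.neg_apply]
    module
  have h1 : ContDiffAt ℝ ∞ (fun _ : Plane => (1 : ℝ)) p := contDiffAt_const
  have hcomp : ∀ n, HasComponents (θ 0) (θ 1) (subwebForm θ a b n 0)
        (subwebComponents (germ ha) (germ hb) (germ (hb.inv hb0)) n).1.1
        (subwebComponents (germ ha) (germ hb) (germ (hb.inv hb0)) n).1.2 ∧
      HasComponents (θ 0) (θ 1) (subwebForm θ a b n 1)
        (subwebComponents (germ ha) (germ hb) (germ (hb.inv hb0)) n).2.1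
        (subwebComponents (germ ha) (germ hb) (germ (hb.inv hb0)) n).2.2 := by
    have s : ∀ {ρ : OneForm} {x y x' y' : SmoothGerm p}, HasComponents (θ 0) (θ 1) ρ x y →
        x = x' → y = y' → HasComponents (θ 0) (θ 1) ρ x' y' := by
      rintro ρ x y _ _ hc rfl rfl
      exact hc
    have q0 : germ (ha.sub h1) = germ ha - 1 := rfl
    have q1 : germ (hb.sub h1) = germ hb - 1 := rfl
    have q2 : germ (ha.sub hb) = germ ha - germ hb := rfl
    have q3 : germ ((hb.sub ha).mul (hb.inv hb0)) =
      (germ hb - germ ha) * germ (hb.inv hb0) := rfl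
    have q4 : germ (h1.sub hb).neg = -(1 - germ hb) := rfl
    have d1 : HasComponents (θ 0) (θ 1) (fun q => a q • θ 0 q) (germ ha) 0 :=
      s (c0.smul ha) (by ring) (by ring)
    have d2 : HasComponents (θ 0) (θ 1) (fun q => (a q - 1) • θ 0 q) (germ ha - 1) 0 :=
      s (c0.smul (ha.sub h1)) (by rw [q0]; ring) (by ring)
    have d2' : HasComponents (θ 0) (θ 1) (fun q => -θ 2 q) (1 : SmoothGerm p) 1 :=
      s c2.neg (by ring) (by ring)
    have d3 : HasComponents (θ 0) (θ 1) (fun q => (a q - 1) • θ 1 q) 0 (germ ha - 1) :=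
      s (c1.smul (ha.sub h1)) (by ring) (by rw [q0]; ring)
    have d3' : HasComponents (θ 0) (θ 1) (fun q => a q • θ 2 q) (-germ ha) (-germ ha) :=
      s (c2.smul ha) (by ring) (by ring)
    have d4 : HasComponents (θ 0) (θ 1) (fun q => b q • θ 0 q) (germ hb) 0 :=
      s (c0.smul hb) (by ring) (by ring)
    have d5 : HasComponents (θ 0) (θ 1) (fun q => (b q - 1) • θ 0 q) (germ hb - 1) 0 :=
      s (c0.smul (hb.sub h1)) (by rw [q1]; ring) (by ring)
    have d6 : HasComponents (θ 0) (θ 1) (fun q => (b q - 1) • θ 1 q) 0 (germ hb - 1) :=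
      s (c1.smul (hb.sub h1)) (by ring) (by rw [q1]; ring)
    have d6' : HasComponents (θ 0) (θ 1) (fun q => b q • θ 2 q) (-germ hb) (-germ hb) :=
      s (c2.smul hb) (by ring) (by ring)
    have d7 : HasComponents (θ 0) (θ 1) (fun q => (a q - b q) • θ 0 q) (germ ha - germ hb) 0 :=
      s (c0.smul (ha.sub hb)) (by rw [q2]; ring) (by ring)
    have d8 : HasComponents (θ 0) (θ 1) (fun q => ((b q - a q) * (b q)⁻¹) • θ 1 q) 0
        ((germ hb - germ ha) * germ (hb.inv hb0)) :=
      s (c1.smul ((hb.sub ha).mul (hb.inv hb0))) (by ring) (by rw [q3]; ring)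
    have d9 : HasComponents (θ 0) (θ 1) (fun q => (a q - b q) • θ 2 q) (-(germ ha - germ hb))
        (-(germ ha - germ hb)) :=
      s (c2.smul (ha.sub hb)) (by rw [q2]; ring) (by rw [q2]; ring)
    have d9' : HasComponents (θ 0) (θ 1) (fun q => -(1 - b q) • θ 3 q) ((1 - germ hb) * germ ha)
        (1 - germ hb) :=
      s (c3.smul (h1.sub hb).neg) (by rw [q4]; ring) (by rw [q4]; ring)
    simp only [← div_eq_mul_inv] at d8
    intro n
    fin_cases n
    exacts [⟨c0, c1⟩, ⟨d1, c1⟩, ⟨d2, d2'⟩, ⟨d3, d3'⟩, ⟨d4, c1⟩, ⟨d5, d2'⟩, ⟨d6, d6'⟩, ⟨d7, c3⟩,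
      ⟨d8, c3⟩, ⟨d9, d9'⟩]
  have hdet : ∀ n, evalGerm p
      ((subwebComponents (germ ha) (germ hb) (germ (hb.inv hb0)) n).1.1 *
        (subwebComponents (germ ha) (germ hb) (germ (hb.inv hb0)) n).2.2 -
        (subwebComponents (germ ha) (germ hb) (germ (hb.inv hb0)) n).1.2 *
        (subwebComponents (germ ha) (germ hb) (germ (hb.inv hb0)) n).2.1) ≠ 0 := by
    have n1 := g.a_unit.ne_zero
    have n3 := g.a_sub_one.ne_zero
    have n4 := g.b_sub_one.ne_zero
    have n5 := g.a_sub_b.ne_zero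
    have n6 : b p - a p ≠ 0 := by rwa [← neg_sub, neg_ne_zero]
    -- The determinant of the coframe of [3,4,5].
    have n7 : (a p - b p) * ((1 - b p) * (a p - 1)) ≠ 0 :=
      mul_ne_zero n5 (mul_ne_zero (by rwa [← neg_sub, neg_ne_zero]) n3)
    intro n
    fin_cases n
    all_goals simp [subwebComponents, evalGerm_germ, n1, n3, n4, n6, hb0]
    intro hz
    exact n7 (by linear_combination hz)
  have hcurv : ∀ n, _ := fun n => hω.curvatureFunction_mul_wedge (hcomp n).1 (hcomp n).2
    (hω.connectionShift (germ ha) (germ hb) i j (germ (hb.inv hb0)) l m n).1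
    (hω.connectionShift (germ ha) (germ hb) i j (germ (hb.inv hb0)) l m n).2 (hdet n)
    (hω.connectionShift_spec hi hj hk hl hm n).1 (hω.connectionShift_spec hi hj hk hl hm n).2
  have hsum := hω.sum_connectionShift hi hj hk hl hm
  have hW := hω.wedge_ne_zero
  -- Every term is now (K + correction) times ω₁∧ω₂. This common factor cancels, and the ten copies
  -- of K over 10 give the summand K of c₀.
  rw [webCurvature, Finset.sum_congr rfl fun n _ => hcurv n, ← Finset.sum_mul,
    mul_div_mul_right _ _ hW, Finset.sum_add_distrib, hsum]
  simp only [nabla_germ, evalGerm_germ, Finset.sum_const, Finset.card_univ, Fintype.card_fin,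
    c₀Expression, nsmul_eq_mul]
  push_cast
  ring

end IsNormalization

/-! ### Existence of a normalization -/

/-- Cramer's rule for the components of γ in terms of α and β. -/
theorem wedge_smul_add (α β γ : OneForm) (q : Plane) :
    wedge γ β q • α q + wedge α γ q • β q = wedge α β q • γ q := by
  apply covector_ext <;>
  · simp only [wedge, add_apply, smul_apply, smul_eq_mul]
    ring

theorem exists_normalization (W : PlanarWeb 5) :
    ∃ (θ : Fin 5 → OneForm) (a b : Plane → ℝ), IsNormalization W θ a b := by
  let c : Fin 5 → Fin 5 → Plane → ℝ := fun i j => wedge (W.form i) (W.form j)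
  have hc : ∀ {i j}, i ≠ j → ∀ q ∈ W.domain, c i j q ≠ 0 := fun hij q hq =>
    wedge_ne_zero_of_linearIndependent (W.general_position _ _ hij q hq)
  have hs : ∀ i, ∀ q ∈ W.domain, ContDiffAt ℝ ∞ (W.form i) q := fun i q hq =>
    (W.smooth_form i).contDiffAt (W.isOpen_domain.mem_nhds hq)
  have hcs : ∀ i j, ∀ q ∈ W.domain, ContDiffAt ℝ ∞ (c i j) q := fun i j q hq =>
    contDiffAt_wedge (hs i q hq) (hs j q hq)
  -- With ω₃ minus the third form, ω₁ and ω₂ are the two components of the third form along the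
  -- first two. The fourth and fifth forms are scaled so that the coefficient of ω₂ in their
  -- relations is 1.
  let s : Fin 5 → Plane → ℝ := ![fun q => c 2 1 q / c 0 1 q, fun q => c 0 2 q / c 0 1 q,
    fun _ => -1, fun q => -(c 0 2 q / c 0 3 q), fun q => -(c 0 2 q / c 0 4 q)]
  have hs0 : ∀ i, ∀ q ∈ W.domain, s i q ≠ 0 := by
    intro i q hq
    fin_cases i
    · exact div_ne_zero (hc (by decide) q hq) (hc (by decide) q hq)
    · exact div_ne_zero (hc (by decide) q hq) (hc (by decide) q hq)
    · exact neg_ne_zero.2 one_ne_zero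
    · exact neg_ne_zero.2 (div_ne_zero (hc (by decide) q hq) (hc (by decide) q hq))
    · exact neg_ne_zero.2 (div_ne_zero (hc (by decide) q hq) (hc (by decide) q hq))
  have hss : ∀ i, ∀ q ∈ W.domain, ContDiffAt ℝ ∞ (s i) q := by
    intro i q hq
    fin_cases i
    · exact (hcs _ _ q hq).div (hcs _ _ q hq) (hc (by decide) q hq)
    · exact (hcs _ _ q hq).div (hcs _ _ q hq) (hc (by decide) q hq)
    · exact contDiffAt_const
    · exact ((hcs _ _ q hq).div (hcs _ _ q hq) (hc (by decide) q hq)).neg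
    · exact ((hcs _ _ q hq).div (hcs _ _ q hq) (hc (by decide) q hq)).neg
  have rel : ∀ k : Fin 5, 0 ≠ k → ∀ q ∈ W.domain,
      (c k 1 q / c 2 1 q * (c 0 2 q / c 0 k q)) • (s 0 q • W.form 0 q) + s 1 q • W.form 1 q +
        -(c 0 2 q / c 0 k q) • W.form k q = 0 := by
    intro k hk q hq
    have h01 := hc (i := 0) (j := 1) (by decide) q hq
    have h21 := hc (i := 2) (j := 1) (by decide) q hq
    have h0k := hc hk q hq
    have key : W.form k q = (c k 1 q / c 0 1 q) • W.form 0 q + (c 0 k q / c 0 1 q) • W.form 1 q := by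
      have h := congrArg (fun l => (c 0 1 q)⁻¹ • l)
        (wedge_smul_add (W.form 0) (W.form 1) (W.form k) q)
      simp only [smul_add, smul_smul] at h
      change _ = ((c 0 1 q)⁻¹ * c 0 1 q) • W.form k q at h
      rw [inv_mul_cancel₀ h01, one_smul] at h
      rw [← h, div_eq_inv_mul, div_eq_inv_mul]
    rw [key]
    change (c k 1 q / c 2 1 q * (c 0 2 q / c 0 k q)) • ((c 2 1 q / c 0 1 q) • W.form 0 q) +
      (c 0 2 q / c 0 1 q) • W.form 1 q + _ = 0
    apply covector_ext <;>
    · simp only [add_apply, smul_apply, smul_eq_mul, zero_apply]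
      field_simp
      ring
  refine ⟨fun i q => s i q • W.form i q, fun q => c 3 1 q / c 2 1 q * (c 0 2 q / c 0 3 q),
    fun q => c 4 1 q / c 2 1 q * (c 0 2 q / c 0 4 q), ?_, ?_, ?_, ?_, ?_⟩
  · exact fun i q hq => ((hss i q hq).smul (hs i q hq)).contDiffWithinAt
  · exact fun i q hq => ⟨s i q, hs0 i q hq, rfl⟩
  · intro q hq
    have h := rel 2 (by decide) q hq
    rw [div_self (hc (by decide) q hq), div_self (hc (by decide) q hq), one_mul, one_smul] at h
    exact h
  · exact fun q hq => rel 3 (by decide) q hq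
  · exact fun q hq => rel 4 (by decide) q hq

namespace IsCoframeAt

variable {ω₁ ω₂ : OneForm} (hω : IsCoframeAt ω₁ ω₂ p)

/-! ### The differential system for the coordinates of a solution -/

/-- The germs of the coordinates `w₂₂, w₂, v₂, w, u, v`. -/
def coordinateGerms (w u v : SmoothGerm p) : Fin 6 → SmoothGerm p :=
  ![hω.nabla 1 2 (hω.nabla 1 1 w), hω.nabla 1 1 w, hω.nabla 1 1 v, w, u, v]

/-- The derivatives of the coordinates of a solution of the abelian equation are linear
combinations of the coordinates. -/
theorem deriv_coordinateGerms_mem {a b w u v : SmoothGerm p}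
    (g : WeightedCalculus.Generic (evalGerm p a) (evalGerm p b))
    (h : hω.abelianGerm a b (w, u, v) = 0) (i : Fin 2) (j : Fin 6) :
    hω.deriv i (hω.coordinateGerms w u v j) ∈
      Ideal.span (Set.range (hω.coordinateGerms w u v)) := by
  set I := Ideal.span (Set.range (hω.coordinateGerms w u v)) with hI
  -- Modulo the ideal `I` the six coordinates vanish, so the pointwise argument, repeated over this
  -- quotient, puts all covariant derivatives of `w`, `u`, `v` up to order three into `I`.
  let π := forget (Ideal.Quotient.mk I)
  have hY : ∀ j, hω.coordinateGerms w u v j ∈ I := fun j => Ideal.subset_span ⟨j, rfl⟩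
  have hπ : ∀ {k x}, π (monomial k x) = 0 ↔ x ∈ I := by
    intro k x
    rw [forget_monomial, Ideal.Quotient.eq_zero_iff_mem]
  have g' : WeightedCalculus.Generic (π (monomial 0 a)) (π (monomial 0 b)) := by
    rw [forget_monomial, forget_monomial]
    have t : ∀ {x : SmoothGerm p}, IsUnit (evalGerm p x) → IsUnit (Ideal.Quotient.mk I x) :=
      fun hx => (isUnit_germ hx.ne_zero).map _
    have h1 := g.a_sub_one
    have h2 := g.b_sub_one
    have h3 := g.a_sub_b
    rw [← map_one (evalGerm p), ← map_sub] at h1 h2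
    rw [← map_sub] at h3
    refine ⟨t g.a_unit, t g.b_unit, ?_, ?_, ?_⟩
    · rw [← map_one (Ideal.Quotient.mk I), ← map_sub]
      exact t h1
    · rw [← map_one (Ideal.Quotient.mk I), ← map_sub]
      exact t h2
    · rw [← map_sub]
      exact t h3
  have he : hω.calculus.KillsEquations π (monomial 0 a) (monomial 0 b) (monomial 1 w)
      (monomial 1 u) (monomial 1 v) := by
    rw [killsEquations_monomial_iff, h]
    intro j
    constructor <;> simp
  obtain ⟨kw, ku, kv⟩ := hω.calculus.killsThreeJet_of_coordinates π
    (hω.euler_monomial_zero a) (hω.euler_monomial_zero b)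
    (hω.euler_monomial_one w) (hω.euler_monomial_one u) (hω.euler_monomial_one v) g' he
    (hπ.2 (hY 3)) (hπ.2 (hY 4)) (hπ.2 (hY 5))
    (by rw [d₂_monomial_nabla, hπ]; exact hY 1)
    (by rw [d₂_monomial_nabla, hπ]; exact hY 2)
    (by rw [d₂_monomial_nabla, d₂_monomial_nabla, hπ]; exact hY 0)
  -- The connection term is a multiple of `x`, which already lies in `I`.
  have hn : ∀ (k : ℕ) {x : SmoothGerm p}, x ∈ I → hω.nabla i k x ∈ I → hω.deriv i x ∈ I := by
    intro k x hx hx'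
    rw [nabla_apply] at hx'
    have := I.add_mem hx' (I.mul_mem_left (k * hω.connection i) hx)
    rwa [sub_add_cancel] at this
  have first : ∀ {x}, x ∈ I → hω.calculus.KillsThreeJet π (monomial 1 x) →
      hω.deriv i x ∈ I := by
    intro x hx k
    refine hn 1 hx ?_
    have h1 := k.h₁
    have h2 := k.h₂
    rw [d₁_monomial_nabla, hπ] at h1
    rw [d₂_monomial_nabla, hπ] at h2
    fin_cases i
    exacts [h1, h2]
  have d12 : ∀ {x}, hω.calculus.KillsThreeJet π (monomial 1 x) →
      π (hω.calculus.d₁ (hω.calculus.d₂ (monomial 1 x))) = 0 := by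
    intro x k
    rw [hω.calculus.comm, euler_monomial_one, map_sub, map_mul, k.h₂₁, k.h, mul_zero, sub_zero]
  have second : ∀ {x}, hω.nabla 1 1 x ∈ I → hω.calculus.KillsThreeJet π (monomial 1 x) →
      hω.deriv i (hω.nabla 1 1 x) ∈ I := by
    intro x hx k
    refine hn 2 hx ?_
    have h1 := d12 k
    have h2 := k.h₂₂
    rw [d₂_monomial_nabla, d₁_monomial_nabla, hπ] at h1
    rw [d₂_monomial_nabla, d₂_monomial_nabla, hπ] at h2
    fin_cases i
    exacts [h1, h2]
  fin_cases j
  · refine hn 3 (hY 0) ?_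
    -- The derivative ∇₁ of w₂₂ is reduced to ∇₂∇₂∇₁w; the commutators contribute only multiples of
    -- `w` and w₂.
    have h1 : π (hω.calculus.d₁ (hω.calculus.d₂ (hω.calculus.d₂ (monomial 1 w)))) = 0 := by
      rw [hω.calculus.comm, hω.calculus.comm, hω.calculus.euler_d₂, euler_monomial_one]
      simp only [map_sub, map_add, map_mul, Derivation.leibniz, smul_eq_mul, kw.h₂₂₁, kw.h₂, kw.h]
      ring
    have h2 := kw.h₂₂₂
    rw [d₂_monomial_nabla, d₂_monomial_nabla, d₁_monomial_nabla, hπ] at h1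
    rw [d₂_monomial_nabla, d₂_monomial_nabla, d₂_monomial_nabla, hπ] at h2
    fin_cases i
    exacts [h1, h2]
  · exact second (hY 1) kw
  · exact second (hY 2) kv
  · exact first (hY 3) kw
  · exact first (hY 4) ku
  · exact first (hY 5) kv

/-- Each subtracted term contains Δ₁w, Δ₂u or Δ₃v; the others add up to Δ₁Δ₂Δ₃ applied to the fourth
equation. -/
theorem bracketGerm_eq_zero {a b w u v : SmoothGerm p}
    (h : hω.abelianGerm a b (w, u, v) = 0) : hω.bracketGerm a b (w, u, v) = 0 := by
  have h0 : hω.deltaGerm 1 1 w = 0 := congrFun h 0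
  have h1 : hω.deltaGerm a 1 u = 0 := congrFun h 1
  have h2 : hω.deltaGerm b 1 v = 0 := congrFun h 2
  have h3 : hω.nabla 0 1 w + hω.nabla 0 1 u + hω.nabla 0 1 v = 0 := congrFun h 3
  have h4 := congrArg (fun x => hω.deltaGerm 1 4 (hω.deltaGerm a 3 (hω.deltaGerm b 2 x))) h3
  simp only [map_add, map_zero] at h4
  simp only [bracketGerm, LinearMap.add_apply, LinearMap.comp_apply, LinearMap.sub_apply,
    LinearMap.fst_apply, LinearMap.snd_apply, h0, h1, h2, map_zero, sub_zero]
  exact h4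

end IsCoframeAt

/-! ### Unique continuation -/

/-- A vanishing value of a map `Y` with `‖dY‖ ≤ C ‖Y‖` near `p` spreads to a neighbourhood
of `p`. -/
theorem eventually_eq_zero_of_norm_fderiv_le {ι E : Type*} [Fintype ι] [NormedAddCommGroup E]
    [NormedSpace ℝ E] {Y : ι → E → ℝ} {p : E}
    (hd : ∀ j, ∀ᶠ r in 𝓝 p, DifferentiableAt ℝ (Y j) r)
    (hb : ∀ j, ∃ C, ∀ᶠ r in 𝓝 p, ‖fderiv ℝ (Y j) r‖ ≤ C * ‖fun k => Y k r‖)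
    (h0 : ∀ j, Y j p = 0) : ∀ᶠ r in 𝓝 p, ∀ j, Y j r = 0 := by
  choose C hC using hb
  obtain ⟨ε, hε, hball⟩ := Metric.eventually_nhds_iff_ball.1
    ((eventually_all.2 hd).and (eventually_all.2 hC))
  filter_upwards [Metric.ball_mem_nhds p hε] with r hr
  have hmem : ∀ t ∈ Set.Icc (0 : ℝ) 1, p + t • (r - p) ∈ Metric.ball p ε := by
    intro t ht
    have := (convex_ball p ε).add_smul_mem (Metric.mem_ball_self hε)
      (y := r - p) (by rwa [add_sub_cancel]) ht
    exact this
  have hderiv : ∀ t ∈ Set.Icc (0 : ℝ) 1, HasDerivAt (fun t j => Y j (p + t • (r - p)))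
      (fun j => fderiv ℝ (Y j) (p + t • (r - p)) (r - p)) t := by
    intro t ht
    refine hasDerivAt_pi.2 fun j => ?_
    have hl : HasDerivAt (fun t : ℝ => p + t • (r - p)) (r - p) t := by
      simpa using ((hasDerivAt_id t).smul_const (r - p)).const_add p
    exact ((hball _ (hmem t ht)).1 j).hasFDerivAt.comp_hasDerivAt t hl
  -- Grönwall's inequality along the segment from `p` to `r`, which stays in the ball. The sum of
  -- the |C j| serves as a constant for all components at once.
  have key := eq_zero_of_abs_deriv_le_mul_abs_self_of_eq_zero_right
    (K := (∑ j, |C j|) * ‖r - p‖)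
    (fun t ht => (hderiv t ht).continuousAt.continuousWithinAt)
    (fun t ht => (hderiv t (Set.Ico_subset_Icc_self ht)).hasDerivWithinAt)
    (by
      funext j
      simp [h0 j])
    (by
      intro t ht
      have ht' := hmem t (Set.Ico_subset_Icc_self ht)
      refine (pi_norm_le_iff_of_nonneg (by positivity)).2 fun j => ?_
      have hCj : C j ≤ ∑ j, |C j| := (le_abs_self _).trans
        (Finset.single_le_sum (f := fun j => |C j|) (fun _ _ => abs_nonneg _) (Finset.mem_univ j))
      calc ‖fderiv ℝ (Y j) (p + t • (r - p)) (r - p)‖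
          ≤ ‖fderiv ℝ (Y j) (p + t • (r - p))‖ * ‖r - p‖ := ContinuousLinearMap.le_opNorm _ _
        _ ≤ (∑ j, |C j|) * ‖fun k => Y k (p + t • (r - p))‖ * ‖r - p‖ := by
            gcongr
            exact ((hball _ ht').2 j).trans (by gcongr)
        _ = _ := by ring)
    1 ⟨zero_le_one, le_rfl⟩
  intro j
  simpa using congrFun key j

/-- Unique continuation for solutions of linear differential inequalities on connected sets. -/
theorem eq_zero_of_norm_fderiv_le {ι E : Type*} [Fintype ι] [NormedAddCommGroup E]
    [NormedSpace ℝ E] {Y : ι → E → ℝ} {U : Set E} (hU : IsOpen U) (hU' : IsPreconnected U)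
    (hd : ∀ j, ∀ r ∈ U, DifferentiableAt ℝ (Y j) r)
    (hb : ∀ j, ∀ q ∈ U, ∃ C, ∀ᶠ r in 𝓝 q, ‖fderiv ℝ (Y j) r‖ ≤ C * ‖fun k => Y k r‖)
    {p : E} (hp : p ∈ U) (h0 : ∀ j, Y j p = 0) : ∀ r ∈ U, ∀ j, Y j r = 0 := by
  have hsub : U ⊆ {q | q ∈ U ∧ ∀ j, Y j q = 0} := by
    -- The zero set in `U` is open by the local statement and its complement in `U` is open by
    -- continuity, so connectedness excludes the latter.
    refine hU'.subset_left_of_subset_union (v := {q | q ∈ U ∧ ¬ ∀ j, Y j q = 0}) ?_ ?_ ?_ ?_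
      ⟨p, hp, hp, h0⟩
    · rw [isOpen_iff_mem_nhds]
      rintro q ⟨hq, hq'⟩
      filter_upwards [hU.mem_nhds hq, eventually_eq_zero_of_norm_fderiv_le
        (fun j => (hU.eventually_mem hq).mono (hd j)) (fun j => hb j q hq) hq'] with r h1 h2
      exact ⟨h1, h2⟩
    · rw [isOpen_iff_mem_nhds]
      rintro q ⟨hq, hq'⟩
      obtain ⟨j, hj⟩ := not_forall.1 hq'
      filter_upwards [hU.mem_nhds hq, (hd j q hq).continuousAt.eventually_ne hj] with r h1 h2
      exact ⟨h1, fun h => h2 (h j)⟩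
    · exact Set.disjoint_left.2 fun q h1 h2 => h2.2 h1.2
    · exact fun q hq => (em _).imp (⟨hq, ·⟩) (⟨hq, ·⟩)
  exact fun r hr => (hsub hr).2

/-- The coordinates `w₂₂, w₂, v₂, w, u, v` of a triple of functions. -/
def coordinateFunctions (ω₁ ω₂ : OneForm) (w u v : Plane → ℝ) : Fin 6 → Plane → ℝ :=
  ![covDeriv ω₁ ω₂ 1 2 (covDeriv ω₁ ω₂ 1 1 w), covDeriv ω₁ ω₂ 1 1 w, covDeriv ω₁ ω₂ 1 1 v, w, u, v]

namespace IsCoframeAt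

variable {ω₁ ω₂ : OneForm} (hω : IsCoframeAt ω₁ ω₂ p)
include hω

theorem contDiffAt_coordinateFunctions {w u v : Plane → ℝ} (hw : ContDiffAt ℝ ∞ w p)
    (hu : ContDiffAt ℝ ∞ u p) (hv : ContDiffAt ℝ ∞ v p) (j : Fin 6) :
    ContDiffAt ℝ ∞ (coordinateFunctions ω₁ ω₂ w u v j) p := by
  fin_cases j
  exacts [hω.contDiffAt_covDeriv 1 2 (hω.contDiffAt_covDeriv 1 1 hw),
    hω.contDiffAt_covDeriv 1 1 hw, hω.contDiffAt_covDeriv 1 1 hv, hw, hu, hv]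

theorem coordinateGerms_germ {w u v : Plane → ℝ} (hw : ContDiffAt ℝ ∞ w p)
    (hu : ContDiffAt ℝ ∞ u p) (hv : ContDiffAt ℝ ∞ v p) (j : Fin 6) :
    hω.coordinateGerms (germ hw) (germ hu) (germ hv) j =
      germ (hω.contDiffAt_coordinateFunctions hw hu hv j) := by
  rw [coordinateGerms]
  simp only [nabla_germ]
  fin_cases j <;> rfl

/-- Membership in the ideal supplies smooth coefficients that express the frame derivatives of each
coordinate linearly in the coordinates. These coefficients and the coframe are bounded near `p` by
continuity. -/
theorem exists_norm_fderiv_coordinateFunctions_le {a b w u v : Plane → ℝ}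
    (ha : ContDiffAt ℝ ∞ a p) (hb : ContDiffAt ℝ ∞ b p) (hw : ContDiffAt ℝ ∞ w p)
    (hu : ContDiffAt ℝ ∞ u p) (hv : ContDiffAt ℝ ∞ v p)
    (g : WeightedCalculus.Generic (a p) (b p))
    (h : hω.abelianGerm (germ ha) (germ hb) (germ hw, germ hu, germ hv) = 0) (j : Fin 6) :
    ∃ C, ∀ᶠ r in 𝓝 p, ‖fderiv ℝ (coordinateFunctions ω₁ ω₂ w u v j) r‖ ≤
      C * ‖fun k => coordinateFunctions ω₁ ω₂ w u v k r‖ := by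
  set Y := coordinateFunctions ω₁ ω₂ w u v with hY
  have key : ∀ i : Fin 2, ∃ C, ∀ᶠ r in 𝓝 p, |frameDeriv ω₁ ω₂ i (Y j) r| ≤
      C * ‖fun k => Y k r‖ := by
    intro i
    obtain ⟨c, hc⟩ := Ideal.mem_span_range_iff_exists_fun.1
      (hω.deriv_coordinateGerms_mem (a := germ ha) (b := germ hb) g h i j)
    choose A hA hAc using fun k => exists_germ (c k)
    simp only [← hAc, coordinateGerms_germ, deriv_germ, Fin.sum_univ_six, germ_mul,
      germ_add] at hc
    rw [germ_eq_iff] at hc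
    have hcont : ContinuousAt (fun r => ∑ k, |A k r|) p :=
      tendsto_finsetSum _ fun k _ => (hA k).continuousAt.abs
    refine ⟨∑ k, |A k p| + 1, ?_⟩
    filter_upwards [hc, hcont.eventually_lt_const (lt_add_one (∑ k, |A k p|))] with r h1 h2
    have h3 : frameDeriv ω₁ ω₂ i (Y j) r = ∑ k, A k r * Y k r := by
      rw [Fin.sum_univ_six]
      exact h1.symm
    rw [h3]
    calc |∑ k, A k r * Y k r| ≤ ∑ k, |A k r * Y k r| := Finset.abs_sum_le_sum_abs _ _
      _ ≤ ∑ k, |A k r| * ‖fun k => Y k r‖ := by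
          refine Finset.sum_le_sum fun k _ => ?_
          rw [abs_mul]
          gcongr
          exact norm_le_pi_norm (fun k => Y k r) k
      _ = (∑ k, |A k r|) * ‖fun k => Y k r‖ := (Finset.sum_mul _ _ _).symm
      _ ≤ _ := by gcongr
  obtain ⟨C₀, h₀⟩ := key 0
  obtain ⟨C₁, h₁⟩ := key 1
  refine ⟨C₀ * (‖ω₁ p‖ + 1) + C₁ * (‖ω₂ p‖ + 1), ?_⟩
  filter_upwards [h₀, h₁, hω.eventually_wedge_ne_zero,
    hω.smooth₁.continuousAt.norm.eventually_lt_const (lt_add_one _),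
    hω.smooth₂.continuousAt.norm.eventually_lt_const (lt_add_one _)] with r k₀ k₁ k₂ k₃ k₄
  rw [fderiv_eq_frameDeriv ω₁ ω₂ _ r k₂]
  refine (norm_add_le _ _).trans ?_
  rw [norm_smul, norm_smul, Real.norm_eq_abs, Real.norm_eq_abs]
  calc _ ≤ C₀ * ‖fun k => Y k r‖ * (‖ω₁ p‖ + 1) + C₁ * ‖fun k => Y k r‖ * (‖ω₂ p‖ + 1) :=
        add_le_add
          (mul_le_mul k₀ k₃.le (norm_nonneg _) ((abs_nonneg _).trans k₀))
          (mul_le_mul k₁ k₄.le (norm_nonneg _) ((abs_nonneg _).trans k₁))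
    _ = _ := by ring

end IsCoframeAt

/-! ### Abelian relations and maximum rank -/

/-- The components of a closed form. -/
theorem IsCoframeAt.nabla_eq_of_extD_eq_zero {ω₁ ω₂ α : OneForm} (hω : IsCoframeAt ω₁ ω₂ p)
    {f g : Plane → ℝ} (hf : ContDiffAt ℝ ∞ f p) (hg : ContDiffAt ℝ ∞ g p)
    (hα : α =ᶠ[𝓝 p] fun q => f q • ω₁ q + g q • ω₂ q) (hc : ∀ᶠ q in 𝓝 p, extD α q = 0) :
    hω.nabla 0 1 (germ hg) = hω.nabla 1 1 (germ hf) := by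
  rw [nabla_germ, nabla_germ, germ_eq_iff]
  filter_upwards [hα.eventuallyEq_nhds, hc, extD_components_eventually hω hf hg,
    hω.eventually_wedge_ne_zero] with q h1 h2 h3 h4
  rw [extD_congr h1, h3] at h2
  have h5 := (mul_eq_zero.1 h2).resolve_right h4
  change frameDeriv ω₁ ω₂ 0 g q - (1 : ℕ) * g₁ ω₁ ω₂ q * g q =
    frameDeriv ω₁ ω₂ 1 f q - (1 : ℕ) * g₂ ω₁ ω₂ q * f q
  push_cast
  linear_combination h5

namespace IsNormalization

variable {W : PlanarWeb 5} {θ : Fin 5 → OneForm} {a b : Plane → ℝ}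

/-- The components of a tuple of functions with respect to the normalized forms: the forms
`lam i • W.form i` and `normalize W θ lam i • θ i` agree on the domain. -/
def normalize (W : PlanarWeb 5) (θ : Fin 5 → OneForm) (lam : Fin 5 → Plane → ℝ) (i : Fin 5)
    (q : Plane) : ℝ :=
  lam i q * (wedge (W.form i) (θ (i + 1)) q / wedge (θ i) (θ (i + 1)) q)

variable (h : IsNormalization W θ a b)
include h

theorem normalize_smul (hp : p ∈ W.domain) (lam : Fin 5 → Plane → ℝ) (i : Fin 5) :
    normalize W θ lam i p • θ i p = lam i p • W.form i p := by
  obtain ⟨s, hs, hs'⟩ := h.same_foliations i p hp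
  -- Wedging with any other form of the web reads off the scaling factor as a smooth function; `i +
  -- 1`, taken cyclically in `Fin 5`, is a convenient other index.
  have hw := h.wedge_ne_zero hp (i := i) (j := i + 1) (by fin_cases i <;> decide)
  have hm : wedge (θ i) (θ (i + 1)) p = s * wedge (W.form i) (θ (i + 1)) p := by
    simp only [wedge, hs', smul_apply, smul_eq_mul]
    ring
  have hw' : wedge (W.form i) (θ (i + 1)) p ≠ 0 := by
    intro h0
    rw [hm, h0, mul_zero] at hw
    exact hw rfl
  rw [normalize, hs', hm, smul_smul]
  congr 1
  field_simp

theorem normalize_eq_zero_iff (hp : p ∈ W.domain) (lam : Fin 5 → Plane → ℝ) (i : Fin 5) :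
    normalize W θ lam i p = 0 ↔ lam i p = 0 := by
  have h1 : ∀ {j k : Fin 5}, j ≠ k → W.form j p ≠ 0 ∧ θ j p ≠ 0 := by
    intro j k hjk
    refine ⟨(W.general_position j k hjk p hp).ne_zero 0, fun h0 => h.wedge_ne_zero hp hjk ?_⟩
    simp [wedge, h0]
  obtain ⟨h2, h3⟩ := h1 (j := i) (k := i + 1) (by fin_cases i <;> decide)
  rw [← smul_eq_zero_iff_left h3, h.normalize_smul hp, smul_eq_zero_iff_left h2]

theorem contDiffAt_normalize (hp : p ∈ W.domain) {lam : Fin 5 → Plane → ℝ}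
    (hl : lam ∈ W.abelianSolutions) (i : Fin 5) : ContDiffAt ℝ ∞ (normalize W θ lam i) p :=
  have hd := W.isOpen_domain.mem_nhds hp
  ((hl.1 i).contDiffAt hd).mul ((contDiffAt_wedge ((W.smooth_form i).contDiffAt hd)
    (h.smoothAt hp _)).div (contDiffAt_wedge (h.smoothAt hp _) (h.smoothAt hp _))
    (h.wedge_ne_zero hp (by fin_cases i <;> decide)))

/-- These are the ω₁- and ω₂-components of the abelian relation after elimination of ω₃, ω₄, ω₅;
they recover the whole relation from `w`, `u`, `v`. -/
theorem normalize_relations (hp : p ∈ W.domain) {lam : Fin 5 → Plane → ℝ}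
    (hl : lam ∈ W.abelianSolutions) :
    normalize W θ lam 0 p = normalize W θ lam 2 p + a p * normalize W θ lam 3 p +
      b p * normalize W θ lam 4 p ∧
    normalize W θ lam 1 p = normalize W θ lam 2 p + normalize W θ lam 3 p +
      normalize W θ lam 4 p := by
  set f := normalize W θ lam
  have hs : ∑ i, f i p • θ i p = 0 := by
    rw [← hl.2.2.1 p hp]
    exact Finset.sum_congr rfl fun i _ => h.normalize_smul hp lam i
  have hs' : (f 0 p - f 2 p - a p * f 3 p - b p * f 4 p) • θ 0 p +
      (f 1 p - f 2 p - f 3 p - f 4 p) • θ 1 p = 0 := by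
    rw [← hs, Fin.sum_univ_five, h.form₂_eq hp, h.form₃_eq hp, h.form₄_eq hp]
    module
  have hx := DFunLike.congr_fun hs' ex
  have hy := DFunLike.congr_fun hs' ey
  simp only [add_apply, smul_apply, smul_eq_mul, zero_apply] at hx hy
  have hw := h.wedge_ne_zero hp (i := 0) (j := 1) (by decide)
  constructor
  · refine sub_eq_zero.1 ((mul_eq_zero.1 ?_).resolve_right hw)
    rw [wedge]
    linear_combination hx * θ 1 p ey - hy * θ 1 p ex
  · refine sub_eq_zero.1 ((mul_eq_zero.1 ?_).resolve_right hw)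
    rw [wedge]
    linear_combination hy * θ 0 p ex - hx * θ 0 p ey

theorem extD_normalize (hp : p ∈ W.domain) {lam : Fin 5 → Plane → ℝ}
    (hl : lam ∈ W.abelianSolutions) (i : Fin 5) :
    extD (fun q => normalize W θ lam i q • θ i q) p = 0 := by
  rw [← hl.2.2.2 i p hp]
  apply extD_congr
  filter_upwards [W.isOpen_domain.mem_nhds hp] with q hq
  exact h.normalize_smul hq lam i

/-- The germs of the normalized components `w, u, v` of an abelian relation. -/
def solutionGerms (hp : p ∈ W.domain) :
    W.abelianSolutions →ₗ[ℝ] SmoothGerm p × SmoothGerm p × SmoothGerm p where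
  toFun lam := (germ (h.contDiffAt_normalize hp lam.2 2), germ (h.contDiffAt_normalize hp lam.2 3),
    germ (h.contDiffAt_normalize hp lam.2 4))
  map_add' lam mu := by
    have key : ∀ i, germ (h.contDiffAt_normalize hp (lam + mu).2 i) =
        germ (h.contDiffAt_normalize hp lam.2 i) + germ (h.contDiffAt_normalize hp mu.2 i) := by
      intro i
      rw [germ_add, germ_eq_iff]
      exact Eventually.of_forall fun q => add_mul _ _ _
    rw [key, key, key]
    rfl
  map_smul' r lam := by
    have key : ∀ i, germ (h.contDiffAt_normalize hp (r • lam).2 i) =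
        r • germ (h.contDiffAt_normalize hp lam.2 i) := by
      intro i
      rw [germ_smul, germ_eq_iff]
      exact Eventually.of_forall fun q => mul_assoc _ _ _
    rw [key, key, key]
    rfl

/-- Closedness of wω₃, uω₄, vω₅ gives the three equations with Δ₁, Δ₂, Δ₃. The fourth equation is
closedness of (w + u + v)ω₂. -/
theorem abelianGerm_solutionGerms (hp : p ∈ W.domain) (lam : W.abelianSolutions) :
    (h.isCoframeAt hp).abelianGerm (germ (h.contDiffAt_a hp)) (germ (h.contDiffAt_b hp))
      (h.solutionGerms hp lam) = 0 := by
  have hω := h.isCoframeAt hp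
  have ha := h.contDiffAt_a hp
  have hb := h.contDiffAt_b hp
  have hdom : ∀ᶠ q in 𝓝 p, q ∈ W.domain := W.isOpen_domain.mem_nhds hp
  have hf := h.contDiffAt_normalize hp lam.2
  have hc := fun i => hdom.mono fun q hq => h.extD_normalize hq lam.2 i
  have e0 : hω.nabla 0 1 (-germ (hf 2)) = hω.nabla 1 1 (-germ (hf 2)) := hω.nabla_eq_of_extD_eq_zero (hf 2).neg (hf 2).neg
    (by
      filter_upwards [hdom] with q hq
      rw [h.form₂_eq hq]
      module) (hc 2)
  have e1 : hω.nabla 0 1 (-germ (hf 3)) = hω.nabla 1 1 (-(germ ha * germ (hf 3))) :=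
    hω.nabla_eq_of_extD_eq_zero (ha.mul (hf 3)).neg (hf 3).neg
    (by
      filter_upwards [hdom] with q hq
      rw [h.form₃_eq hq]
      module) (hc 3)
  have e2 : hω.nabla 0 1 (-germ (hf 4)) = hω.nabla 1 1 (-(germ hb * germ (hf 4))) :=
    hω.nabla_eq_of_extD_eq_zero (hb.mul (hf 4)).neg (hf 4).neg
    (by
      filter_upwards [hdom] with q hq
      rw [h.form₄_eq hq]
      module) (hc 4)
  have e3 : hω.nabla 0 1 (germ (hf 2) + germ (hf 3) + germ (hf 4)) = hω.nabla 1 1 0 :=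
    hω.nabla_eq_of_extD_eq_zero (contDiffAt_const (c := (0 : ℝ)))
    (((hf 2).add (hf 3)).add (hf 4))
    (by
      filter_upwards [hdom] with q hq
      rw [(h.normalize_relations hq lam.2).2, zero_smul, zero_add]) (hc 1)
  rw [map_neg, map_neg, neg_inj] at e0 e1 e2
  rw [map_zero, map_add, map_add] at e3
  funext j
  fin_cases j
  · change hω.nabla 0 1 (germ (hf 2)) - hω.nabla 1 1 (1 * germ (hf 2)) = 0
    rw [one_mul, e0, sub_self]
  · exact sub_eq_zero.2 e1
  · exact sub_eq_zero.2 e2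
  · exact e3

/-- An abelian relation is determined by the coordinates of its `3`-jet at one point. -/
theorem coordinates_solutionGerms_injective (hp : p ∈ W.domain) :
    Function.Injective ((h.isCoframeAt hp).coordinates ∘ₗ h.solutionGerms hp) := by
  rw [← LinearMap.ker_eq_bot, LinearMap.ker_eq_bot']
  intro lam hlam
  set f := normalize W θ lam.1
  set Y := coordinateFunctions (θ 0) (θ 1) (f 2) (f 3) (f 4)
  have hf : ∀ {q}, q ∈ W.domain → ∀ i, ContDiffAt ℝ ∞ (f i) q := fun hq =>
    h.contDiffAt_normalize hq lam.2
  have hY : ∀ j, Y j p = 0 := by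
    intro j
    have hj := congrFun hlam j
    have he := congrArg (evalGerm p)
      ((h.isCoframeAt hp).coordinateGerms_germ (hf hp 2) (hf hp 3) (hf hp 4) j)
    rw [evalGerm_germ] at he
    refine he.symm.trans ?_
    fin_cases j <;> exact hj
  -- Vanishing of the six coordinates at `p` spreads over the connected domain; the last three of
  -- them are `w`, `u`, `v` themselves.
  have hzero := eq_zero_of_norm_fderiv_le W.isOpen_domain W.isConnected_domain.isPreconnected
    (fun j r hr => ((h.isCoframeAt hr).contDiffAt_coordinateFunctions (hf hr 2) (hf hr 3)
      (hf hr 4) j).differentiableAt (by simp))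
    (fun j q hq => (h.isCoframeAt hq).exists_norm_fderiv_coordinateFunctions_le
      (h.contDiffAt_a hq) (h.contDiffAt_b hq) (hf hq 2) (hf hq 3) (hf hq 4) (h.generic hq)
      (h.abelianGerm_solutionGerms hq lam) j) hp hY
  ext i q
  by_cases hq : q ∈ W.domain
  · refine (h.normalize_eq_zero_iff hq lam.1 i).1 ?_
    have h2 : f 2 q = 0 := hzero q hq 3
    have h3 : f 3 q = 0 := hzero q hq 4
    have h4 : f 4 q = 0 := hzero q hq 5
    have h01 : f 0 q = _ ∧ f 1 q = _ := h.normalize_relations hq lam.2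
    have h0 : f 0 q = 0 := by
      rw [h01.1]
      change f 2 q + a q * f 3 q + b q * f 4 q = 0
      rw [h2, h3, h4]
      ring
    have h1 : f 1 q = 0 := by
      rw [h01.2]
      change f 2 q + f 3 q + f 4 q = 0
      rw [h2, h3, h4]
      ring
    fin_cases i
    exacts [h0, h1, h2, h3, h4]
  · exact lam.2.2.1 i q hq

/-- The curvature of a planar `5`-web of maximum rank equals zero. -/
theorem webCurvature_eq_zero (hr : W.IsOfMaximumRank) (hp : p ∈ W.domain) :
    webCurvature θ a b p = 0 := by
  have hω := h.isCoframeAt hp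
  have g := h.generic hp
  have hinj := h.coordinates_solutionGerms_injective hp
  have hfin : FiniteDimensional ℝ W.abelianSolutions := FiniteDimensional.of_injective _ hinj
  have hdim : Module.finrank ℝ W.abelianSolutions = Module.finrank ℝ (Fin 6 → ℝ) := by
    rw [Module.finrank_fin_fun]
    exact hr
  -- An injective map between spaces of dimension 6 is onto, so some abelian relation has w₂₂ = 1 at
  -- `p` and its other coordinates zero. Its bracket is c₀ times a nonzero factor, and it also
  -- vanishes.
  obtain ⟨lam, hlam⟩ := (LinearMap.injective_iff_surjective_of_finrank_eq_finrank hdim).1 hinj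
    (Pi.single 0 1)
  have hA := h.abelianGerm_solutionGerms hp lam
  have he : hω.equations (germ (h.contDiffAt_a hp)) (germ (h.contDiffAt_b hp))
      (h.solutionGerms hp lam) = 0 := by
    rw [IsCoframeAt.equations]
    funext j
    simp [hA]
  have hx : hω.coordinates (h.solutionGerms hp lam) = Pi.single 0 1 := hlam
  have hB := hω.evalGerm_bracketGerm (h.contDiffAt_a hp) (h.contDiffAt_b hp) g he
    (fun i hi => by rw [hx, Pi.single_eq_of_ne hi])
  have hZ : hω.bracketGerm (germ (h.contDiffAt_a hp)) (germ (h.contDiffAt_b hp))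
      (h.solutionGerms hp lam) = 0 := hω.bracketGerm_eq_zero hA
  rw [hZ, map_zero, hx, Pi.single_eq_same, mul_one] at hB
  rw [h.webCurvature_eq hp]
  refine (mul_eq_zero.1 hB.symm).resolve_left (mul_ne_zero (mul_ne_zero (by norm_num) ?_) ?_)
  · exact sub_ne_zero.2 (sub_ne_zero.1 g.a_sub_one.ne_zero).symm
  · exact sub_ne_zero.2 (sub_ne_zero.1 g.b_sub_one.ne_zero).symm

end IsNormalization
end
end PlanarWebs

open PlanarWebs in
theorem mainTheorem9 (W : PlanarWeb 5) :
    (∃ (θ : Fin 5 → OneForm) (a b : Plane → ℝ), IsNormalization W θ a b) ∧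
    ∀ (θ : Fin 5 → OneForm) (a b : Plane → ℝ), IsNormalization W θ a b →
      (∀ p ∈ W.domain, ∃ c : Fin 6 → ℝ,
        IsObstructionCoefficients (θ 0) (θ 1) a b p c ∧
        (∀ c' : Fin 6 → ℝ, IsObstructionCoefficients (θ 0) (θ 1) a b p c' → c' = c) ∧
        c 0 = c₀Expression (θ 0) (θ 1) a b p ∧
        c 0 = webCurvature θ a b p) ∧
      (W.IsOfMaximumRank → ∀ p ∈ W.domain, webCurvature θ a b p = 0) := by
  refine ⟨exists_normalization W, fun θ a b h => ⟨fun p hp => ?_, fun hr p hp =>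
    h.webCurvature_eq_zero hr hp⟩⟩
  obtain ⟨c, h1, h2, h3⟩ := (h.isCoframeAt hp).exists_obstructionCoefficients
    (h.contDiffAt_a hp) (h.contDiffAt_b hp) (h.generic hp)
  exact ⟨c, h1, h2, h3, h3.trans (h.webCurvature_eq hp).symm⟩
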